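/- Computations are on a word-RAM whose words have $O(\log s)$ bits, where $s$ is the size of the instance, with unit-cost arithmetic, bitwise, comparison and indirect-addressing instructions. For $k\ge 2$, the $k$-OV problem is: given $k$ collections of $n$ vectors in $\{0,1\}^d$, decide whether one can choose a vector $v_j$ from the $j$-th collection for every $j=1,\dots,k$ such that $\sum_{i=1}^d\prod_{j=1}^k v_j[i]=0$. The $k$-OV conjecture states that for no $\varepsilon>0$ is there an algorithm that solves $k$-OV in time $O(n^{k-\varepsilon}\,\mathrm{poly}(d))$. The eccentricity of a vertex $v$ of a graph is $\varepsilon(v)=\max_u d(v,u)$. A $\rho$-approximation for Eccentricities outputs for every vertex $v$ an estimate $\varepsilon'(v)$ such that $\varepsilon(v)\le\varepsilon'(v)\le\rho\,\varepsilon(v)$ for all inputs and all $v$ (approximation from above), or such that $\varepsilon(v)/\rho\le\varepsilon'(v)\le\varepsilon(v)$ for all inputs and all $v$ (approximation from below); the statements below hold for either convention. **Theorem.** Let $C\ge 2$ be an integer, and let $\mathcal G_C$ be the class of connected undirected unweighted graphs with $n$ vertices and at most $Cn$ edges (given by lists of edges), $n\ge1$. 1. For every $k\ge 2$, under the $k$-OV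 conjecture, every algorithm that, given a graph in $\mathcal G_C$, outputs one answer for each vertex which distinguishes eccentricity at most $2k-1$ from eccentricity at least $4k-3$ (with any answer allowed for a vertex of eccentricity strictly between) requires $n^{1+1/(k-1)-o(1)}$ time: for no $\varepsilon>0$ is there such an algorithm that runs in time $O(n^{1+1/(k-1)-\varepsilon})$. 2. In particular, under the $3$-OV conjecture, for all $\varepsilon,\delta>0$, no algorithm computes a $(9/5-\varepsilon)$-approximation for Eccentricities on $\mathcal G_C$ in time $O(n^{3/2-\delta})$. 3. In particular, if the $k$-OV conjecture holds for every $k\ge 2$, then for every $\varepsilon>0$ no algorithm computes a $(2-\varepsilon)$-approximation for Eccentricities on $\mathcal G_C$ in time $n^{1+o(1)}$. -/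

import Mathlib

open Filter Topology

namespace WordRAM

/-- The unit-cost operations on words. Subtraction is truncated at `0`, division and remainder are
those of `ℕ`, and comparisons return `1` for true and `0` for false. -/
inductive BinOp
  | add | sub | mul | div | mod | land | lor | xor | shl | shr | lt | eq

/-- The value of an operation, before the test that it fits into a word. -/
def BinOp.eval : BinOp → ℕ → ℕ → ℕ
  | .add, x, y => x + y
  | .sub, x, y => x - y
  | .mul, x, y => x * y
  | .div, x, y => x / y
  | .mod, x, y => x % y
  | .land, x, y => x &&& y
  | .lor, x, y => x ||| y
  | .xor, x, y => x ^^^ y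
  | .shl, x, y => x <<< y
  | .shr, x, y => x >>> y
  | .lt, x, y => if x < y then 1 else 0
  | .eq, x, y => if x = y then 1 else 0

/-- Word-RAM programs. The names `r a b` are (fixed) register numbers. -/
inductive Prog
  /-- do nothing -/
  | skip
  /-- `R[r] := v` -/
  | const (r v : ℕ)
  /-- `R[r] := R[a] o R[b]` -/
  | op (o : BinOp) (r a b : ℕ)
  /-- `R[r] := M[R[a]]` -/
  | load (r a : ℕ)
  /-- `M[R[a]] := R[b]` -/
  | store (a b : ℕ)
  /-- first `p`, then `q` -/
  | seq (p q : Prog)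
  /-- if `R[r] ≠ 0` then `p` else `q` -/
  | ite (r : ℕ) (p q : Prog)
  /-- while `R[r] ≠ 0` do `p` -/
  | loop (r : ℕ) (p : Prog)

/-- A configuration: the contents of the registers and of the random-access memory. -/
structure State where
  reg : ℕ → ℕ
  mem : ℕ → ℕ

/-- The initial configuration on input `x`: the words of `x` stand in the memory cells
`0, 1, …, x.length - 1`; all other cells and all registers are `0`. -/
def State.start (x : List ℕ) : State where
  reg := fun _ => 0
  mem := fun a => x.getD a 0

/-- `Exec w p s t s'`: on a machine with `w`-bit words the program `p`, started in the
configuration `s`, halts after exactly `t` steps in the configuration `s'`. Every executed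
instruction and every evaluated test is one step. A run in which a number that does not fit into
`w` bits would enter a register is aborted, that is, there is no such `s'`. -/
inductive Exec (w : ℕ) : Prog → State → ℕ → State → Prop
  | skip (s : State) : Exec w .skip s 1 s
  | const (s : State) (r v : ℕ) (h : v < 2 ^ w) :
      Exec w (.const r v) s 1 { s with reg := Function.update s.reg r v }
  | op (s : State) (o : BinOp) (r a b : ℕ) (h : o.eval (s.reg a) (s.reg b) < 2 ^ w) :
      Exec w (.op o r a b) s 1
        { s with reg := Function.update s.reg r (o.eval (s.reg a) (s.reg b)) }
  | load (s : State) (r a : ℕ) (h : s.mem (s.reg a) < 2 ^ w) :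
      Exec w (.load r a) s 1 { s with reg := Function.update s.reg r (s.mem (s.reg a)) }
  | store (s : State) (a b : ℕ) :
      Exec w (.store a b) s 1 { s with mem := Function.update s.mem (s.reg a) (s.reg b) }
  | seq {p q : Prog} {s₁ s₂ s₃ : State} {t u : ℕ}
      (hp : Exec w p s₁ t s₂) (hq : Exec w q s₂ u s₃) : Exec w (.seq p q) s₁ (t + u) s₃
  | ite_true {r : ℕ} {p q : Prog} {s s' : State} {t : ℕ}
      (hr : s.reg r ≠ 0) (hp : Exec w p s t s') : Exec w (.ite r p q) s (t + 1) s'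
  | ite_false {r : ℕ} {p q : Prog} {s s' : State} {t : ℕ}
      (hr : s.reg r = 0) (hq : Exec w q s t s') : Exec w (.ite r p q) s (t + 1) s'
  | loop_done {r : ℕ} {p : Prog} {s : State}
      (hr : s.reg r = 0) : Exec w (.loop r p) s 1 s
  | loop_step {r : ℕ} {p : Prog} {s₁ s₂ s₃ : State} {t u : ℕ}
      (hr : s₁.reg r ≠ 0) (hp : Exec w p s₁ t s₂) (hl : Exec w (.loop r p) s₂ u s₃) :
      Exec w (.loop r p) s₁ (t + u + 1) s₃

/-- The word size `c · (⌊log₂ s⌋ + 1)` of a machine with `O(log s)`-bit words; the constant `c` is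
chosen together with the program. -/
def wordSize (c s : ℕ) : ℕ := c * (Nat.log 2 s + 1)

/-- With `w`-bit words and on input `x`, the program `p` halts after at most `T` steps, without
overflow, with final memory contents `out` such that `Q out`. -/
def RunsWithin (p : Prog) (w : ℕ) (x : List ℕ) (T : ℝ) (Q : (ℕ → ℕ) → Prop) : Prop :=
  ∃ (t : ℕ) (s : State), Exec w p (State.start x) t s ∧ (t : ℝ) ≤ T ∧ Q s.mem

end WordRAM

open WordRAM

/-! ### Orthogonal vectors -/

/-- The `k` collections `A 0, …, A (k-1)` of `n` vectors in `{0,1}^d` each contain vectors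
`A 0 (v 0), …, A (k-1) (v (k-1))` whose generalized inner product is `0`. -/
def HasOrthogonalTuple {k n d : ℕ} (A : Fin k → Fin n → Fin d → Bool) : Prop :=
  ∃ v : Fin k → Fin n, ∑ l : Fin d, ∏ i : Fin k, (A i (v i) l).toNat = 0

/-- The encoding of an instance of `k`-OV: `n`, `d`, then all coordinates of all vectors of all
collections in lexicographic order of (collection, vector, coordinate), one word each. -/
def ovInput {k n d : ℕ} (A : Fin k → Fin n → Fin d → Bool) : List ℕ :=
  n :: d :: (List.finRange k).flatMap fun i => (List.finRange n).flatMap fun j =>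
    (List.finRange d).map fun l => (A i j l).toNat

/-- The `k`-OV conjecture: for no `ε > 0` is there a word-RAM algorithm (with words of
logarithmically many bits) that decides `k`-OV on `n` vectors per collection and dimension `d` in
time `n ^ (k - ε) · poly(d)`. The answer is "yes" if memory cell `0` is nonzero at the end. -/
def KOVConjecture (k : ℕ) : Prop :=
  ∀ ε : ℝ, 0 < ε → ¬ ∃ (p : Prog) (c : ℕ) (K : ℝ) (a : ℕ),
    ∀ n d : ℕ, 1 ≤ n → 1 ≤ d → ∀ A : Fin k → Fin n → Fin d → Bool,
      RunsWithin p (wordSize c (n * d)) (ovInput A)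
        (K * (n : ℝ) ^ ((k : ℝ) - ε) * (d : ℝ) ^ a)
        (fun out => out 0 ≠ 0 ↔ HasOrthogonalTuple A)

/-! ### Eccentricities in sparse graphs -/

/-- `L` lists every edge of `G` exactly once (with its end points in some order). -/
def IsEdgeList {n : ℕ} (G : SimpleGraph (Fin n)) (L : List (Fin n × Fin n)) : Prop :=
  (L.map fun e => s(e.1, e.2)).Nodup ∧
    ∀ u v : Fin n, G.Adj u v ↔ s(u, v) ∈ L.map fun e => s(e.1, e.2)

/-- The encoding of a graph on `n` vertices `0, …, n-1` with edge list `L`: the number of vertices,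
the number of edges, then the end points of the edges. -/
def graphInput {n : ℕ} (L : List (Fin n × Fin n)) : List ℕ :=
  n :: L.length :: L.flatMap fun e => [(e.1 : ℕ), (e.2 : ℕ)]

/-- A task on graphs: which final memory contents are correct for which graph. -/
abbrev GraphTask := ∀ n : ℕ, SimpleGraph (Fin n) → (ℕ → ℕ) → Prop

/-- There is a word-RAM algorithm (with `O(log n)`-bit words) that performs `task` on every
connected undirected unweighted graph with `n` vertices and at most `C · n` edges, given by any of
its edge lists, in time `T n`. -/
def SolvableOnSparse (C : ℕ) (task : GraphTask) (T : ℕ → ℝ) : Prop :=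
  ∃ (p : Prog) (c : ℕ), ∀ (n : ℕ) (G : SimpleGraph (Fin n)) (L : List (Fin n × Fin n)),
    G.Connected → IsEdgeList G L → L.length ≤ C * n →
      RunsWithin p (wordSize c n) (graphInput L) (T n) (task n G)

/-- For every vertex `v`, memory cell `v` tells whether the eccentricity of `v` is at most `lo`
(cell `v` is zero) or at least `hi` (cell `v` is nonzero). Nothing is asked in between. -/
def eccGap (lo hi : ℕ) : GraphTask := fun n G out =>
  ∀ v : Fin n, (G.eccent v ≤ (lo : ℕ∞) → out v = 0) ∧ ((hi : ℕ∞) ≤ G.eccent v → out v ≠ 0)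

/-- For every vertex `v`, memory cell `v` is a `ρ`-approximation from above of the eccentricity of
`v`: at least the eccentricity, and at most `ρ` times the eccentricity. (The eccentricities of a
finite connected graph are finite.) -/
def eccApproxAbove (ρ : ℝ) : GraphTask := fun n G out =>
  ∀ v : Fin n, (((G.eccent v).toNat : ℕ) : ℝ) ≤ out v ∧ (out v : ℝ) ≤ ρ * ((G.eccent v).toNat : ℕ)

/-- For every vertex `v`, memory cell `v` is a `ρ`-approximation from below of the eccentricity of
`v`: at most the eccentricity, which is at most `ρ` times the cell. -/
def eccApproxBelow (ρ : ℝ) : GraphTask := fun n G out =>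
  ∀ v : Fin n, (out v : ℝ) ≤ ((G.eccent v).toNat : ℕ) ∧ (((G.eccent v).toNat : ℕ) : ℝ) ≤ ρ * out v

set_option linter.unusedSectionVars false

namespace WordRAM

/-! ### Invariants and relocation of programs -/

/-! Put `K = k - 1`. An instance of `k`-OV is turned into a connected graph with `N = O(n^K d^K)`
vertices (`K` is fixed) and at most `2N` edges, together with `n^K` (after padding, `(n+1)^K`)
source vertices. If no orthogonal tuple exists, every source has eccentricity at most `2K+1`;
otherwise some source has eccentricity at least `4K+1`. The graph is written down in time `O(N)`.
Since `(n^K)^(1+1/K-δ) = n^(K+1-Kδ)`, an algorithm for the gap problem that is too fast would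
violate the conjecture. The two approximation bounds follow because the ratio `(4K+1)/(2K+1)` is
`9/5` for `K = 2` and tends to `2`.

The graph has layers `0, …, 3K+1`. Layer `0` is a hub, from which a path of length `K` leads to each
source in layer `K`; a source lists vectors `a_0, …, a_{K-1}` of the collections `1, …, K`. A vertex
of layer `2K+1` lists vectors `b_0, …, b_{K-1}` of the collections `0, …, K-1` and starts a pendant
path of length `K`. The `K+1` gaps in between exchange the `a_i` for the `b_i` one at a time: layer
`K+1+i` omits position `i`. The middle layers also carry coordinates `X_0, …, X_{K-1}`, fixed
throughout these layers, and the edges check that certain listed vectors are `1` at certain `X_m`.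

Without an orthogonal tuple, let `X_m` be a common `1` of `b_0, …, b_m, a_m, …, a_{K-1}`. All checks
succeed, so layers `K` and `2K+1` are at distance at most `K+1`, and any other vertex is near one of
them (`edist_le_of_no_tuple`).

With an orthogonal tuple `v`, take `a_q = v_{q+1}`, `b_q = v_q` and the far end of the pendant path
of `b`. A walk through the hub needs `K + (3K+1)` steps. A shorter walk avoiding the hub has fewer
than `K` backward steps, so two gaps `g < g'` are never crossed backwards and each is crossed
exactly once. The crossing of `g` checks the `a_q` with `q ≥ g`, that of `g'` the `b_q` with `q <
g'`, against the same `X`. At `X_{g'-1}` all of `v_0, …, v_K` are then `1`, a contradiction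
(`Trace`, `le_length_of_tuple`).

Adding an all-ones vector to each collection, and `K+1` coordinates that keep it from creating
orthogonal tuples, gives a harmless placeholder for omitted vectors and makes the graph connected.
Labels that do not name a proper vertex become leaves at the hub, so vertex numbers are plain
mixed-radix numbers.

On the machine side, vertex numbers and edge tests are arithmetic expressions of fixed size, hence
polynomially bounded and within words of `O(log (nd))` bits. The given algorithm runs on the graph
with its addresses shifted past the instance (`Exec.relocate`), and a final loop inspects its
outputs at the sources. -/

theorem BinOp.eval_or_self (x : ℕ) : BinOp.lor.eval x x = x := Nat.or_self x

theorem update_lt {b : ℕ} {f : ℕ → ℕ} (r v : ℕ) (hf : ∀ a, f a < b) (hv : v < b) (a : ℕ) :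
    Function.update f r v a < b := by
  by_cases h : a = r
  · simpa [h] using hv
  · simpa [h] using hf a

/-- On `w`-bit words all registers keep values below `2 ^ w`. -/
theorem Exec.reg_lt {w : ℕ} {p : Prog} {s s' : State} {t : ℕ} (e : Exec w p s t s') :
    (∀ r, s.reg r < 2 ^ w) → ∀ r, s'.reg r < 2 ^ w := by
  induction e with
  | skip s => exact id
  | const s r v h => exact fun h1 => update_lt r v h1 h
  | op s o r a b h => exact fun h1 => update_lt r _ h1 h
  | load s r a h => exact fun h1 => update_lt r _ h1 h
  | store s a b => exact id
  | seq _ _ ih1 ih2 => exact fun h1 => ih2 (ih1 h1)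
  | ite_true _ _ ih => exact ih
  | ite_false _ _ ih => exact ih
  | loop_done _ => exact id
  | loop_step _ _ _ ih1 ih2 => exact fun h1 => ih2 (ih1 h1)

/-- A bound on the memory which is at least `2 ^ w` is preserved. -/
theorem Exec.mem_lt {w W : ℕ} (hW : 2 ^ w ≤ W) {p : Prog} {s s' : State} {t : ℕ}
    (e : Exec w p s t s') :
    (∀ r, s.reg r < 2 ^ w) → (∀ a, s.mem a < W) → ∀ a, s'.mem a < W := by
  induction e with
  | store s a b => exact fun h1 h2 => update_lt _ _ h2 ((h1 b).trans_le hW)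
  | seq e1 _ ih1 ih2 => exact fun h1 h2 => ih2 (e1.reg_lt h1) (ih1 h1 h2)
  | ite_true _ _ ih => exact ih
  | ite_false _ _ ih => exact ih
  | loop_step _ e1 _ ih1 ih2 => exact fun h1 h2 => ih2 (e1.reg_lt h1) (ih1 h1 h2)
  | _ => exact fun _ h2 => h2

/-- A strict upper bound for the registers that occur in a program. -/
def Prog.regBound : Prog → ℕ
  | .skip => 0
  | .const r _ => r + 1
  | .op _ r a b => max (r + 1) (max (a + 1) (b + 1))
  | .load r a => max (r + 1) (a + 1)
  | .store a b => max (a + 1) (b + 1)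
  | .seq p q => max p.regBound q.regBound
  | .ite r p q => max (r + 1) (max p.regBound q.regBound)
  | .loop r p => max (r + 1) p.regBound

/-- The program with all its memory addresses shifted by the contents of the register `bs`. -/
def Prog.relocate (bs tmp : ℕ) : Prog → Prog
  | .load r a => .seq (.op .add tmp a bs) (.load r tmp)
  | .store a b => .seq (.op .add tmp a bs) (.store tmp b)
  | .seq p q => .seq (p.relocate bs tmp) (q.relocate bs tmp)
  | .ite r p q => .ite r (p.relocate bs tmp) (q.relocate bs tmp)
  | .loop r p => .loop r (p.relocate bs tmp)
  | .skip => .skip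
  | .const r v => .const r v
  | .op o r a b => .op o r a b

/-- `u` represents `s` on the registers below `R` and on the memory from `B` on, and agrees with
`v` on all other registers except `tmp` and on the memory below `B`. -/
structure Represents (R tmp B : ℕ) (v s u : State) : Prop where
  low : ∀ r < R, u.reg r = s.reg r
  high : ∀ r, R ≤ r → r ≠ tmp → u.reg r = v.reg r
  mem : ∀ a, u.mem (B + a) = s.mem a
  below : ∀ a < B, u.mem a = v.mem a

theorem Represents.update_tmp {R tmp B : ℕ} {v s u : State} (h : Represents R tmp B v s u)
    (htmp : R ≤ tmp) (x : ℕ) :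
    Represents R tmp B v s { u with reg := Function.update u.reg tmp x } where
  low r hr := by simpa [Function.update_of_ne (show r ≠ tmp by omega)] using h.low r hr
  high r hr hne := by simpa [Function.update_of_ne hne] using h.high r hr hne
  mem := h.mem
  below := h.below

theorem Represents.update_reg {R tmp B : ℕ} {v s u : State} (h : Represents R tmp B v s u)
    {r : ℕ} (hr : r < R) (x : ℕ) :
    Represents R tmp B v { s with reg := Function.update s.reg r x }
      { u with reg := Function.update u.reg r x } where
  low q hq := by
    by_cases hqr : q = r
    · simp [hqr]
    · simpa [Function.update_of_ne hqr] using h.low q hq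
  high q hq hne := by
    simpa [Function.update_of_ne (show q ≠ r by omega)] using h.high q hq hne
  mem := h.mem
  below := h.below

theorem Represents.update_mem {R tmp B : ℕ} {v s u : State} (h : Represents R tmp B v s u)
    (a x : ℕ) :
    Represents R tmp B v { s with mem := Function.update s.mem a x }
      { u with mem := Function.update u.mem (B + a) x } where
  low := h.low
  high := h.high
  mem b := by
    by_cases hb : b = a
    · simp [hb]
    · simpa [Function.update_of_ne hb, Function.update_of_ne (show B + b ≠ B + a by omega)]
        using h.mem b
  below b hb := by
    simpa [Function.update_of_ne (show b ≠ B + a by omega)] using h.below b hb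

/-- Only loads and stores change, each gaining one addition, hence the factor 2 in time. A shifted
address is a register content plus `B`, which is why `2 ^ w + B ≤ 2 ^ w'` suffices. The program
itself never touches `bs` or `tmp`, both lying at or above its register bound. -/
theorem Exec.relocate {w w' R bs tmp B : ℕ} (hw : 2 ^ w + B ≤ 2 ^ w') (hbs : R ≤ bs)
    (htmp : R ≤ tmp) (hne : bs ≠ tmp) {v : State} (hv : v.reg bs = B) {p : Prog} {s s' : State}
    {t : ℕ} (e : Exec w p s t s') :
    p.regBound ≤ R → (∀ r, s.reg r < 2 ^ w) → ∀ u, Represents R tmp B v s u →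
      ∃ t' u', Exec w' (p.relocate bs tmp) u t' u' ∧ t' ≤ 2 * t ∧ Represents R tmp B v s' u' := by
  have hp0 : 0 < 2 ^ w := by positivity
  have addr : ∀ {u s : State} {a : ℕ}, Represents R tmp B v s u → a < R →
      (∀ r, s.reg r < 2 ^ w) →
      Exec w' (.op .add tmp a bs) u 1
        { u with reg := Function.update u.reg tmp (B + s.reg a) } := by
    intro u s a hu ha hs
    have h := Exec.op (w := w') u .add tmp a bs (by
      simp only [BinOp.eval]
      rw [hu.low a ha, hu.high bs hbs hne, hv]
      have := hs a
      omega)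
    simp only [BinOp.eval] at h
    rwa [hu.low a ha, hu.high bs hbs hne, hv, add_comm] at h
  induction e with
  | skip s => exact fun _ _ u hu => ⟨1, u, .skip u, by omega, hu⟩
  | const s r x h =>
    intro hR hs u hu
    simp only [Prog.regBound] at hR
    exact ⟨1, _, .const u r x (by omega), by omega, hu.update_reg (by omega) x⟩
  | op s o r a b h =>
    intro hR hs u hu
    simp only [Prog.regBound, max_le_iff] at hR
    have ha := hu.low a (by omega)
    have hb := hu.low b (by omega)
    refine ⟨1, _, .op u o r a b ?_, by omega, ?_⟩
    · rw [ha, hb]; omega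
    · rw [ha, hb]; exact hu.update_reg (by omega) _
  | load s r a h =>
    intro hR hs u hu
    simp only [Prog.regBound, max_le_iff] at hR
    have h1 := addr hu (show a < R by omega) hs
    have hu1 := hu.update_tmp htmp (B + s.reg a)
    refine ⟨1 + 1, _, .seq h1 (.load _ r tmp ?_), by omega, ?_⟩
    · simp only [Function.update_self]
      rw [hu.mem]; omega
    · simp only [Function.update_self]
      rw [hu.mem]
      exact hu1.update_reg (by omega) _
  | store s a b =>
    intro hR hs u hu
    simp only [Prog.regBound, max_le_iff] at hR
    have h1 := addr hu (show a < R by omega) hs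
    have hu1 := hu.update_tmp htmp (B + s.reg a)
    refine ⟨1 + 1, _, .seq h1 (.store _ tmp b), by omega, ?_⟩
    have hb := hu1.low b (by omega)
    simp only at hb
    simp only [Function.update_self]
    rw [hb]
    exact hu1.update_mem _ _
  | seq e1 e2 ih1 ih2 =>
    intro hR hs u hu
    simp only [Prog.regBound, max_le_iff] at hR
    obtain ⟨t1, u1, x1, l1, r1⟩ := ih1 hR.1 hs u hu
    obtain ⟨t2, u2, x2, l2, r2⟩ := ih2 hR.2 (e1.reg_lt hs) u1 r1
    exact ⟨t1 + t2, u2, .seq x1 x2, by omega, r2⟩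
  | ite_true hr e ih =>
    intro hR hs u hu
    simp only [Prog.regBound, max_le_iff] at hR
    obtain ⟨t1, u1, x1, l1, r1⟩ := ih hR.2.1 hs u hu
    exact ⟨t1 + 1, u1, .ite_true (by rw [hu.low _ (by omega)]; exact hr) x1, by omega, r1⟩
  | ite_false hr e ih =>
    intro hR hs u hu
    simp only [Prog.regBound, max_le_iff] at hR
    obtain ⟨t1, u1, x1, l1, r1⟩ := ih hR.2.2 hs u hu
    exact ⟨t1 + 1, u1, .ite_false (by rw [hu.low _ (by omega)]; exact hr) x1, by omega, r1⟩
  | loop_done hr =>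
    intro hR hs u hu
    simp only [Prog.regBound, max_le_iff] at hR
    exact ⟨1, u, .loop_done (by rw [hu.low _ (by omega)]; exact hr), by omega, hu⟩
  | loop_step hr e1 e2 ih1 ih2 =>
    intro hR hs u hu
    have hR' := hR
    simp only [Prog.regBound, max_le_iff] at hR
    obtain ⟨t1, u1, x1, l1, r1⟩ := ih1 hR.2 hs u hu
    obtain ⟨t2, u2, x2, l2, r2⟩ := ih2 hR' (e1.reg_lt hs) u1 r1
    exact ⟨t1 + t2 + 1, u2, .loop_step (by rw [hu.low _ (by omega)]; exact hr) x1 x2, by omega, r2⟩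

/-! ### Compiling arithmetic expressions -/

/-- The operations of arithmetic expressions. -/
inductive ArithOp
  | add | sub | mul | div | mod | lt | eq

def ArithOp.toBinOp : ArithOp → BinOp
  | .add => .add
  | .sub => .sub
  | .mul => .mul
  | .div => .div
  | .mod => .mod
  | .lt => .lt
  | .eq => .eq

/-- Arithmetic expressions over registers, numerals and memory cells. -/
inductive Ex
  | var (r : ℕ)
  | num (v : ℕ)
  | op (o : ArithOp) (a b : Ex)
  | get (a : Ex)

namespace Ex

/-- The value of an expression. -/
def eval (s : State) : Ex → ℕ
  | var r => s.reg r
  | num v => v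
  | op o a b => o.toBinOp.eval (a.eval s) (b.eval s)
  | get a => s.mem (a.eval s)

/-- The number of leaves of an expression. -/
def size : Ex → ℕ
  | var _ => 1
  | num _ => 1
  | op _ a b => a.size + b.size
  | get a => a.size

/-- The number of instructions of the compiled expression. -/
def steps : Ex → ℕ
  | var _ => 1
  | num _ => 1
  | op _ a b => a.steps + b.steps + 1
  | get a => a.steps + 1

/-- A strict upper bound for the registers that occur in an expression. -/
def varBound : Ex → ℕ
  | var r => r + 1
  | num _ => 0
  | op _ a b => max a.varBound b.varBound
  | get a => a.varBound

/-- An upper bound for the numerals that occur in an expression. -/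
def numBound : Ex → ℕ
  | var _ => 0
  | num v => v
  | op _ a b => max a.numBound b.numBound
  | get a => a.numBound

/-- The program that computes the value of an expression in register `t`, with the registers
above `t` as scratch space. -/
def compile : Ex → ℕ → Prog
  -- There is no register-to-register move; `x ||| x = x` provides one.
  | var r, t => .op .lor t r r
  | num v, t => .const t v
  | op o a b, t => .seq (a.compile t) (.seq (b.compile (t + 1)) (.op o.toBinOp t t (t + 1)))
  | get a, t => .seq (a.compile t) (.load t t)

theorem one_le_size (e : Ex) : 1 ≤ e.size := by
  induction e <;> simp only [size] <;> omega

end Ex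

theorem ArithOp.eval_le {B x y a b : ℕ} (o : ArithOp) (hB : 2 ≤ B) (ha : 1 ≤ a) (hb : 1 ≤ b)
    (hx : x ≤ B ^ a) (hy : y ≤ B ^ b) : o.toBinOp.eval x y ≤ B ^ (a + b) := by
  have h2a : 2 ≤ B ^ a := hB.trans (Nat.le_self_pow (by omega) B)
  have h2b : 2 ≤ B ^ b := hB.trans (Nat.le_self_pow (by omega) B)
  have hab : B ^ a ≤ B ^ a * B ^ b := Nat.le_mul_of_pos_right _ (by omega)
  rw [pow_add]
  cases o <;> simp only [toBinOp, BinOp.eval]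
  · nlinarith
  · omega
  · exact Nat.mul_le_mul hx hy
  · exact (Nat.div_le_self _ _).trans (hx.trans hab)
  · exact (Nat.mod_le _ _).trans (hx.trans hab)
  · split_ifs <;> omega
  · split_ifs <;> omega

/-- Registers below `t` and all memory cells contain numbers of size at most `B`. -/
structure State.Bounded (t B : ℕ) (s : State) : Prop where
  reg : ∀ r < t, s.reg r ≤ B
  mem : ∀ a, s.mem a ≤ B

namespace Ex

/-- Reading a cell returns a number at most `B` whatever the address, so growth comes only from the
arithmetic and is bounded by the number of leaves. For a fixed expression this is polynomial in `B`.
-/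
theorem eval_le {B t : ℕ} {s : State} (hs : s.Bounded t B) (hB : 2 ≤ B) (e : Ex)
    (ht : e.varBound ≤ t) (hn : e.numBound ≤ B) : e.eval s ≤ B ^ e.size := by
  induction e with
  | var r => simpa [eval, size] using hs.reg r (by simpa [varBound] using ht)
  | num v => simpa [eval, size, numBound] using hn
  | op o a b iha ihb =>
    simp only [varBound, numBound, max_le_iff] at ht hn
    exact o.eval_le hB a.one_le_size b.one_le_size (iha ht.1 hn.1) (ihb ht.2 hn.2)
  | get a ih =>
    simp only [eval, size]
    exact (hs.mem _).trans (Nat.le_self_pow (by have := a.one_le_size; omega) B)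

/-- The expression uses registers below `t`, numerals up to `B`, and has size at most `m`. -/
structure Fits (t B m : ℕ) (e : Ex) : Prop where
  var : e.varBound ≤ t
  num : e.numBound ≤ B
  size : e.size ≤ m

/-- The induction is over all target registers `t' ≥ t`: the second operand is evaluated at `t' + 1`
while the first one waits in `t'`. Only agreement with `s` below `t` is needed, so waiting operands
do not disturb the evaluation. -/
theorem exec_compile {B t w m : ℕ} {s : State} (hs : s.Bounded t B) (hB : 2 ≤ B)
    (hw : B ^ m < 2 ^ w) (e : Ex) :
    e.Fits t B m → ∀ t' ≥ t, ∀ u : State, (∀ r < t, u.reg r = s.reg r) → u.mem = s.mem →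
      ∃ u', Exec w (e.compile t') u e.steps u' ∧ u'.reg t' = e.eval s ∧
        (∀ r < t', u'.reg r = u.reg r) ∧ u'.mem = u.mem := by
  have key : ∀ e : Ex, e.Fits t B m → e.eval s < 2 ^ w := fun e he =>
    ((e.eval_le hs hB he.var he.num).trans (Nat.pow_le_pow_right (by omega) he.size)).trans_lt hw
  have frame : ∀ (u : State) (t' v : ℕ), ∀ r < t', Function.update u.reg t' v r = u.reg r :=
    fun u t' v r hr => Function.update_of_ne (by omega) _ _
  induction e with
  | var r =>
    intro he t' ht' u hr hm
    have hv := he.var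
    have hk := key _ he
    simp only [varBound] at hv
    simp only [eval] at hk ⊢
    have hx := Exec.op (w := w) u .lor t' r r (by rw [BinOp.eval_or_self, hr r (by omega)]; exact hk)
    rw [BinOp.eval_or_self, hr r (by omega)] at hx
    exact ⟨_, hx, by simp, frame u t' _, rfl⟩
  | num v =>
    intro he t' ht' u hr hm
    exact ⟨_, .const u t' v (key _ he), by simp [eval], frame u t' _, rfl⟩
  | op o a b iha ihb =>
    intro he t' ht' u hr hm
    have hv := he.var
    have hn := he.num
    have hz := he.size
    have hk := key _ he
    simp only [varBound, numBound, max_le_iff, size] at hv hn hz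
    obtain ⟨u1, x1, v1, f1, m1⟩ := iha ⟨hv.1, hn.1, by omega⟩ t' ht' u hr hm
    obtain ⟨u2, x2, v2, f2, m2⟩ := ihb ⟨hv.2, hn.2, by omega⟩ (t' + 1) (by omega) u1
      (fun r h => (f1 r (by omega)).trans (hr r h)) (m1.trans hm)
    have e2 : u2.reg t' = a.eval s := (f2 t' (by omega)).trans v1
    simp only [eval] at hk
    have hx := Exec.op (w := w) u2 o.toBinOp t' t' (t' + 1) (by rw [e2, v2]; exact hk)
    rw [e2, v2] at hx
    have hxx := Exec.seq x1 (Exec.seq x2 hx)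
    refine ⟨_, hxx, by simp [eval], ?_, m2.trans m1⟩
    · intro r h
      simp only [frame _ _ _ r h]
      exact (f2 r (by omega)).trans (f1 r h)
  | get a ih =>
    intro he t' ht' u hr hm
    have hk := key _ he
    obtain ⟨u1, x1, v1, f1, m1⟩ := ih ⟨he.var, he.num, he.size⟩ t' ht' u hr hm
    simp only [eval] at hk
    have hx := Exec.load (w := w) u1 t' t' (by rw [v1, m1, hm]; exact hk)
    rw [v1, m1, hm] at hx
    refine ⟨_, .seq x1 hx, by simp [eval], ?_, hm.symm⟩
    intro r h
    simp only [frame _ _ _ r h]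
    exact f1 r h

end Ex

/-! ### Structured programs -/

/-- The two configurations agree on the registers below `t` and on the memory. -/
structure Agree (t : ℕ) (s u : State) : Prop where
  reg : ∀ r < t, u.reg r = s.reg r
  mem : u.mem = s.mem

/-- From every configuration that agrees with `s`, the program reaches in at most `T` steps a
configuration that agrees with `s'`. -/
def Does (w t T : ℕ) (p : Prog) (s s' : State) : Prop :=
  ∀ u, Agree t s u → ∃ k u', Exec w p u k u' ∧ k ≤ T ∧ Agree t s' u'

theorem Does.seq {w t T U : ℕ} {p q : Prog} {s₁ s₂ s₃ : State} (hp : Does w t T p s₁ s₂)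
    (hq : Does w t U q s₂ s₃) : Does w t (T + U) (.seq p q) s₁ s₃ := by
  intro u hu
  obtain ⟨k, u1, x1, l1, a1⟩ := hp u hu
  obtain ⟨l, u2, x2, l2, a2⟩ := hq u1 a1
  exact ⟨k + l, u2, .seq x1 x2, by omega, a2⟩

theorem Does.mono {w t T U : ℕ} {p : Prog} {s s' : State} (hp : Does w t T p s s')
    (h : T ≤ U) : Does w t U p s s' := by
  intro u hu
  obtain ⟨k, u1, x1, l1, a1⟩ := hp u hu
  exact ⟨k, u1, x1, by omega, a1⟩

theorem Does.skip (w t : ℕ) (s : State) : Does w t 1 .skip s s :=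
  fun u hu => ⟨1, u, .skip u, le_rfl, hu⟩

/-- The configuration with register `r` changed to `v`. -/
def State.setReg (s : State) (r v : ℕ) : State := { s with reg := Function.update s.reg r v }

/-- The configuration with memory cell `a` changed to `v`. -/
def State.setMem (s : State) (a v : ℕ) : State := { s with mem := Function.update s.mem a v }

/-- Assign the value of an expression to the register `r`. -/
def Prog.assign (t r : ℕ) (e : Ex) : Prog := .seq (e.compile t) (.op .lor r t t)

/-- Write the value of an expression to the memory. -/
def Prog.write (t : ℕ) (a e : Ex) : Prog :=
  .seq (a.compile t) (.seq (e.compile (t + 1)) (.store t (t + 1)))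

/-- Run a program if the value of an expression is not zero. -/
def Prog.when (t : ℕ) (e : Ex) (p : Prog) : Prog := .seq (e.compile t) (.ite t p .skip)

/-- Run a program for the values `0, 1, …` of register `r` below the value of an expression. -/
def Prog.upTo (t r : ℕ) (e : Ex) (p : Prog) : Prog :=
  .seq (.assign t r (.num 0)) (.seq ((Ex.op .lt (.var r) e).compile t)
    (.loop t (.seq p (.seq (.assign t r (.op .add (.var r) (.num 1)))
      ((Ex.op .lt (.var r) e).compile t)))))

section

variable {B t w m : ℕ} {s : State}

theorem does_assign (hs : s.Bounded t B) (hB : 2 ≤ B) (hw : B ^ m < 2 ^ w) {e : Ex}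
    (he : e.Fits t B m) (r : ℕ) :
    Does w t (e.steps + 1) (.assign t r e) s (s.setReg r (e.eval s)) := by
  intro u hu
  obtain ⟨u1, x1, v1, f1, m1⟩ := e.exec_compile hs hB hw he t le_rfl u hu.reg hu.mem
  have hlt : e.eval s < 2 ^ w :=
    ((e.eval_le hs hB he.var he.num).trans (Nat.pow_le_pow_right (by omega) he.size)).trans_lt hw
  have hx := Exec.op (w := w) u1 .lor r t t (by rw [BinOp.eval_or_self, v1]; exact hlt)
  rw [BinOp.eval_or_self, v1] at hx
  refine ⟨_, _, .seq x1 hx, le_rfl, fun q hq => ?_, m1.trans hu.mem⟩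
  by_cases h : q = r
  · simp [State.setReg, h]
  · simpa [State.setReg, Function.update_of_ne h] using (f1 q hq).trans (hu.reg q hq)

theorem does_write (hs : s.Bounded t B) (hB : 2 ≤ B) (hw : B ^ m < 2 ^ w) {a e : Ex}
    (ha : a.Fits t B m) (he : e.Fits t B m) :
    Does w t (a.steps + e.steps + 1) (.write t a e) s (s.setMem (a.eval s) (e.eval s)) := by
  intro u hu
  obtain ⟨u1, x1, v1, f1, m1⟩ := a.exec_compile hs hB hw ha t le_rfl u hu.reg hu.mem
  obtain ⟨u2, x2, v2, f2, m2⟩ := e.exec_compile hs hB hw he (t + 1) (by omega) u1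
    (fun r h => (f1 r h).trans (hu.reg r h)) (m1.trans hu.mem)
  refine ⟨_, _, .seq x1 (.seq x2 (.store u2 t (t + 1))), by omega, fun q hq => ?_, ?_⟩
  · exact (f2 q (by omega)).trans ((f1 q hq).trans (hu.reg q hq))
  · simp only [State.setMem]
    rw [f2 t (by omega), v1, v2, m2, m1, hu.mem]

theorem does_when_true (hs : s.Bounded t B) (hB : 2 ≤ B) (hw : B ^ m < 2 ^ w) {e : Ex}
    (he : e.Fits t B m) (hne : e.eval s ≠ 0) {T : ℕ} {p : Prog} {s' : State}
    (hp : Does w t T p s s') : Does w t (e.steps + T + 1) (.when t e p) s s' := by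
  intro u hu
  obtain ⟨u1, x1, v1, f1, m1⟩ := e.exec_compile hs hB hw he t le_rfl u hu.reg hu.mem
  obtain ⟨k, u2, x2, l2, a2⟩ := hp u1 ⟨fun r h => (f1 r h).trans (hu.reg r h), m1.trans hu.mem⟩
  exact ⟨_, u2, .seq x1 (.ite_true (by rwa [v1]) x2), by omega, a2⟩

theorem does_when_false (hs : s.Bounded t B) (hB : 2 ≤ B) (hw : B ^ m < 2 ^ w) {e : Ex}
    (he : e.Fits t B m) (h0 : e.eval s = 0) (T : ℕ) (p : Prog) :
    Does w t (e.steps + T + 2) (.when t e p) s s := by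
  intro u hu
  obtain ⟨u1, x1, v1, f1, m1⟩ := e.exec_compile hs hB hw he t le_rfl u hu.reg hu.mem
  exact ⟨_, u1, .seq x1 (.ite_false (by rwa [v1]) (.skip u1)), by omega,
    ⟨fun r h => (f1 r h).trans (hu.reg r h), m1.trans hu.mem⟩⟩

/-- `σ i` is the invariant before round `i` and `τ i` the configuration after its body, before the
counter is increased. The bound `e` is evaluated anew in each round, so it must equal `n` at every
`σ i`. A round costs `T` for the body, 4 for the increment, `e.steps + 2` for the test and 1 for the
loop. -/
theorem does_upTo {r n T : ℕ} (hr : r < t) (hB : 2 ≤ B) (hw : B ^ m < 2 ^ w) {e : Ex}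
    (he : e.Fits t B m) (hm : e.size + 2 ≤ m) {p : Prog} (s : State) (σ τ : ℕ → State)
    (hs : s.Bounded t B) (h0 : s.setReg r 0 = σ 0)
    (hσ : ∀ i ≤ n, (σ i).Bounded t B ∧ (σ i).reg r = i ∧ e.eval (σ i) = n)
    (hτ : ∀ i < n, (τ i).Bounded t B ∧ (τ i).reg r = i ∧ (τ i).setReg r (i + 1) = σ (i + 1))
    (hp : ∀ i < n, Does w t T p (σ i) (τ i)) :
    Does w t ((n + 1) * (T + e.steps + 8) + 1) (.upTo t r e p) s (σ n) := by
  have fit : (Ex.op .lt (.var r) e).Fits t B m :=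
    ⟨by simp [Ex.varBound, he.var]; omega, by simp [Ex.numBound, he.num],
      by simp only [Ex.size]; omega⟩
  have test : ∀ i ≤ n, ∀ u, Agree t (σ i) u → ∃ u', Exec w ((Ex.op .lt (.var r) e).compile t) u
      (e.steps + 2) u' ∧ u'.reg t = (if i < n then 1 else 0) ∧ Agree t (σ i) u' := by
    intro i hi u hu
    obtain ⟨hb, h1, h2⟩ := hσ i hi
    obtain ⟨u1, x1, v1, f1, m1⟩ := Ex.exec_compile hb hB hw _ fit t le_rfl u hu.reg hu.mem
    refine ⟨u1, ?_, ?_, ⟨fun r h => (f1 r h).trans (hu.reg r h), m1.trans hu.mem⟩⟩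
    · have e1 : (Ex.op .lt (.var r) e).steps = e.steps + 2 := by simp only [Ex.steps]; omega
      rwa [e1] at x1
    · simpa [Ex.eval, ArithOp.toBinOp, BinOp.eval, h1, h2] using v1
  -- Induction on the number `j` of rounds still to be made.
  have body : ∀ j, ∀ i, i + j = n → ∀ u, Agree t (σ i) u → u.reg t = (if i < n then 1 else 0) →
      ∃ k u', Exec w (.loop t (.seq p (.seq (.assign t r (.op .add (.var r) (.num 1)))
        ((Ex.op .lt (.var r) e).compile t)))) u k u' ∧ k ≤ j * (T + e.steps + 7) + 1 ∧
        Agree t (σ n) u' := by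
    intro j
    induction j with
    | zero =>
      intro i hi u hu ht
      obtain rfl : i = n := by omega
      exact ⟨1, u, .loop_done (by simpa using ht), by omega, hu⟩
    | succ j ih =>
      intro i hi u hu ht
      have hin : i < n := by omega
      obtain ⟨hb, h1, h2⟩ := hτ i hin
      have hinc := does_assign hb hB hw (e := .op .add (.var r) (.num 1)) (r := r)
        ⟨by simp [Ex.varBound]; omega, by simp [Ex.numBound]; omega,
          by simp only [Ex.size]; omega⟩
      have hev : (Ex.op .add (.var r) (.num 1)).eval (τ i) = i + 1 := by
        simp [Ex.eval, ArithOp.toBinOp, BinOp.eval, h1]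
      rw [hev, h2] at hinc
      obtain ⟨k1, u1, x1, l1, a1⟩ := hp i hin u hu
      obtain ⟨k2, u2, x2, l2, a2⟩ := hinc u1 a1
      obtain ⟨u3, x3, v3, a3⟩ := test (i + 1) (by omega) u2 a2
      obtain ⟨k4, u4, x4, l4, a4⟩ := ih (i + 1) (by omega) u3 a3 v3
      refine ⟨_, u4, .loop_step (by simp [ht, hin]) (.seq x1 (.seq x2 x3)) x4, ?_, a4⟩
      simp only [Ex.steps] at l2
      rw [Nat.succ_mul]
      omega
  intro u hu
  have hz := does_assign hs hB hw (e := .num 0) (r := r)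
    ⟨by simp [Ex.varBound], by simp [Ex.numBound], by simp only [Ex.size]; omega⟩
  simp only [Ex.eval, h0] at hz
  obtain ⟨k1, u1, x1, l1, a1⟩ := hz u hu
  obtain ⟨u2, x2, v2, a2⟩ := test 0 (by omega) u1 a1
  obtain ⟨k3, u3, x3, l3, a3⟩ := body n 0 (by omega) u2 a2 v2
  refine ⟨_, u3, .seq x1 (.seq x2 x3), ?_, a3⟩
  simp only [Ex.steps] at l1
  have e1 : (n + 1) * (T + e.steps + 8) = n * (T + e.steps + 7) + n + (T + e.steps + 8) := by ring
  omega

end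

end WordRAM

/-! ### The layered graph of an orthogonal vectors instance -/

namespace LayeredGraph

/-- Tuples of `K` vector indices and `K` coordinates. -/
abbrev Tup (K n d : ℕ) := (Fin K → Fin n) × (Fin K → Fin d)

variable {K n d : ℕ} [NeZero n] [NeZero d]

/-- The name of the vertex of layer `l` that is an end point of the edge with label `z`. -/
def norm (l : ℕ) (z : Tup K n d) : Tup K n d :=
  -- Layer `0` is a single vertex; layer `K + 1 + q` forgets the vector at position `q`, which is
  -- exchanged there. Coordinates are remembered only in the middle layers.
  (fun q => if l = 0 ∨ (q : ℕ) + K + 1 = l then 0 else z.1 q,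
    if K < l ∧ l ≤ 2 * K then z.2 else 0)

variable (bit : ℕ → Fin n → Fin d → Prop)

/-- The vectors at positions other than `i` are `1` at the coordinates assigned to them. -/
def Good (i : ℕ) (z : Tup K n d) : Prop :=
  -- Position `q` holds a vector of collection `q` if `q < i` and of collection `q + 1` otherwise,
  -- so collection `i` is the absent one. The restrictions `q ≤ m` and `m ≤ q` are what lets a
  -- single `X` serve all gaps when there is no orthogonal tuple.
  ∀ q m : Fin K, ((q : ℕ) < i → q ≤ m → bit q (z.1 q) (z.2 m)) ∧
    (i ≤ q → m ≤ q → bit (q + 1) (z.1 q) (z.2 m))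

/-- There is an edge with label `z` between layers `l` and `l + 1`. -/
def EdgeAt (l : ℕ) (z : Tup K n d) : Prop :=
  if K ≤ l ∧ l ≤ 2 * K then Good bit (l - K) z else z.2 = 0

/-- The vertex `(l, z)` is a proper vertex of the construction, not just a leaf at the hub. -/
def Valid (p : ℕ × Tup K n d) : Prop :=
  norm p.1 p.2 = p.2 ∧ (K < p.1 → p.1 ≤ 2 * K → Good bit (p.1 - K) p.2)

/-- The (oriented) edges: those between consecutive layers, and those from the hub `(0, 0)` to the
improper vertices. -/
inductive Rel : ℕ × Tup K n d → ℕ × Tup K n d → Prop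
  | gap (l : ℕ) (z : Tup K n d) (hl : l < 3 * K + 1) (h : EdgeAt bit l z) :
      Rel (l, norm l z) (l + 1, norm (l + 1) z)
  | leaf (l : ℕ) (z : Tup K n d) (hl : l < 3 * K + 2) (h : ¬ Valid bit (l, z)) :
      Rel (0, 0) (l, z)

/-- The layered graph. -/
def layered : SimpleGraph (ℕ × Tup K n d) := SimpleGraph.fromRel (Rel bit)

variable {bit}

theorem norm_norm (l : ℕ) (z : Tup K n d) : norm l (norm l z) = norm l z := by
  ext q
  · simp only [norm]; split_ifs <;> rfl
  · simp only [norm]; split_ifs <;> rfl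

theorem norm_zero (z : Tup K n d) : norm 0 z = 0 := by
  ext q <;> simp [norm]

theorem norm_outer {l : ℕ} (z : Tup K n d) (h0 : l ≠ 0) (h : l ≤ K ∨ 2 * K < l) :
    norm l z = (z.1, 0) := by
  have h1 : ∀ q : Fin K, (q : ℕ) + K + 1 ≠ l := fun q => by omega
  have h2 : ¬ (K < l ∧ l ≤ 2 * K) := by omega
  simp [norm, h0, h1, h2]

theorem norm_fst_of_ne {l : ℕ} (z : Tup K n d) (h0 : l ≠ 0) {q : Fin K}
    (h : (q : ℕ) + K + 1 ≠ l) : (norm l z).1 q = z.1 q := by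
  simp [norm, h0, h]

theorem norm_snd {l : ℕ} (z : Tup K n d) (h : K < l ∧ l ≤ 2 * K) : (norm l z).2 = z.2 := by
  simp [norm, h]

theorem edgeAt_inner {l : ℕ} {z : Tup K n d} (h : K ≤ l ∧ l ≤ 2 * K) :
    EdgeAt bit l z ↔ Good bit (l - K) z := by simp [EdgeAt, h]

theorem edgeAt_outer {l : ℕ} {z : Tup K n d} (h : ¬ (K ≤ l ∧ l ≤ 2 * K)) :
    EdgeAt bit l z ↔ z.2 = 0 := by simp [EdgeAt, h]

theorem valid_hub : Valid bit ((0, 0) : ℕ × Tup K n d) :=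
  ⟨norm_zero _, fun h => absurd h (by simp)⟩

theorem valid_outer {l : ℕ} (D : Fin K → Fin n) (h0 : l ≠ 0) (h : l ≤ K ∨ 2 * K < l) :
    Valid bit (l, ((D, 0) : Tup K n d)) :=
  ⟨norm_outer _ h0 h, fun h1 h2 => absurd h1 (by simp only at h2 ⊢; omega)⟩

/-- The checks pass from the label to the end point because the forgotten vector is replaced by the
index `0`, which by `h0` passes every check. -/
theorem EdgeAt.valid_low (h0 : ∀ p x, bit p 0 x) {l : ℕ} {z : Tup K n d} (h : EdgeAt bit l z) :
    Valid bit (l, norm l z) := by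
  refine ⟨norm_norm l z, fun h1 h2 q m => ?_⟩
  simp only at h1 h2
  have hg := (edgeAt_inner ⟨h1.le, h2⟩).1 h q m
  simp only [norm_snd z ⟨h1, h2⟩]
  by_cases hq : (q : ℕ) + K + 1 = l
  · have : (norm l z).1 q = 0 := by simp [norm, hq]
    simp only [this]
    exact ⟨fun _ _ => h0 _ _, fun _ _ => h0 _ _⟩
  · rwa [norm_fst_of_ne z (by omega) hq]

/-- The conditions `Good` for consecutive gaps differ only at the position exchanged between them,
and the layer between them has forgotten that position. -/
theorem EdgeAt.valid_high (h0 : ∀ p x, bit p 0 x) {l : ℕ} {z : Tup K n d}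
    (h : EdgeAt bit l z) : Valid bit (l + 1, norm (l + 1) z) := by
  refine ⟨norm_norm _ z, fun h1 h2 q m => ?_⟩
  simp only at h1 h2
  have hg := (edgeAt_inner ⟨by omega, by omega⟩).1 h q m
  simp only [norm_snd z ⟨h1, h2⟩]
  by_cases hq : (q : ℕ) + K + 1 = l + 1
  · have : (norm (l + 1) z).1 q = 0 := if_pos (.inr hq)
    simp only [this]
    exact ⟨fun _ _ => h0 _ _, fun _ _ => h0 _ _⟩
  · rw [norm_fst_of_ne z (by omega) hq]
    exact ⟨fun h3 => hg.1 (by omega), fun h3 => hg.2 (by omega)⟩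

theorem Rel.ne {p p' : ℕ × Tup K n d} (h : Rel bit p p') : p ≠ p' := by
  cases h with
  | gap l z hl h => intro e; simpa using congrArg Prod.fst e
  | leaf l z hl h => rintro e; exact h (e ▸ valid_hub)

theorem layered_adj {p p' : ℕ × Tup K n d} :
    (layered bit).Adj p p' ↔ Rel bit p p' ∨ Rel bit p' p := by
  rw [layered, SimpleGraph.fromRel_adj]
  exact ⟨fun h => h.2, fun h => ⟨h.elim Rel.ne fun h => h.ne.symm, h⟩⟩

theorem Rel.edist_le {p p' : ℕ × Tup K n d} (h : Rel bit p p') :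
    (layered bit).edist p p' ≤ 1 := by
  have := (layered_adj.2 (.inl h)).toWalk.edist_le
  simpa using this

theorem edist_trans_le {V : Type*} {G : SimpleGraph V} {u v w : V} {a b c : ℕ}
    (h1 : G.edist u v ≤ a) (h2 : G.edist v w ≤ b) (h : a + b ≤ c) : G.edist u w ≤ c := by
  refine SimpleGraph.edist_triangle.trans ((add_le_add h1 h2).trans ?_)
  exact_mod_cast h

/-! #### Distances without an orthogonal tuple -/

theorem edist_hub_le (D : Fin K → Fin n) {l : ℕ} (hl : l ≠ 0) (hK : l ≤ K) :
    (layered bit).edist ((0, 0) : ℕ × Tup K n d) (l, (D, 0)) ≤ l := by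
  induction l with
  | zero => exact absurd rfl hl
  | succ l ih =>
    have e : EdgeAt bit l ((D, 0) : Tup K n d) := (edgeAt_outer (by omega)).2 rfl
    have h := (Rel.gap l _ (by omega) e).edist_le
    rw [norm_outer _ (Nat.succ_ne_zero l) (.inl hK)] at h
    by_cases h0 : l = 0
    · subst h0
      rw [norm_zero] at h
      simpa using h
    · rw [norm_outer _ h0 (.inl (by omega))] at h
      exact edist_trans_le (ih h0 (by omega)) h (by omega)

theorem edist_pendant_le (D : Fin K → Fin n) {j : ℕ} (hj : j ≤ K) :
    (layered bit).edist ((2 * K + 1, (D, 0)) : ℕ × Tup K n d) (2 * K + 1 + j, (D, 0)) ≤ j := by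
  induction j with
  | zero => simp
  | succ j ih =>
    have e : EdgeAt bit (2 * K + 1 + j) ((D, 0) : Tup K n d) := (edgeAt_outer (by omega)).2 rfl
    have h := (Rel.gap _ _ (by omega) e).edist_le
    rw [norm_outer _ (by omega) (.inr (by omega)), norm_outer _ (by omega) (.inr (by omega))] at h
    exact edist_trans_le (ih (by omega)) h (by omega)

/-- A valid middle vertex is itself an admissible label for the next gap, so one can always climb.
-/
theorem exists_edist_upper_le (h0 : ∀ p x, bit p 0 x) (j : ℕ) : ∀ {l : ℕ} {z : Tup K n d},
    K < l → l + j = 2 * K + 1 → (l ≤ 2 * K → Valid bit (l, z)) → (2 * K < l → z.2 = 0) →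
      ∃ D, (layered bit).edist (l, z) (2 * K + 1, (D, 0)) ≤ j := by
  induction j with
  | zero =>
    intro l z hl hj _ hz
    obtain rfl : l = 2 * K + 1 := by omega
    refine ⟨z.1, ?_⟩
    rw [← hz (by omega)]
    simp
  | succ j ih =>
    intro l z hl hj hv _
    have hv := hv (by omega)
    have e : EdgeAt bit l z := (edgeAt_inner ⟨hl.le, by omega⟩).2 (hv.2 hl (by simp only; omega))
    obtain ⟨D, hD⟩ := ih (l := l + 1) (z := norm (l + 1) z) (by omega) (by omega)
      (fun _ => e.valid_high h0) (fun h => by rw [norm_outer _ (by omega) (.inr h)])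
    have h := (Rel.gap l z (by omega) e).edist_le
    have hn : norm l z = z := hv.1
    rw [hn] at h
    exact ⟨D, edist_trans_le h hD (by omega)⟩

/-- A valid middle vertex is also an admissible label for the gap below it: the one position treated
differently holds the index `0`. -/
theorem good_pred {l : ℕ} {z : Tup K n d} (h0 : ∀ p x, bit p 0 x) (hl : K < l) (h2 : l ≤ 2 * K)
    (hv : Valid bit (l, z)) : Good bit (l - 1 - K) z := by
  intro q m
  have hg := hv.2 hl h2 q m
  refine ⟨fun h => hg.1 (by simp only; omega), fun h => ?_⟩
  by_cases hq : (q : ℕ) + K + 1 = l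
  · have hz : z.1 q = 0 := by
      have : norm l z = z := hv.1
      rw [← this]; simp [norm, hq]
    rw [hz]; exact fun _ => h0 _ _
  · exact hg.2 (by simp only; omega)

theorem exists_reachable_lower (h0 : ∀ p x, bit p 0 x) (j : ℕ) : ∀ {l : ℕ} {z : Tup K n d},
    l = K + j → K ≠ 0 → l ≤ 2 * K → (K < l → Valid bit (l, z)) → (l = K → z.2 = 0) →
      ∃ D, (layered bit).Reachable (K, (D, 0)) (l, z) := by
  induction j with
  | zero =>
    rintro l z rfl _ _ _ hz
    refine ⟨z.1, ?_⟩
    rw [← hz (by omega)]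
  | succ j ih =>
    rintro l z rfl hK hj hv _
    have hv := hv (by omega)
    have hg := good_pred h0 (by omega) hj hv
    have e : EdgeAt bit (K + j) z := (edgeAt_inner ⟨by omega, by omega⟩).2 (by
      rwa [show K + (j + 1) - 1 - K = K + j - K by omega] at hg)
    obtain ⟨D, hD⟩ := ih (l := K + j) (z := norm (K + j) z) rfl hK (by omega)
      (fun _ => e.valid_low h0) (fun h => by rw [norm_outer _ (by omega) (.inl (by omega))])
    have h := (layered_adj.2 (.inl (Rel.gap (K + j) z (by omega) e))).reachable
    have hn : norm (K + j + 1) z = z := hv.1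
    rw [hn] at h
    exact ⟨D, hD.trans h⟩

/-- Every vertex of the layered graph can be reached from the hub. -/
theorem reachable_hub (h0 : ∀ p x, bit p 0 x) (h1 : ∃ x, ∀ p < K, ∀ v, bit p v x) (hK : K ≠ 0)
    {l : ℕ} (z : Tup K n d) (hl : l < 3 * K + 2) :
    (layered bit).Reachable ((0, 0) : ℕ × Tup K n d) (l, z) := by
  have fin : ∀ {p q : ℕ × Tup K n d} {c : ℕ}, (layered bit).edist p q ≤ c →
      (layered bit).Reachable p q := fun h =>
    SimpleGraph.edist_ne_top_iff_reachable.1 (ne_top_of_le_ne_top (ENat.natCast_ne_top _) h)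
  by_cases hv : Valid bit (l, z)
  swap
  · exact fin (c := 1) (by exact_mod_cast (Rel.leaf l z hl hv).edist_le)
  have hn : norm l z = z := hv.1
  rcases Nat.eq_zero_or_pos l with rfl | hl0
  · rw [norm_zero] at hn
    rw [← hn]
  rcases le_or_gt l K with hlK | hlK
  · rw [norm_outer _ (by omega) (.inl hlK)] at hn
    rw [← hn]
    exact fin (edist_hub_le z.1 (by omega) hlK)
  rcases le_or_gt l (2 * K) with hl2 | hl2
  · obtain ⟨D, hD⟩ := exists_reachable_lower h0 (l - K) (l := l) (z := z) (by omega) hK hl2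
      (fun _ => hv) (fun h => by omega)
    exact (fin (edist_hub_le D hK le_rfl)).trans hD
  · rw [norm_outer _ (by omega) (.inr hl2)] at hn
    -- Gap `K` checks only the collections `0, …, K-1`. With all coordinates equal to `x` its checks
    -- hold for any vectors, which ties every pendant path to the middle layers.
    obtain ⟨x, hx⟩ := h1
    have e : EdgeAt bit (2 * K) ((z.1, fun _ => x) : Tup K n d) :=
      (edgeAt_inner ⟨by omega, le_rfl⟩).2 fun q m =>
        ⟨fun _ _ => hx _ q.2 _, fun h => by omega⟩
    obtain ⟨D, hD⟩ := exists_reachable_lower h0 K (l := 2 * K)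
      (z := norm (2 * K) ((z.1, fun _ => x) : Tup K n d)) (by omega) hK le_rfl
      (fun _ => e.valid_low h0) (fun h => by omega)
    have h := fin (c := 1) (by exact_mod_cast (Rel.gap (2 * K) _ (by omega) e).edist_le)
    rw [norm_outer (l := 2 * K + 1) _ (by omega) (.inr (by omega))] at h
    have hp := fin (edist_pendant_le (bit := bit) (d := d) z.1 (j := l - (2 * K + 1)) (by omega))
    rw [show 2 * K + 1 + (l - (2 * K + 1)) = l by omega] at hp
    rw [show ((l, z) : ℕ × Tup K n d) = (l, (z.1, 0)) by rw [hn]]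
    exact (((fin (edist_hub_le D hK le_rfl)).trans hD).trans h).trans hp

/-- If there is no orthogonal tuple, layers `K` and `2 * K + 1` are at distance at most `K + 1`. -/
theorem edist_across_le (h2 : ∀ v : ℕ → Fin n, ∃ x, ∀ p ≤ K, bit p (v p) x) (hK : K ≠ 0)
    (a b : Fin K → Fin n) :
    (layered bit).edist ((K, (a, 0)) : ℕ × Tup K n d) (2 * K + 1, (b, 0)) ≤ (K + 1 : ℕ) := by
  -- `X m` is a coordinate at which `b 0, …, b m, a m, …, a (K-1)`, one vector from each collection,
  -- are all `1`. The default `0` below is never used for `p ≤ K`.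
  have hX : ∃ X : Fin K → Fin d, ∀ m q : Fin K, (q ≤ m → bit q (b q) (X m)) ∧
      (m ≤ q → bit (q + 1) (a q) (X m)) := by
    have : ∀ m : Fin K, ∃ x : Fin d, ∀ q : Fin K, (q ≤ m → bit q (b q) x) ∧
        (m ≤ q → bit (q + 1) (a q) x) := by
      intro m
      obtain ⟨x, hx⟩ := h2 fun p => if h : p ≤ m then b ⟨p, by omega⟩ else
        if h' : p - 1 < K then a ⟨p - 1, h'⟩ else 0
      refine ⟨x, fun q => ⟨fun h => ?_, fun h => ?_⟩⟩
      · have := hx q (by omega)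
        have h' : (q : ℕ) ≤ m := h
        simpa [h'] using this
      · have := hx (q + 1) (by omega)
        have h' : ¬ ((q : ℕ) + 1 ≤ m) := by
          have : (m : ℕ) ≤ q := h
          omega
        simpa [h'] using this
    choose X hX using this
    exact ⟨X, hX⟩
  obtain ⟨X, hX⟩ := hX
  -- The label in gap `i`: the first `i` vectors are already exchanged and the coordinates stay
  -- fixed.
  let z : ℕ → Tup K n d := fun i => (fun q => if (q : ℕ) < i then b q else a q, X)
  have hz : ∀ i ≤ K, EdgeAt bit (K + i) (z i) := fun i hi =>
    (edgeAt_inner ⟨by omega, by omega⟩).2 fun q m => by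
      rw [show K + i - K = i by omega]
      refine ⟨fun h hm => ?_, fun h hm => ?_⟩
      · simpa [z, h] using (hX m q).1 hm
      · simpa [z, not_lt.2 h] using (hX m q).2 hm
  -- Consecutive labels differ only at position `i`, forgotten in layer `K + i + 1`, so the edges
  -- join up to a path.
  have hzz : ∀ i, norm (K + i + 1) (z i) = norm (K + i + 1) (z (i + 1)) := by
    intro i
    have : ∀ q : Fin K, ¬ ((q : ℕ) + K + 1 = K + i + 1) → ((q : ℕ) < i ↔ (q : ℕ) < i + 1) :=
      fun q hq => by omega
    ext q
    · simp only [norm, z]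
      by_cases hq : (q : ℕ) + K + 1 = K + i + 1
      · simp [hq]
      · simp [this q hq]
    · simp [norm, z]
  have key : ∀ i ≤ K + 1, (layered bit).edist ((K, (a, 0)) : ℕ × Tup K n d)
      (K + i, norm (K + i) (z i)) ≤ (i : ℕ) := by
    intro i hi
    induction i with
    | zero =>
      have : norm (K + 0) (z 0) = (a, 0) := by
        rw [norm_outer _ (by omega) (.inl (by omega))]
        simp [z]
      rw [this]
      simp
    | succ i ih =>
      have h := (Rel.gap (K + i) (z i) (by omega) (hz i (by omega))).edist_le
      rw [hzz] at h
      exact edist_trans_le (ih (by omega)) h (by omega)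
  have h := key (K + 1) le_rfl
  rw [norm_outer _ (by omega) (.inr (by omega)), show K + (K + 1) = 2 * K + 1 by omega] at h
  have hb : (z (K + 1)).1 = b := by
    funext q
    simp [z, show (q : ℕ) < K + 1 by omega]
  rwa [hb] at h

/-- If there is no orthogonal tuple, then the vertices of layer `K` have small eccentricity. -/
theorem edist_le_of_no_tuple (h0 : ∀ p x, bit p 0 x)
    (h2 : ∀ v : ℕ → Fin n, ∃ x, ∀ p ≤ K, bit p (v p) x) (hK : K ≠ 0) (a : Fin K → Fin n)
    {l : ℕ} (z : Tup K n d) (hl : l < 3 * K + 2) :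
    (layered bit).edist ((K, (a, 0)) : ℕ × Tup K n d) (l, z) ≤ (2 * K + 1 : ℕ) := by
  have hhub := edist_hub_le (bit := bit) (d := d) a hK le_rfl
  rw [SimpleGraph.edist_comm] at hhub
  by_cases hv : Valid bit (l, z)
  swap
  · exact edist_trans_le hhub (b := 1) (by exact_mod_cast (Rel.leaf l z hl hv).edist_le) (by omega)
  have hn : norm l z = z := hv.1
  rcases Nat.eq_zero_or_pos l with rfl | hl0
  · rw [norm_zero] at hn
    rw [← hn]
    exact hhub.trans (by exact_mod_cast (by omega : K ≤ 2 * K + 1))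
  rcases le_or_gt l K with hlK | hlK
  · rw [norm_outer _ (by omega) (.inl hlK)] at hn
    rw [← hn]
    exact edist_trans_le hhub (edist_hub_le z.1 (by omega) hlK) (by omega)
  rcases le_or_gt l (2 * K) with hl2 | hl2
  -- A middle vertex is at most `K` steps below some vertex of layer `2K + 1`, so crossing first and
  -- then coming back down stays within `2K + 1`.
  · obtain ⟨D, hD⟩ := exists_edist_upper_le h0 (2 * K + 1 - l) hlK (by omega) (fun _ => hv)
      (fun h => by omega)
    rw [SimpleGraph.edist_comm] at hD
    exact edist_trans_le (edist_across_le h2 hK a D) hD (by omega)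
  · rw [norm_outer _ (by omega) (.inr hl2)] at hn
    have hp := edist_pendant_le (bit := bit) (d := d) z.1 (j := l - (2 * K + 1)) (by omega)
    rw [show 2 * K + 1 + (l - (2 * K + 1)) = l by omega] at hp
    rw [show ((l, z) : ℕ × Tup K n d) = (l, (z.1, 0)) by rw [hn]]
    exact edist_trans_le (edist_across_le h2 hK a z.1) hp (by omega)

end LayeredGraph

namespace LayeredGraph

variable {K n d : ℕ} [NeZero n] [NeZero d] {bit : ℕ → Fin n → Fin d → Prop}

/-! #### Distances in the presence of an orthogonal tuple -/

variable (bit) in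
/-- What is known about the vertex `(l, z)` if it is reached from the vertex `(K, (a, 0))` by a walk
that avoids the hub; `B` contains the gaps `i` between layers `K + i` and `K + i + 1` which
the walk has crossed backwards. -/
structure Trace (a : Fin K → Fin n) (B : Finset ℕ) (l : ℕ) (z : Tup K n d) : Prop where
  le : ∀ g ∈ B, g ≤ K
  -- Being below a gap that was never crossed backwards means never having been above it.
  up : ∀ g, l ≤ K + g → g ∉ B → ∀ g' ≥ g, g' ∉ B
  -- Position `q ≥ g` can change only at layer `K + q + 1`, which lies beyond gap `g`.
  same : ∀ g, l ≤ K + g → g ∉ B → ∀ q : Fin K, g ≤ q → z.1 q = a q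
  -- The single crossing of gap `g` checked the `a q` with `q ≥ g`. The coordinates have not changed
  -- since: they are forgotten only at layer `K` and below, or at layer `2K + 1` and above;
  -- returning from the latter would cross gap `K` backwards.
  left : ∀ g, K + g < l → l ≤ 2 * K → g ∉ B → K ∉ B →
    ∀ q m : Fin K, g ≤ q → m ≤ q → bit (q + 1) (a q) (z.2 m)
  -- Once both gaps are behind, the `X` in force at the crossing of `g'` satisfies the checks of
  -- both. The vectors at positions `q < g'` are final, since they change only at layers up to `K +
  -- g'`.
  both : ∀ g g', g < g' → g' ≤ K → K + g' < l → g ∉ B → g' ∉ B → ∃ X : Fin K → Fin d,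
    (∀ q m : Fin K, g ≤ q → m ≤ q → bit (q + 1) (a q) (X m)) ∧
      ∀ q m : Fin K, (q : ℕ) < g' → q ≤ m → bit q (z.1 q) (X m)

/-- Only a gap crossed in this step needs an argument: crossing `g` yields `left` from `same` and
the check on the edge; crossing `g'` yields `both` from `left`, with `z.2` as the common
coordinates. -/
theorem Trace.forward {a : Fin K → Fin n} {B : Finset ℕ} {l : ℕ} {z : Tup K n d}
    (h : Trace bit a B l (norm l z)) (hl : l ≠ 0) (he : EdgeAt bit l z) :
    Trace bit a B (l + 1) (norm (l + 1) z) where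
  le := h.le
  up g hg := h.up g (by omega)
  same g hg hB q hq := by
    rw [norm_fst_of_ne z (by omega) (by omega), ← h.same g (by omega) hB q hq,
      norm_fst_of_ne z (by omega) (by omega)]
  left g hg hl2 hB hK q m hq hm := by
    rw [norm_snd z (by omega)]
    by_cases hgl : K + g = l
    · have := h.same g (by omega) hB q hq
      rw [norm_fst_of_ne z hl (by omega)] at this
      rw [← this]
      exact ((edgeAt_inner (by omega)).1 he q m).2 (by omega) hm
    · have := h.left g (by omega) (by omega) hB hK q m hq hm
      rwa [norm_snd z (by omega)] at this
  both g g' hgg hg' hl' hB hB' := by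
    by_cases hgl : K + g' = l
    · refine ⟨z.2, fun q m hq hm => ?_, fun q m hq hm => ?_⟩
      -- The walk is still below gap `g'`, so by `up` it cannot have crossed gap `K` backwards.
      · by_cases hK : K ∈ B
        · exact absurd hK (h.up g' (by omega) hB' K hg')
        · have := h.left g (by omega) (by omega) hB hK q m hq hm
          rwa [norm_snd z (by omega)] at this
      · rw [norm_fst_of_ne z (by omega) (by omega)]
        exact ((edgeAt_inner (by omega)).1 he q m).1 (by omega) hm
    · obtain ⟨X, h1, h2⟩ := h.both g g' hgg hg' (by omega) hB hB'
      refine ⟨X, h1, fun q m hq hm => ?_⟩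
      have := h2 q m hq hm
      rw [norm_fst_of_ne z hl (by omega)] at this
      rwa [norm_fst_of_ne z (by omega) (by omega)]

/-- The crossed gap joins the set `B'` if it is a middle gap. For every remaining gap the walk stays
on the same side, and what was known there survives. -/
theorem Trace.backward {a : Fin K → Fin n} {B : Finset ℕ} {l : ℕ} {z : Tup K n d}
    (h : Trace bit a B (l + 1) (norm (l + 1) z)) (hl : l ≠ 0) :
    ∃ B' : Finset ℕ, B'.card ≤ B.card + 1 ∧ Trace bit a B' l (norm l z) := by
  refine ⟨if K ≤ l ∧ l ≤ 2 * K then insert (l - K) B else B, ?_, ?_⟩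
  · split_ifs
    · exact Finset.card_insert_le _ _
    · omega
  have key : ∀ g, g ∉ (if K ≤ l ∧ l ≤ 2 * K then insert (l - K) B else B) ↔
      g ∉ B ∧ ¬ (K + g = l ∧ g ≤ K) := by
    intro g
    split_ifs with hc
    · rw [Finset.mem_insert, not_or, and_comm]
      exact and_congr_right fun _ => not_congr ⟨fun h => ⟨by omega, by omega⟩, fun h => by omega⟩
    · exact ⟨fun h => ⟨h, by omega⟩, fun h => h.1⟩
  refine ⟨fun g hg => ?_, fun g hg hB g' hg' => ?_, fun g hg hB q hq => ?_,
    fun g hg hl2 hB hK q m hq hm => ?_, fun g g' hgg hg' hl' hB hB' => ?_⟩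
  · by_contra hgK
    exact (key g).2 ⟨fun h' => hgK (h.le g h'), fun h' => hgK h'.2⟩ hg
  · rw [key] at hB ⊢
    refine ⟨?_, by omega⟩
    by_cases hgK : g ≤ K
    · exact h.up g (by omega) hB.1 g' hg'
    · exact fun h' => by have := h.le _ h'; omega
  · rw [key] at hB
    have := h.same g (by omega) hB.1 q hq
    rw [norm_fst_of_ne z (by omega) (by omega)] at this
    rwa [norm_fst_of_ne z hl (by omega)]
  · rw [key] at hB hK
    have := h.left g (by omega) (by omega) hB.1 hK.1 q m hq hm
    rw [norm_snd z (by omega)] at this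
    rwa [norm_snd z (by omega)]
  · rw [key] at hB hB'
    obtain ⟨X, h1, h2⟩ := h.both g g' hgg hg' (by omega) hB.1 hB'.1
    refine ⟨X, h1, fun q m hq hm => ?_⟩
    have := h2 q m hq hm
    rw [norm_fst_of_ne z (by omega) (by omega)] at this
    rwa [norm_fst_of_ne z hl (by omega)]

theorem Trace.start (a : Fin K → Fin n) :
    Trace bit a ∅ K ((a, 0) : Tup K n d) where
  le := by simp
  up := by simp
  same _ _ _ _ _ := rfl
  left g hg := by omega
  both g g' _ _ hg := by omega

open Classical in
variable (bit) in
/-- A lower bound for the distance from the hub. -/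
noncomputable def height (p : ℕ × Tup K n d) : ℕ := if Valid bit p then p.1 else 1

variable (bit) in
/-- What is known about a vertex that is reached from `(K, (a, 0))` in `s` steps. -/
def Reached (a : Fin K → Fin n) (s : ℕ) (p : ℕ × Tup K n d) : Prop :=
  -- In the first case the hub has not been visited, and `u` and `b` count the forward and backward
  -- steps. In the second case the `K` steps down to the hub have been paid.
  (p.1 ≠ 0 ∧ Valid bit p ∧ ∃ (u b : ℕ) (B : Finset ℕ), s = u + b ∧ p.1 + b = K + u ∧
    B.card ≤ b ∧ Trace bit a B p.1 p.2) ∨ K + height bit p ≤ s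

/-- `height` changes by exactly one along every edge, so the bound after a visit to the hub
persists. At the first arrival at the hub the layer count gives `b = K + u`, hence at least `K`
steps. -/
theorem Reached.step (h0 : ∀ p x, bit p 0 x) {a : Fin K → Fin n} {s : ℕ} {p p' : ℕ × Tup K n d}
    (h : Reached bit a s p) (hp : (layered bit).Adj p p') : Reached bit a (s + 1) p' := by
  have hub : height bit ((0, 0) : ℕ × Tup K n d) = 0 := if_pos valid_hub
  have low : ∀ {l : ℕ} {z : Tup K n d}, EdgeAt bit l z → height bit (l, norm l z) = l :=
    fun h => if_pos (h.valid_low h0)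
  have high : ∀ {l : ℕ} {z : Tup K n d}, EdgeAt bit l z →
    height bit (l + 1, norm (l + 1) z) = l + 1 := fun h => if_pos (h.valid_high h0)
  rcases layered_adj.1 hp with hr | hr
  · cases hr with
    | gap l z hl he =>
      rcases h with ⟨hp0, hv, u, b, B, hs, hub', hB, ht⟩ | h
      · exact .inl ⟨Nat.succ_ne_zero l, he.valid_high h0, u + 1, b, B, by omega,
          by simp only at hub' ⊢; omega, hB, ht.forward hp0 he⟩
      · rw [low he] at h
        exact .inr (by rw [high he]; omega)
    | leaf l z hl hv =>
      rcases h with ⟨hp0, -⟩ | h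
      · exact absurd rfl hp0
      · rw [hub] at h
        have h1 : height bit (l, z) = 1 := if_neg hv
        exact .inr (by omega)
  · cases hr with
    | gap l z hl he =>
      rcases h with ⟨hp0, hv, u, b, B, hs, hub', hB, ht⟩ | h
      · simp only at hub'
        by_cases hl0 : l = 0
        · subst hl0
          exact .inr (by rw [low he]; omega)
        · obtain ⟨B', hc, ht'⟩ := ht.backward hl0
          exact .inl ⟨hl0, he.valid_low h0, u, b + 1, B', by omega,
            by simp only; omega, by omega, ht'⟩
      · rw [high he] at h
        exact .inr (by rw [low he]; omega)
    | leaf l z hl hv =>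
      rcases h with ⟨-, hv', -⟩ | h
      · exact absurd hv' hv
      · exact .inr (by rw [hub]; omega)

theorem Reached.walk (h0 : ∀ p x, bit p 0 x) {a : Fin K → Fin n} {p p' : ℕ × Tup K n d}
    (w : (layered bit).Walk p p') {s : ℕ} (h : Reached bit a s p) :
    Reached bit a (s + w.length) p' := by
  induction w generalizing s with
  | nil => simpa using h
  | cons hadj w ih =>
    have := ih (h.step h0 hadj)
    rwa [SimpleGraph.Walk.length_cons, add_comm w.length, ← add_assoc]

/-- If `v` is an orthogonal tuple, then the corresponding vertex of layer `K` has large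
eccentricity. -/
theorem le_length_of_tuple (h0 : ∀ p x, bit p 0 x) {v : ℕ → Fin n}
    (hv : ∀ x, ∃ p ≤ K, ¬ bit p (v p) x) (hK : K ≠ 0)
    (w : (layered bit).Walk ((K, (fun q => v (q + 1), 0)) : ℕ × Tup K n d)
      (3 * K + 1, (fun q => v q, 0))) : 4 * K + 1 ≤ w.length := by
  have hs : Reached bit (fun q => v (q + 1)) 0
      ((K, (fun q => v (q + 1), 0)) : ℕ × Tup K n d) :=
    .inl ⟨hK, valid_outer _ hK (.inl le_rfl), 0, 0, ∅, rfl, rfl, le_rfl, .start _⟩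
  rcases hs.walk h0 w with ⟨-, -, u, b, B, hl, hub, hB, ht⟩ | h
  · simp only at hub
    by_contra hlt
    -- Here `u = b + 2K + 1`. Fewer than `4K + 1` steps thus mean `b < K`, and `B` misses at least
    -- two of the `K + 1` gaps.
    have hcard : 1 < (Finset.range (K + 1) \ B).card := by
      have := Finset.le_card_sdiff B (Finset.range (K + 1))
      rw [Finset.card_range] at this
      omega
    obtain ⟨g₁, h₁, g₂, h₂, hne⟩ := Finset.one_lt_card.1 hcard
    simp only [Finset.mem_sdiff, Finset.mem_range] at h₁ h₂
    have : ∃ g g', g < g' ∧ g' ≤ K ∧ g ∉ B ∧ g' ∉ B := by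
      rcases lt_or_gt_of_ne hne with h | h
      · exact ⟨g₁, g₂, h, by omega, h₁.2, h₂.2⟩
      · exact ⟨g₂, g₁, h, by omega, h₂.2, h₁.2⟩
    obtain ⟨g, g', hgg, hg', hgB, hgB'⟩ := this
    obtain ⟨X, hX1, hX2⟩ := ht.both g g' hgg hg' (by simp only; omega) hgB hgB'
    -- At coordinate `X (g' - 1)` the two halves of `both` meet: the second covers collections `p <
    -- g'`, the first all `p ≥ g'`, as `g ≤ g' - 1`.
    obtain ⟨p, hp, hpx⟩ := hv (X ⟨g' - 1, by omega⟩)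
    refine hpx ?_
    by_cases hpg : p < g'
    · exact hX2 ⟨p, by omega⟩ ⟨g' - 1, by omega⟩ hpg (by simp only [Fin.mk_le_mk]; omega)
    · have := hX1 ⟨p - 1, by omega⟩ ⟨g' - 1, by omega⟩ (by simp only; omega)
        (by simp only [Fin.mk_le_mk]; omega)
      simpa only [show p - 1 + 1 = p by omega] using this
  · have : height bit ((3 * K + 1, (fun q => v q, 0)) : ℕ × Tup K n d) = 3 * K + 1 :=
      if_pos (valid_outer _ (by omega) (.inr (by omega)))
    omega

end LayeredGraph

namespace LayeredGraph

variable {K n d : ℕ} [NeZero n] [NeZero d]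

/-! #### Numbering of the vertices -/

variable (K n d) in
/-- The number of vertices in a layer. -/
def width : ℕ := n ^ K * d ^ K

variable (K n d) in
/-- The number of vertices of the layered graph. -/
def order : ℕ := (3 * K + 2) * width K n d

/-- The tuple with a given number. -/
def ofRank (y : ℕ) : Tup K n d :=
  (fun q => Fin.ofNat n (y / d ^ K / n ^ (q : ℕ)), fun q => Fin.ofNat d (y % d ^ K / d ^ (q : ℕ)))

/-- The number of a tuple. -/
def rank (z : Tup K n d) : ℕ :=
  (∑ q, (z.1 q : ℕ) * n ^ (q : ℕ)) * d ^ K + ∑ q, (z.2 q : ℕ) * d ^ (q : ℕ)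

theorem width_pos : 0 < width K n d :=
  Nat.mul_pos (pow_pos (NeZero.pos n) _) (pow_pos (NeZero.pos d) _)

instance : NeZero (order K n d) := ⟨(Nat.mul_pos (by omega) width_pos).ne'⟩

theorem sum_digits_lt {m : ℕ} (f : Fin K → Fin m) : ∑ q, (f q : ℕ) * m ^ (q : ℕ) < m ^ K := by
  rw [← finFunctionFinEquiv_apply]; exact Fin.is_lt _

theorem digit_sum {m : ℕ} [NeZero m] (f : Fin K → Fin m) (q : Fin K) :
    Fin.ofNat m ((∑ q, (f q : ℕ) * m ^ (q : ℕ)) / m ^ (q : ℕ)) = f q := by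
  have h := congrFun (finFunctionFinEquiv.symm_apply_apply f) q
  ext
  rw [← h, finFunctionFinEquiv_symm_apply_val, finFunctionFinEquiv_apply]
  simp [Fin.ofNat]

theorem sum_digits {m : ℕ} [NeZero m] {x : ℕ} (hx : x < m ^ K) :
    ∑ q : Fin K, ((Fin.ofNat m (x / m ^ (q : ℕ)) : Fin m) : ℕ) * m ^ (q : ℕ) = x := by
  have h := congrArg Fin.val (finFunctionFinEquiv.apply_symm_apply (⟨x, hx⟩ : Fin (m ^ K)))
  rw [finFunctionFinEquiv_apply] at h
  simpa only [finFunctionFinEquiv_symm_apply_val, Fin.val_ofNat] using h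

theorem rank_lt (z : Tup K n d) : rank z < width K n d := by
  have h1 := sum_digits_lt z.1
  have h2 := sum_digits_lt z.2
  calc rank z < (∑ q, (z.1 q : ℕ) * n ^ (q : ℕ) + 1) * d ^ K := by
        unfold rank; rw [add_mul, one_mul]; omega
    _ ≤ width K n d := Nat.mul_le_mul_right _ h1

theorem ofRank_rank (z : Tup K n d) : ofRank (rank z) = z := by
  have h2 := sum_digits_lt z.2
  have h3 : 0 < d ^ K := by omega
  unfold ofRank rank
  refine Prod.ext (funext fun q => ?_) (funext fun q => ?_)
  · simp only
    rw [add_comm, Nat.add_mul_div_right _ _ h3, Nat.div_eq_of_lt h2, zero_add, digit_sum]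
  · simp only
    rw [add_comm, Nat.add_mul_mod_self_right, Nat.mod_eq_of_lt h2, digit_sum]

theorem rank_ofRank {y : ℕ} (hy : y < width K n d) : rank (ofRank y : Tup K n d) = y := by
  have h3 : 0 < d ^ K := pow_pos (NeZero.pos d) _
  unfold ofRank rank
  simp only
  rw [sum_digits (Nat.mod_lt _ h3), sum_digits, Nat.div_add_mod']
  exact Nat.div_lt_of_lt_mul (by rwa [mul_comm])

theorem rank_zero : rank (0 : Tup K n d) = 0 := by simp [rank]

/-- The number of a vertex. -/
def code (p : ℕ × Tup K n d) : ℕ := p.1 * width K n d + rank p.2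

/-- The vertex with a given number. -/
def name (v : Fin (order K n d)) : ℕ × Tup K n d :=
  ((v : ℕ) / width K n d, ofRank ((v : ℕ) % width K n d))

theorem code_lt {p : ℕ × Tup K n d} (hp : p.1 < 3 * K + 2) : code p < order K n d := by
  have := rank_lt p.2
  unfold code order
  nlinarith

theorem code_name (v : Fin (order K n d)) : code (name v) = v := by
  simp only [code, name]
  rw [rank_ofRank (Nat.mod_lt _ width_pos), Nat.div_add_mod']

theorem name_fst_lt (v : Fin (order K n d)) : (name v).1 < 3 * K + 2 :=
  Nat.div_lt_of_lt_mul (by rw [mul_comm]; exact v.2)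

theorem name_ofNat_code {p : ℕ × Tup K n d} (hp : p.1 < 3 * K + 2) :
    name (Fin.ofNat (order K n d) (code p)) = p := by
  simp only [name, Fin.val_ofNat, Nat.mod_eq_of_lt (code_lt hp)]
  have h := rank_lt p.2
  have hM := width_pos (K := K) (n := n) (d := d)
  simp only [code]
  refine Prod.ext ?_ ?_
  · simp only
    rw [add_comm, Nat.add_mul_div_right _ _ hM, Nat.div_eq_of_lt h, zero_add]
  · simp only
    rw [add_comm, Nat.add_mul_mod_self_right, Nat.mod_eq_of_lt h, ofRank_rank]

theorem name_injective : Function.Injective (name : Fin (order K n d) → ℕ × Tup K n d) :=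
  fun u v h => Fin.ext (by rw [← code_name u, h, code_name])

variable (bit : ℕ → Fin n → Fin d → Prop)

/-- The layered graph, with the vertices numbered. -/
def graph (K : ℕ) : SimpleGraph (Fin (order K n d)) := (layered (K := K) bit).comap name

variable {bit}

theorem Rel.fst_lt {p p' : ℕ × Tup K n d} (h : Rel bit p p') :
    p.1 < 3 * K + 2 ∧ p'.1 < 3 * K + 2 := by
  cases h with
  | gap l z hl h => exact ⟨by simp only; omega, by simp only; omega⟩
  | leaf l z hl h => exact ⟨by simp only; omega, hl⟩

/-- No edge of the layered graph leaves the layers below `3K + 2`, so a walk starting there can be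
renumbered vertex by vertex. -/
theorem exists_walk_graph {p p' : ℕ × Tup K n d} (w : (layered bit).Walk p p') :
    ∀ u v, name u = p → name v = p' → ∃ w' : (graph bit K).Walk u v, w'.length = w.length := by
  induction w with
  | nil =>
    intro u v hu hv
    obtain rfl : u = v := name_injective (hu.trans hv.symm)
    exact ⟨.nil, rfl⟩
  | @cons _ p _ hadj w ih =>
    intro u v hu hv
    have hlt := (layered_adj.1 hadj).elim (fun h => h.fst_lt.2) (fun h => h.fst_lt.1)
    obtain ⟨w', hw'⟩ := ih _ v (name_ofNat_code hlt) hv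
    have hadj' : (graph bit K).Adj u (Fin.ofNat _ (code p)) := by
      simp only [graph, SimpleGraph.comap_adj]
      rwa [hu, name_ofNat_code hlt]
    exact ⟨.cons hadj' w', by rw [SimpleGraph.Walk.length_cons, hw', SimpleGraph.Walk.length_cons]⟩

theorem edist_graph (u v : Fin (order K n d)) :
    (graph bit K).edist u v = (layered bit).edist (name u) (name v) := by
  refine le_antisymm ?_ ?_
  · by_cases h : (layered bit).Reachable (name u) (name v)
    · obtain ⟨w, hw⟩ := h.exists_walk_length_eq_edist
      obtain ⟨w', hw'⟩ := exists_walk_graph w u v rfl rfl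
      rw [← hw, ← hw']
      exact w'.edist_le
    · rw [SimpleGraph.edist_eq_top_of_not_reachable h]
      exact le_top
  · by_cases h : (graph bit K).Reachable u v
    · obtain ⟨w, hw⟩ := h.exists_walk_length_eq_edist
      let f : graph bit K →g layered bit := ⟨name, fun h => h⟩
      have := (w.map f).edist_le
      rw [SimpleGraph.Walk.length_map, hw] at this
      exact this
    · rw [SimpleGraph.edist_eq_top_of_not_reachable h]
      exact le_top

theorem connected_graph (h0 : ∀ p x, bit p 0 x) (h1 : ∃ x, ∀ p < K, ∀ v, bit p v x)
    (hK : K ≠ 0) : (graph bit K).Connected := by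
  have hub : ∀ v, (graph bit K).Reachable 0 v := by
    intro v
    have h := reachable_hub h0 h1 hK (name v).2 (name_fst_lt v)
    have e : name (0 : Fin (order K n d)) = (0, 0) := by
      have := name_ofNat_code (K := K) (n := n) (d := d) (p := (0, 0)) (by simp)
      simpa [code, rank_zero] using this
    rw [← SimpleGraph.edist_ne_top_iff_reachable, edist_graph, e,
      SimpleGraph.edist_ne_top_iff_reachable]
    exact h
  exact ⟨fun u v => (hub u).symm.trans (hub v)⟩

/-- The vertices whose eccentricities decide the instance. -/
def source (K n d : ℕ) [NeZero n] [NeZero d] (a : Fin K → Fin n) : Fin (order K n d) :=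
  Fin.ofNat _ (code (K, ((a, 0) : Tup K n d)))

theorem eccent_source_le (h0 : ∀ p x, bit p 0 x)
    (h2 : ∀ v : ℕ → Fin n, ∃ x, ∀ p ≤ K, bit p (v p) x) (hK : K ≠ 0) (a : Fin K → Fin n) :
    (graph bit K).eccent (source K n d a) ≤ (2 * K + 1 : ℕ) := by
  rw [SimpleGraph.eccent_le_iff]
  intro v
  rw [edist_graph, source, name_ofNat_code (by simp only; omega)]
  exact edist_le_of_no_tuple h0 h2 hK a _ (name_fst_lt v)

theorem le_eccent_source (h0 : ∀ p x, bit p 0 x) {v : ℕ → Fin n}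
    (hv : ∀ x, ∃ p ≤ K, ¬ bit p (v p) x) (hK : K ≠ 0) :
    (4 * K + 1 : ℕ) ≤ (graph bit K).eccent (source K n d fun q => v (q + 1)) := by
  refine le_trans ?_ (SimpleGraph.edist_le_eccent (v :=
    Fin.ofNat (order K n d) (code (3 * K + 1, ((fun q => v q, 0) : Tup K n d)))))
  rw [edist_graph, source, name_ofNat_code (by simp only; omega),
    name_ofNat_code (by simp only; omega)]
  refine le_iInf fun w => ?_
  exact_mod_cast le_length_of_tuple h0 hv hK w

/-! #### The list of edges -/

variable (K) in
/-- The edges between consecutive layers (`true`) or the leaves in a given layer (`false`). -/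
def passes : List (Bool × ℕ) :=
  (List.range (3 * K + 1)).map (Prod.mk true) ++ (List.range (3 * K + 2)).map (Prod.mk false)

variable (bit) in
/-- There is an edge of a given kind with label `z`. -/
def Present (P : Bool × ℕ) (z : Tup K n d) : Prop :=
  if P.1 then EdgeAt bit P.2 z else ¬ Valid bit (P.2, z)

/-- The end points of the edge of a given kind with label `z`. -/
def ends (P : Bool × ℕ) (z : Tup K n d) : (ℕ × Tup K n d) × (ℕ × Tup K n d) :=
  if P.1 then ((P.2, norm P.2 z), (P.2 + 1, norm (P.2 + 1) z)) else ((0, 0), (P.2, z))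

open Classical in
variable (bit) in
/-- The edge of a given kind with label `z`, if there is one. -/
noncomputable def edgeOpt (P : Bool × ℕ) (z : Tup K n d) :
    List ((ℕ × Tup K n d) × (ℕ × Tup K n d)) :=
  if Present bit P z then [ends P z] else []

variable (bit) in
/-- All edges. -/
noncomputable def edges (K : ℕ) : List ((ℕ × Tup K n d) × (ℕ × Tup K n d)) :=
  (passes K).flatMap fun P => (List.range (width K n d)).flatMap fun y => edgeOpt bit P (ofRank y)

variable (bit) in
/-- The list of edges of the numbered graph. -/
noncomputable def edgeList (K : ℕ) : List (Fin (order K n d) × Fin (order K n d)) :=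
  (edges bit K).map fun e => (Fin.ofNat _ (code e.1), Fin.ofNat _ (code e.2))

theorem mem_edges {e : (ℕ × Tup K n d) × (ℕ × Tup K n d)} :
    e ∈ edges bit K ↔ Rel bit e.1 e.2 := by
  have h1 : e ∈ edges bit K ↔ ∃ P ∈ passes K, ∃ z, Present bit P z ∧ e = ends P z := by
    simp only [edges, List.mem_flatMap, List.mem_range, edgeOpt]
    refine exists_congr fun P => and_congr_right fun _ => ⟨?_, ?_⟩
    · rintro ⟨y, hy, h⟩
      split_ifs at h with hc
      · exact ⟨_, hc, by simpa using h⟩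
      · simp at h
    · rintro ⟨z, hz, rfl⟩
      exact ⟨rank z, rank_lt z, by simp [ofRank_rank, hz]⟩
  rw [h1]
  constructor
  · rintro ⟨⟨b, l⟩, hP, z, hz, rfl⟩
    cases b
    · have hl : l < 3 * K + 2 := by simpa [passes] using hP
      exact .leaf l z hl (by simpa [Present] using hz)
    · have hl : l < 3 * K + 1 := by simpa [passes] using hP
      exact .gap l z hl (by simpa [Present] using hz)
  · obtain ⟨p, p'⟩ := e
    intro h
    cases h with
    | gap l z hl h => exact ⟨(true, l), by simpa [passes] using hl, z, by simpa [Present] using h, rfl⟩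
    | leaf l z hl h =>
      exact ⟨(false, l), by simpa [passes] using hl, z, by simpa [Present] using h, rfl⟩

/-- There are `3K + 1` gaps and `3K + 2` layers for leaves, and each contributes at most one edge
per label. As `6K + 3 ≤ 2 (3K + 2)`, this is at most twice the number of vertices. -/
theorem length_edges_le : (edges bit K).length ≤ (6 * K + 3) * width K n d := by
  have h1 : ∀ (l : List (Bool × ℕ)), (l.flatMap fun P => (List.range (width K n d)).flatMap
      fun y => edgeOpt bit P (ofRank y : Tup K n d)).length ≤ l.length * width K n d := by
    intro l
    rw [List.length_flatMap]
    refine (List.sum_le_card_nsmul _ (width K n d) fun x hx => ?_).trans (by simp)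
    obtain ⟨P, -, rfl⟩ := List.mem_map.1 hx
    rw [List.length_flatMap]
    refine (List.sum_le_card_nsmul _ 1 fun x hx => ?_).trans (by simp)
    obtain ⟨y, -, rfl⟩ := List.mem_map.1 hx
    unfold edgeOpt
    split_ifs <;> simp
  refine (h1 _).trans (Nat.mul_le_mul_right _ ?_)
  simp [passes]
  omega

/-- Two consecutive layers never forget the same vector. For `K ≠ 0` every middle gap touches a
layer that remembers the coordinates; in the other gaps they are `0`. -/
theorem norm_pair_injective (hK : K ≠ 0) {l : ℕ} {z z' : Tup K n d} (h : EdgeAt bit l z)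
    (h' : EdgeAt bit l z') (e : norm l z = norm l z') (e' : norm (l + 1) z = norm (l + 1) z') :
    z = z' := by
  refine Prod.ext (funext fun q => ?_) ?_
  · by_cases hq : l = 0 ∨ (q : ℕ) + K + 1 = l
    · have := congrFun (congrArg Prod.fst e') q
      rwa [norm_fst_of_ne z (by omega) (by omega), norm_fst_of_ne z' (by omega) (by omega)] at this
    · have := congrFun (congrArg Prod.fst e) q
      rwa [norm_fst_of_ne z (by omega) (by omega), norm_fst_of_ne z' (by omega) (by omega)] at this
  · by_cases hl : K < l ∧ l ≤ 2 * K
    · have := congrArg Prod.snd e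
      rwa [norm_snd z hl, norm_snd z' hl] at this
    by_cases hl' : K < l + 1 ∧ l + 1 ≤ 2 * K
    · have := congrArg Prod.snd e'
      rwa [norm_snd z hl', norm_snd z' hl'] at this
    · rw [edgeAt_outer (by omega)] at h h'
      rw [h, h']

/-- An edge determines its kind and its label. -/
theorem ends_injective (h0 : ∀ p x, bit p 0 x) (hK : K ≠ 0) {P P' : Bool × ℕ} {z z' : Tup K n d}
    (h : Present bit P z) (h' : Present bit P' z')
    (he : s((ends P z).1, (ends P z).2) = s((ends P' z').1, (ends P' z').2)) :
    P = P' ∧ z = z' := by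
  -- Both ends of a layer edge are valid, whereas a leaf is not.
  have mixed : ∀ {l l' : ℕ} {z z' : Tup K n d}, EdgeAt bit l z → ¬ Valid bit (l', z') →
      s((l, norm l z), (l + 1, norm (l + 1) z)) ≠ s(((0, 0) : ℕ × Tup K n d), (l', z')) := by
    intro l l' z z' h h' he
    rcases Sym2.eq_iff.1 he with ⟨-, e⟩ | ⟨e, -⟩
    · exact h' (e ▸ h.valid_high h0)
    · exact h' (e ▸ h.valid_low h0)
  obtain ⟨b, l⟩ := P
  obtain ⟨b', l'⟩ := P'
  cases b <;> cases b' <;> simp only [Present, ends, if_true, Bool.false_eq_true, if_false] at h h' he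
  · rcases Sym2.eq_iff.1 he with ⟨-, e⟩ | ⟨e, -⟩
    · exact ⟨congrArg (Prod.mk false) (Prod.ext_iff.1 e).1, (Prod.ext_iff.1 e).2⟩
    · exact absurd (e ▸ valid_hub) h'
  · exact absurd he.symm (mixed h' h)
  · exact absurd he (mixed h h')
  · rcases Sym2.eq_iff.1 he with ⟨e, e'⟩ | ⟨e, e'⟩
    · obtain rfl : l = l' := (Prod.ext_iff.1 e).1
      exact ⟨rfl, norm_pair_injective hK h h' (Prod.ext_iff.1 e).2 (Prod.ext_iff.1 e').2⟩
    · have h1 : l = l' + 1 := (Prod.ext_iff.1 e).1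
      have h2 : l + 1 = l' := (Prod.ext_iff.1 e').1
      omega

theorem nodup_flatMap_of_disjoint {α β : Type*} {l : List α} {f : α → List β} (hl : l.Nodup)
    (hf : ∀ x ∈ l, (f x).Nodup) (h : ∀ x ∈ l, ∀ y ∈ l, ∀ b ∈ f x, b ∈ f y → x = y) :
    (l.flatMap f).Nodup :=
  List.nodup_flatMap.2 ⟨hf, hl.imp_of_mem fun hx hy hne b hb hb' => hne (h _ hx _ hy b hb hb')⟩

theorem nodup_edges (h0 : ∀ p x, bit p 0 x) (hK : K ≠ 0) :
    ((edges bit K).map fun e => s(e.1, e.2)).Nodup := by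
  have mem : ∀ {P : Bool × ℕ} {z : Tup K n d} {e : Sym2 (ℕ × Tup K n d)},
      e ∈ (edgeOpt bit P z).map (fun e => s(e.1, e.2)) →
        Present bit P z ∧ e = s((ends P z).1, (ends P z).2) := by
    intro P z e h
    unfold edgeOpt at h
    split_ifs at h with hc
    · exact ⟨hc, by simpa using h⟩
    · simp at h
  simp only [edges, List.map_flatMap]
  refine nodup_flatMap_of_disjoint ?_ (fun P _ => nodup_flatMap_of_disjoint List.nodup_range
    (fun y _ => ?_) fun y hy y' hy' e he he' => ?_) fun P _ P' _ e he he' => ?_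
  · refine List.Nodup.append (List.nodup_range.map fun a b h => by simpa using h)
      (List.nodup_range.map fun a b h => by simpa using h) fun P h h' => ?_
    simp only [List.mem_map] at h h'
    obtain ⟨l, -, rfl⟩ := h
    obtain ⟨l', -, h⟩ := h'
    simp at h
  · unfold edgeOpt
    split_ifs <;> simp
  · obtain ⟨h1, rfl⟩ := mem he
    obtain ⟨h2, h⟩ := mem he'
    rw [← rank_ofRank (K := K) (n := n) (d := d) (List.mem_range.1 hy),
      (ends_injective h0 hK h1 h2 h).2, rank_ofRank (List.mem_range.1 hy')]
  · obtain ⟨y, -, he⟩ := List.mem_flatMap.1 he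
    obtain ⟨y', -, he'⟩ := List.mem_flatMap.1 he'
    obtain ⟨h1, rfl⟩ := mem he
    obtain ⟨h2, h⟩ := mem he'
    exact (ends_injective h0 hK h1 h2 h).1

theorem isEdgeList_edgeList (h0 : ∀ p x, bit p 0 x) (hK : K ≠ 0) :
    IsEdgeList (graph bit K) (edgeList bit K) := by
  have inv : ∀ e ∈ edges bit K, s(name (Fin.ofNat (order K n d) (code e.1)),
      name (Fin.ofNat (order K n d) (code e.2))) = s(e.1, e.2) := by
    intro e he
    have := (mem_edges.1 he).fst_lt
    rw [name_ofNat_code this.1, name_ofNat_code this.2]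
  constructor
  · refine List.Nodup.of_map (Sym2.map name) ?_
    rw [edgeList, List.map_map, List.map_map]
    convert nodup_edges h0 hK using 1
    exact List.map_congr_left inv
  · intro u v
    simp only [graph, SimpleGraph.comap_adj, layered_adj, edgeList, List.map_map, List.mem_map,
      Function.comp_apply]
    constructor
    · rintro (h | h)
      · exact ⟨(name u, name v), mem_edges.2 h, by simp [code_name]⟩
      · exact ⟨(name v, name u), mem_edges.2 h, by simp [code_name]⟩
    · rintro ⟨e, he, h⟩
      have h' := congrArg (Sym2.map name) h
      simp only [Sym2.map_mk] at h'
      rw [inv e he] at h'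
      have hr := mem_edges.1 he
      rcases Sym2.eq_iff.1 h' with ⟨e1, e2⟩ | ⟨e1, e2⟩
      · exact .inl (by rwa [← e1, ← e2])
      · exact .inr (by rwa [← e1, ← e2])

end LayeredGraph

namespace WordRAM.Ex

/-! ### Expressions for the reduction -/

def add (a b : Ex) : Ex := op .add a b
def sub (a b : Ex) : Ex := op .sub a b
def mul (a b : Ex) : Ex := op .mul a b
def div (a b : Ex) : Ex := op .div a b
def mod (a b : Ex) : Ex := op .mod a b
def lt (a b : Ex) : Ex := op .lt a b
def eq (a b : Ex) : Ex := op .eq a b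

/-- The sum of a list of expressions. -/
def sum (l : List Ex) : Ex := l.foldr add (num 0)

/-- The product of a list of expressions. -/
def prod (l : List Ex) : Ex := l.foldr mul (num 1)

/-- A power with a fixed exponent. -/
def pow (e : Ex) (q : ℕ) : Ex := prod (List.replicate q e)

variable (s : State) (a b : Ex)

@[simp] theorem eval_var (r : ℕ) : (var r).eval s = s.reg r := rfl
@[simp] theorem eval_num (v : ℕ) : (num v).eval s = v := rfl
@[simp] theorem eval_get : (get a).eval s = s.mem (a.eval s) := rfl
@[simp] theorem eval_add : (add a b).eval s = a.eval s + b.eval s := rfl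
@[simp] theorem eval_sub : (sub a b).eval s = a.eval s - b.eval s := rfl
@[simp] theorem eval_mul : (mul a b).eval s = a.eval s * b.eval s := rfl
@[simp] theorem eval_div : (div a b).eval s = a.eval s / b.eval s := rfl
@[simp] theorem eval_mod : (mod a b).eval s = a.eval s % b.eval s := rfl
@[simp] theorem eval_lt : (lt a b).eval s = if a.eval s < b.eval s then 1 else 0 := rfl
@[simp] theorem eval_eq : (eq a b).eval s = if a.eval s = b.eval s then 1 else 0 := rfl

@[simp] theorem eval_sum (l : List Ex) : (sum l).eval s = (l.map fun e => e.eval s).sum := by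
  induction l with
  | nil => rfl
  | cons e l ih => simp only [sum, List.foldr_cons, eval_add] at ih ⊢; simp [ih]

@[simp] theorem eval_prod (l : List Ex) : (prod l).eval s = (l.map fun e => e.eval s).prod := by
  induction l with
  | nil => rfl
  | cons e l ih => simp only [prod, List.foldr_cons, eval_mul] at ih ⊢; simp [ih]

@[simp] theorem eval_pow (q : ℕ) : (pow a q).eval s = a.eval s ^ q := by simp [pow]

end WordRAM.Ex

/-! ### Arithmetic expressions for the tests and vertex numbers of the layered graph. -/

namespace LayeredGraph

open WordRAM.Ex

/-- The vector `v` of collection `p` has a `1` at coordinate `x`. The collections of an instance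
with input `inp` are extended by an all-ones vector with index `0`, and the dimension is extended in
such a way that tuples with a new vector are not orthogonal. -/
def bitOf (inp : ℕ → ℕ) (n d p v x : ℕ) : Prop :=
  v = 0 ∨ (d ≤ x ∧ x ≠ d + p) ∨ (x < d ∧ inp (2 + ((p * n + (v - 1)) * d + x)) ≠ 0)

/-- The extended instance. -/
def extBit (K n d : ℕ) (inp : ℕ → ℕ) (p : ℕ) (v : Fin (n + 1)) (x : Fin (d + K + 1)) : Prop :=
  bitOf inp n d p v x

section

variable (K R : ℕ)

/-- The number of vectors in each extended collection. -/
def countE : Ex := add (var R) (num 1)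

/-- The extended dimension. -/
def dimE : Ex := add (add (var (R + 1)) (num K)) (num 1)

/-- The number of vertices in a layer. -/
def widthE : Ex := mul (pow (countE R) K) (pow (dimE K R) K)

/-- The vector indices of the current label. -/
def vecE (q : ℕ) : Ex :=
  mod (div (div (var (R + 4)) (pow (dimE K R) K)) (pow (countE R) q)) (countE R)

/-- The number of the list of coordinates of the current label. -/
def restE : Ex := mod (var (R + 4)) (pow (dimE K R) K)

/-- The coordinates of the current label. -/
def coordE (m : ℕ) : Ex := mod (div (restE K R) (pow (dimE K R) m)) (dimE K R)

/-- The test `bitOf`. -/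
def bitE (p : ℕ) (v x : Ex) : Ex :=
  -- Nonzero means true: sums are disjunctions, products conjunctions, `1 - x` negation. The memory
  -- is read even where the guard `x < d` fails; the factor `0` then discards whatever stands there.
  add (eq v (num 0))
    (add (mul (lt (var (R + 1)) (add x (num 1))) (sub (num 1) (eq x (add (var (R + 1)) (num p)))))
      (mul (lt x (var (R + 1))) (Ex.get (add (num 2)
        (add (mul (add (mul (num p) (var R)) (sub v (num 1))) (var (R + 1))) x)))))

/-- The test `Good`. -/
def goodE (i : ℕ) : Ex :=
  prod ((List.finRange K).map fun q : Fin K => prod ((List.finRange K).map fun m : Fin K =>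
    mul (if (q : ℕ) < i ∧ q ≤ m then bitE R q (vecE K R q) (coordE K R m) else num 1)
      (if i ≤ q ∧ m ≤ q then bitE R (q + 1) (vecE K R q) (coordE K R m) else num 1)))

/-- The test `EdgeAt`. -/
def edgeAtE (l : ℕ) : Ex :=
  if K ≤ l ∧ l ≤ 2 * K then goodE K R (l - K) else eq (restE K R) (num 0)

/-- The number of the label `norm`. -/
def normE (l : ℕ) : Ex :=
  add (mul (sum ((List.finRange K).map fun q : Fin K => if l = 0 ∨ (q : ℕ) + K + 1 = l then num 0 else
    mul (vecE K R q) (pow (countE R) q))) (pow (dimE K R) K))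
    (if K < l ∧ l ≤ 2 * K then restE K R else num 0)

/-- The test `Valid`. -/
def validE (l : ℕ) : Ex :=
  mul (eq (normE K R l) (var (R + 4))) (if K < l ∧ l ≤ 2 * K then goodE K R (l - K) else num 1)

/-- The number of a vertex. -/
def codeE (l : ℕ) (e : Ex) : Ex := add (mul (num l) (widthE K R)) e

/-- The test `Present`. -/
def presentE (P : Bool × ℕ) : Ex :=
  if P.1 then edgeAtE K R P.2 else eq (validE K R P.2) (num 0)

/-- The first end point. -/
def fstE (P : Bool × ℕ) : Ex := if P.1 then codeE K R P.2 (normE K R P.2) else num 0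

/-- The second end point. -/
def sndE (P : Bool × ℕ) : Ex :=
  if P.1 then codeE K R (P.2 + 1) (normE K R (P.2 + 1)) else codeE K R P.2 (var (R + 4))

/-- The registers contain the size of the instance and the current label. -/
structure Holds (R n d y : ℕ) (s : State) : Prop where
  count : s.reg R = n
  dim : s.reg (R + 1) = d
  label : s.reg (R + 4) = y

variable {K R} {n d y : ℕ} {s : State} {inp : ℕ → ℕ}

theorem Holds.eval_countE (h : Holds R n d y s) : (countE R).eval s = n + 1 := by
  simp [countE, h.count]

theorem Holds.eval_dimE (h : Holds R n d y s) : (dimE K R).eval s = d + K + 1 := by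
  simp [dimE, h.dim]

theorem Holds.eval_widthE (h : Holds R n d y s) :
    (widthE K R).eval s = width K (n + 1) (d + K + 1) := by
  simp [widthE, h.eval_countE, h.eval_dimE, width]

theorem Holds.eval_vecE (h : Holds R n d y s) (q : Fin K) :
    (vecE K R q).eval s = ((ofRank y : Tup K (n + 1) (d + K + 1)).1 q : ℕ) := by
  simp [vecE, h.eval_countE, h.eval_dimE, h.label, ofRank]

theorem Holds.eval_restE (h : Holds R n d y s) :
    (restE K R).eval s = ∑ q, ((ofRank y : Tup K (n + 1) (d + K + 1)).2 q : ℕ) *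
      (d + K + 1) ^ (q : ℕ) := by
  simp only [ofRank]
  rw [sum_digits (Nat.mod_lt _ (by positivity))]
  simp [restE, h.eval_dimE, h.label]

theorem Holds.eval_coordE (h : Holds R n d y s) (m : Fin K) :
    (coordE K R m).eval s = ((ofRank y : Tup K (n + 1) (d + K + 1)).2 m : ℕ) := by
  simp [coordE, restE, h.eval_dimE, h.label, ofRank]

theorem Holds.eval_bitE (h : Holds R n d y s) (hm : ∀ a < 2 + (K + 1) * n * d, s.mem a = inp a)
    {p : ℕ} (hp : p ≤ K) {v x : Ex} (hv : v.eval s < n + 1) :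
    (bitE R p v x).eval s ≠ 0 ↔ bitOf inp n d p (v.eval s) (x.eval s) := by
  generalize hv' : v.eval s = v' at hv
  generalize hx' : x.eval s = x'
  have e : (bitE R p v x).eval s = (if v' = 0 then 1 else 0) +
      ((if d < x' + 1 then 1 else 0) * (1 - if x' = d + p then 1 else 0) +
        (if x' < d then 1 else 0) * s.mem (2 + ((p * n + (v' - 1)) * d + x'))) := by
    simp only [bitE, eval_add, eval_mul, eval_sub, eval_lt, eval_eq, eval_num, eval_var, eval_get,
      hv', hx', h.count, h.dim]
  rw [e, bitOf]
  by_cases h0 : v' = 0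
  · simp [h0]
  by_cases hx : x' < d
  · have haddr : 2 + ((p * n + (v' - 1)) * d + x') < 2 + (K + 1) * n * d := by
      have h1 : p * n + (v' - 1) + 1 ≤ (K + 1) * n := by
        have : p * n ≤ K * n := Nat.mul_le_mul_right _ hp
        rw [add_mul, one_mul]; omega
      have h2 := Nat.mul_le_mul_right d h1
      rw [add_mul, one_mul] at h2
      omega
    rw [hm _ haddr]
    simp [h0, hx, show ¬ d ≤ x' by omega, show ¬ d < x' + 1 by omega]
  · by_cases hxp : x' = d + p
    · simp [h0, hxp]
    · simp [h0, hx, hxp, show d ≤ x' by omega, show d < x' + 1 by omega]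

theorem Holds.eval_goodE (h : Holds R n d y s) (hm : ∀ a < 2 + (K + 1) * n * d, s.mem a = inp a)
    (i : ℕ) : (goodE K R i).eval s ≠ 0 ↔
      Good (extBit K n d inp) i (ofRank y : Tup K (n + 1) (d + K + 1)) := by
  have hb : ∀ (q m : Fin K) (p : ℕ), p ≤ K →
      ((bitE R p (vecE K R q) (coordE K R m)).eval s ≠ 0 ↔ extBit K n d inp p
        ((ofRank y : Tup K (n + 1) (d + K + 1)).1 q) ((ofRank y : Tup K (n + 1) (d + K + 1)).2 m)) := by
    intro q m p hp
    rw [h.eval_bitE hm hp (by rw [h.eval_vecE]; exact Fin.is_lt _), h.eval_vecE, h.eval_coordE]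
    rfl
  have ht : ∀ (c : Prop) [Decidable c] (e : Ex),
      ((if c then e else num 1).eval s ≠ 0 ↔ (c → e.eval s ≠ 0)) := by
    intro c _ e
    split_ifs with hc <;> simp [hc]
  rw [goodE, eval_prod, Good, Ne, List.prod_eq_zero_iff]
  simp only [List.map_map, List.mem_map, List.mem_finRange, true_and, Function.comp_apply,
    not_exists]
  refine forall_congr' fun q => ?_
  rw [eval_prod, ← Ne, Ne, List.prod_eq_zero_iff]
  simp only [List.map_map, List.mem_map, List.mem_finRange, true_and, Function.comp_apply,
    not_exists]
  refine forall_congr' fun m => ?_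
  rw [eval_mul, mul_eq_zero, not_or, ← Ne, ← Ne, ht, ht, hb q m q q.2.le, hb q m (q + 1) q.2,
    and_imp, and_imp]

theorem Holds.eval_edgeAtE (h : Holds R n d y s)
    (hm : ∀ a < 2 + (K + 1) * n * d, s.mem a = inp a) (l : ℕ) :
    (edgeAtE K R l).eval s ≠ 0 ↔
      EdgeAt (extBit K n d inp) l (ofRank y : Tup K (n + 1) (d + K + 1)) := by
  unfold edgeAtE EdgeAt
  split_ifs
  · exact h.eval_goodE hm _
  · rw [eval_eq, h.eval_restE, eval_num]
    simp only [ne_eq, ite_eq_right_iff, one_ne_zero, imp_false, not_not]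
    rw [Finset.sum_eq_zero_iff]
    simp only [Finset.mem_univ, true_imp_iff, mul_eq_zero, funext_iff, Pi.zero_apply, Fin.ext_iff,
      Fin.val_zero]
    exact forall_congr' fun q => or_iff_left (by positivity)

theorem Holds.eval_normE (h : Holds R n d y s) (l : ℕ) :
    (normE K R l).eval s = rank (norm l (ofRank y : Tup K (n + 1) (d + K + 1))) := by
  unfold normE LayeredGraph.rank norm
  rw [eval_add, eval_mul, eval_sum, eval_pow, h.eval_dimE, List.map_map, ← Fin.sum_univ_def]
  congr 1
  · congr 1
    refine Finset.sum_congr rfl fun q _ => ?_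
    simp only [Function.comp_apply]
    split_ifs
    · simp
    · simp [h.eval_vecE, h.eval_countE]
  · split_ifs
    · exact h.eval_restE
    · simp

theorem Holds.eval_validE (h : Holds R n d y s)
    (hm : ∀ a < 2 + (K + 1) * n * d, s.mem a = inp a) (hy : y < width K (n + 1) (d + K + 1))
    (l : ℕ) : (validE K R l).eval s ≠ 0 ↔
      Valid (extBit K n d inp) (l, (ofRank y : Tup K (n + 1) (d + K + 1))) := by
  unfold validE Valid
  rw [eval_mul, Ne, mul_eq_zero, not_or, eval_eq, h.eval_normE, eval_var, h.label]
  simp only [ite_eq_right_iff, one_ne_zero, imp_false, not_not]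
  refine and_congr ⟨fun e => ?_, fun e => ?_⟩ ?_
  · rw [← ofRank_rank (norm l _), e]
  · rw [e, rank_ofRank hy]
  · split_ifs with hl
    · rw [← Ne, h.eval_goodE hm]
      exact ⟨fun h _ _ => h, fun h => h hl.1 hl.2⟩
    · simp only [eval_num, one_ne_zero, not_false_eq_true, true_iff]
      exact fun h1 h2 => absurd ⟨h1, h2⟩ hl

theorem Holds.eval_presentE (h : Holds R n d y s)
    (hm : ∀ a < 2 + (K + 1) * n * d, s.mem a = inp a) (hy : y < width K (n + 1) (d + K + 1))
    (P : Bool × ℕ) : (presentE K R P).eval s ≠ 0 ↔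
      Present (extBit K n d inp) P (ofRank y : Tup K (n + 1) (d + K + 1)) := by
  unfold presentE Present
  split_ifs
  · exact h.eval_edgeAtE hm _
  · rw [← h.eval_validE hm hy]
    by_cases h0 : (validE K R P.2).eval s = 0 <;> simp [h0]

theorem Holds.eval_fstE (h : Holds R n d y s) (P : Bool × ℕ) :
    (fstE K R P).eval s = code (ends P (ofRank y : Tup K (n + 1) (d + K + 1))).1 := by
  unfold fstE ends
  split_ifs
  · simp [codeE, code, h.eval_widthE, h.eval_normE]
  · simp only [code, eval_num]
    simp [rank_zero]

theorem Holds.eval_sndE (h : Holds R n d y s) (hy : y < width K (n + 1) (d + K + 1))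
    (P : Bool × ℕ) :
    (sndE K R P).eval s = code (ends P (ofRank y : Tup K (n + 1) (d + K + 1))).2 := by
  unfold sndE ends
  split_ifs
  · simp [codeE, code, h.eval_widthE, h.eval_normE]
  · simp [codeE, code, h.eval_widthE, h.label, rank_ofRank hy]

end

end LayeredGraph

namespace LayeredGraph

open WordRAM.Ex

/-! ### The reduction program -/

/-- Registers with the six variables of the reduction from register `R` on. -/
def env (R : ℕ) (g : ℕ → ℕ) (n d b p y z r : ℕ) : ℕ :=
  if r < R then g r else if r = R then n else if r = R + 1 then d else if r = R + 2 then b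
  else if r = R + 3 then p else if r = R + 4 then y else if r = R + 5 then z else 0

section env

variable (R : ℕ) (g : ℕ → ℕ) (n d b p y z v : ℕ)

@[simp] theorem env_zero : env R g n d b p y z R = n := by simp [env]
@[simp] theorem env_one : env R g n d b p y z (R + 1) = d := by simp [env]
@[simp] theorem env_two : env R g n d b p y z (R + 2) = b := by simp [env]
@[simp] theorem env_three : env R g n d b p y z (R + 3) = p := by simp [env]
@[simp] theorem env_four : env R g n d b p y z (R + 4) = y := by simp [env]
@[simp] theorem env_five : env R g n d b p y z (R + 5) = z := by simp [env]

variable (m : ℕ → ℕ)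

theorem setReg_zero : (State.mk (env R g n d b p y z) m).setReg R v =
    ⟨env R g v d b p y z, m⟩ := by
  simp only [State.setReg, State.mk.injEq, and_true]
  funext r; simp only [env, Function.update_apply]; split_ifs <;> first | rfl | omega

theorem setReg_one : (State.mk (env R g n d b p y z) m).setReg (R + 1) v =
    ⟨env R g n v b p y z, m⟩ := by
  simp only [State.setReg, State.mk.injEq, and_true]
  funext r; simp only [env, Function.update_apply]; split_ifs <;> first | rfl | omega

theorem setReg_two : (State.mk (env R g n d b p y z) m).setReg (R + 2) v =
    ⟨env R g n d v p y z, m⟩ := by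
  simp only [State.setReg, State.mk.injEq, and_true]
  funext r; simp only [env, Function.update_apply]; split_ifs <;> first | rfl | omega

theorem setReg_three : (State.mk (env R g n d b p y z) m).setReg (R + 3) v =
    ⟨env R g n d b v y z, m⟩ := by
  simp only [State.setReg, State.mk.injEq, and_true]
  funext r; simp only [env, Function.update_apply]; split_ifs <;> first | rfl | omega

theorem setReg_four : (State.mk (env R g n d b p y z) m).setReg (R + 4) v =
    ⟨env R g n d b p v z, m⟩ := by
  simp only [State.setReg, State.mk.injEq, and_true]
  funext r; simp only [env, Function.update_apply]; split_ifs <;> first | rfl | omega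

theorem setReg_five : (State.mk (env R g n d b p y z) m).setReg (R + 5) v =
    ⟨env R g n d b p y v, m⟩ := by
  simp only [State.setReg, State.mk.injEq, and_true]
  funext r; simp only [env, Function.update_apply]; split_ifs <;> first | rfl | omega

theorem bounded_env {R n d b p y z t B : ℕ} {g m : ℕ → ℕ} (hg : ∀ r < R, g r ≤ B) (hn : n ≤ B)
    (hd : d ≤ B) (hb : b ≤ B) (hp : p ≤ B) (hy : y ≤ B) (hz : z ≤ B) (hm : ∀ a, m a ≤ B) :
    (State.mk (env R g n d b p y z) m).Bounded t B := by
  refine ⟨fun r _ => ?_, hm⟩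
  simp only [env]
  split_ifs with h <;> first | assumption | exact hg r h | exact Nat.zero_le _

end env

section programs

variable (t K R : ℕ)

/-- The first memory cell after the instance. -/
def baseE : Ex := add (num 2) (mul (mul (num (K + 1)) (var R)) (var (R + 1)))

/-- The number of vertices. -/
def orderE : Ex := mul (num (3 * K + 2)) (widthE K R)

/-- The next free memory cell. -/
def nextE : Ex := add (var (R + 3)) (num 1)

/-- The memory cell for the number of edges. -/
def lenCellE : Ex := add (var (R + 2)) (num 1)

/-- The number of edges. -/
def lenE : Ex := div (sub (var (R + 3)) (add (var (R + 2)) (num 2))) (num 2)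

/-- The number of vertices that decide the instance. -/
def scanE : Ex := pow (countE R) K

/-- The test of the output at such a vertex. -/
def testE (θ : ℕ) : Ex :=
  lt (num θ) (add (Ex.get (add (var (R + 2))
    (add (mul (num K) (widthE K R)) (mul (var (R + 4)) (pow (dimE K R) K))))) (num 1))

/-- All expressions that occur in the reduction. -/
def exprs (θ : ℕ) : List Ex :=
  [num 0, num 1, Ex.get (num 0), Ex.get (num 1), var (R + 2), var (R + 3), var (R + 5), baseE K R,
    orderE K R, nextE R, lenCellE R, lenE R, scanE K R, testE K R θ, widthE K R] ++
    (passes K).map (presentE K R) ++ (passes K).map (fstE K R) ++ (passes K).map (sndE K R)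

/-- Append the value of an expression to the list under construction. -/
def emit (e : Ex) : Prog := .seq (.write t (var (R + 3)) e) (.assign t (R + 3) (nextE R))

/-- Append all edges of a given kind. -/
def passProg (P : Bool × ℕ) : Prog :=
  .upTo t (R + 4) (widthE K R)
    (.when t (presentE K R P) (.seq (emit t R (fstE K R P)) (emit t R (sndE K R P))))

/-- Append all edges of given kinds. -/
def passesProg : List (Bool × ℕ) → Prog
  | [] => .skip
  | P :: l => .seq (passProg t K R P) (passesProg l)

/-- Initialize the variables. -/
def initProg : Prog :=
  .seq (.assign t R (.get (num 0))) (.seq (.assign t (R + 1) (.get (num 1)))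
    (.seq (.assign t (R + 2) (baseE K R)) (.assign t (R + 3) (var (R + 2)))))

/-- Write the encoding of the layered graph. -/
def buildProg : Prog :=
  -- The `0` reserves the cell for the number of edges, known only after all of them are written.
  .seq (initProg t K R) (.seq (emit t R (orderE K R)) (.seq (emit t R (num 0))
    (.seq (passesProg t K R (passes K)) (.write t (lenCellE R) (lenE R)))))

/-- Test whether an output at a deciding vertex is at least `θ`. -/
def scanProg (θ : ℕ) : Prog :=
  .seq (.upTo t (R + 4) (scanE K R) (.when t (testE K R θ) (.assign t (R + 5) (num 1))))
    (.write t (num 0) (var (R + 5)))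

/-- The first scratch register. -/
def scratch (θ : ℕ) : ℕ := R + 6 + ((exprs K R θ).map Ex.varBound).sum

/-- The reduction from orthogonal vectors to a problem on the layered graph that is solved by
`p`. -/
def reduction (θ : ℕ) (p : Prog) : Prog :=
  let R := p.regBound
  let t := scratch K R θ
  .seq (buildProg t K R) (.seq (p.relocate (R + 2) t) (scanProg t K R θ))

end programs

/-- The parameters of a run of the reduction: word size `w`, a bound `B` for all numbers, a bound
`m` for the sizes and `τ` for the running times of the expressions. -/
structure Run (K R n d θ w B m τ : ℕ) (inp : List ℕ) : Prop where
  length : inp.length ≤ 2 + (K + 1) * n * d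
  count : inp.getD 0 0 = n
  dim : inp.getD 1 0 = d
  le : ∀ x ∈ inp, x ≤ B
  num : ∀ e ∈ exprs K R θ, e.numBound ≤ B
  size : ∀ e ∈ exprs K R θ, e.size + 2 ≤ m
  steps : ∀ e ∈ exprs K R θ, e.steps ≤ τ
  two_le : 2 ≤ B
  lt : B ^ m < 2 ^ w
  room : 2 + (K + 1) * n * d + 4 * order K (n + 1) (d + K + 1) + 4 ≤ B

/-- The instance, followed by a list. -/
def memOf (inp : List ℕ) (b : ℕ) (l : List ℕ) (a : ℕ) : ℕ :=
  if a < b then inp.getD a 0 else l.getD (a - b) 0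

theorem memOf_append (inp : List ℕ) (b : ℕ) (l : List ℕ) (v : ℕ) :
    Function.update (memOf inp b l) (b + l.length) v = memOf inp b (l ++ [v]) := by
  funext a
  simp only [memOf, Function.update_apply]
  by_cases h1 : a < b
  · simp [h1, show a ≠ b + l.length by omega]
  · simp only [h1, if_false]
    by_cases h2 : a = b + l.length
    · subst h2
      simp
    · rw [if_neg h2]
      by_cases h3 : a - b < l.length
      · rw [List.getD_append _ _ _ _ h3]
      · rw [List.getD_append_right _ _ _ _ (by omega), List.getD_eq_default _ _ (by omega),
          List.getD_eq_default _ _ (by simp; omega)]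

theorem memOf_le {inp l : List ℕ} {b B : ℕ} (h : ∀ x ∈ inp, x ≤ B) (hl : ∀ x ∈ l, x ≤ B) (a : ℕ) :
    memOf inp b l a ≤ B := by
  have key : ∀ (l : List ℕ) (i : ℕ), (∀ x ∈ l, x ≤ B) → l.getD i 0 ≤ B := by
    intro l i hl
    by_cases hi : i < l.length
    · rw [List.getD_eq_getElem _ _ hi]; exact hl _ (List.getElem_mem hi)
    · rw [List.getD_eq_default _ _ (by omega)]; exact Nat.zero_le _
  unfold memOf
  split_ifs
  · exact key _ _ h
  · exact key _ _ hl

/-! ### Correctness and cost of writing the graph. -/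

section

variable {K R n d θ w B m τ : ℕ} {inp : List ℕ}

/-- The configuration in which the list `l` has been written. -/
def building (K R n d : ℕ) (inp : List ℕ) (l : List ℕ) (y : ℕ) : State :=
  ⟨env R 0 n d (2 + (K + 1) * n * d) (2 + (K + 1) * n * d + l.length) y 0,
    memOf inp (2 + (K + 1) * n * d) l⟩

theorem Run.fits (h : Run K R n d θ w B m τ inp) {e : Ex} (he : e ∈ exprs K R θ) :
    e.Fits (scratch K R θ) B m := by
  refine ⟨?_, h.num e he, by have := h.size e he; omega⟩
  have := List.single_le_sum (fun _ _ => Nat.zero_le _) _ (List.mem_map_of_mem (f := Ex.varBound) he)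
  unfold scratch
  omega

theorem lt_scratch {i : ℕ} (hi : i < 6) : R + i < scratch K R θ := by unfold scratch; omega

/-- A list that may occur during the construction. -/
structure Small (K n d B : ℕ) (l : List ℕ) (c : ℕ) : Prop where
  le : ∀ x ∈ l, x ≤ B
  -- `c` is the number of words that may still be appended. The total provides two header words and
  -- two words for each of up to `2N` edges.
  length : l.length + c ≤ 4 * order K (n + 1) (d + K + 1) + 2

theorem width_le_order : width K (n + 1) (d + K + 1) ≤ order K (n + 1) (d + K + 1) :=
  Nat.le_mul_of_pos_left _ (by omega)

theorem Run.n_le (h : Run K R n d θ w B m τ inp) : n ≤ B ∧ d ≤ B := by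
  rw [← h.count, ← h.dim]
  have := memOf_le (b := 2) h.le (l := []) (by simp)
  exact ⟨by simpa [memOf] using this 0, by simpa [memOf] using this 1⟩

theorem Run.bounded_building (h : Run K R n d θ w B m τ inp) {l : List ℕ} {c : ℕ}
    (hl : Small K n d B l c) {y : ℕ} (hy : y ≤ order K (n + 1) (d + K + 1)) {t : ℕ} :
    (building K R n d inp l y).Bounded t B := by
  have := h.room
  have := hl.length
  exact bounded_env (fun _ _ => Nat.zero_le _) h.n_le.1 h.n_le.2 (by omega) (by omega) (by omega)
    (by omega) (memOf_le h.le hl.le)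

theorem holds_building (l : List ℕ) (y : ℕ) : Holds R n d y (building K R n d inp l y) :=
  ⟨env_zero .., env_one .., env_four ..⟩

theorem mem_building (l : List ℕ) (y : ℕ) : ∀ a < 2 + (K + 1) * n * d,
    (building K R n d inp l y).mem a = inp.getD a 0 := by
  intro a ha
  simp [building, memOf, ha]

theorem Run.does_emit (h : Run K R n d θ w B m τ inp) {l : List ℕ} {c : ℕ}
    (hl : Small K n d B l (c + 1)) {y v : ℕ} (hy : y ≤ order K (n + 1) (d + K + 1)) {e : Ex}
    (he : e ∈ exprs K R θ) (hv : e.eval (building K R n d inp l y) = v) (hvB : v ≤ B) :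
    Does w (scratch K R θ) (τ + 6) (emit (scratch K R θ) R e) (building K R n d inp l y)
      (building K R n d inp (l ++ [v]) y) ∧ Small K n d B (l ++ [v]) c := by
  have hroom := h.room
  have hlen := hl.length
  have hs : Small K n d B (l ++ [v]) c := by
    refine ⟨fun x hx => ?_, by simp; omega⟩
    rcases List.mem_append.1 hx with hx | hx
    · exact hl.le x hx
    · rw [List.mem_singleton.1 hx]; exact hvB
  refine ⟨?_, hs⟩
  have h1 := does_write (h.bounded_building hl hy) h.two_le h.lt
    (h.fits (e := var (R + 3)) (by simp [exprs])) (h.fits he)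
  rw [hv] at h1
  have e1 : ((building K R n d inp l y).setMem ((var (R + 3)).eval (building K R n d inp l y)) v) =
      ⟨env R 0 n d (2 + (K + 1) * n * d) (2 + (K + 1) * n * d + l.length) y 0,
        memOf inp (2 + (K + 1) * n * d) (l ++ [v])⟩ := by
    simp only [State.setMem, building, eval_var, env_three, memOf_append]
  rw [e1] at h1
  have hb : (State.mk (env R 0 n d (2 + (K + 1) * n * d) (2 + (K + 1) * n * d + l.length) y 0)
      (memOf inp (2 + (K + 1) * n * d) (l ++ [v]))).Bounded (scratch K R θ) B :=
    bounded_env (fun _ _ => Nat.zero_le _) h.n_le.1 h.n_le.2 (by omega) (by omega) (by omega)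
      (by omega) (memOf_le h.le hs.le)
  have h2 := does_assign hb h.two_le h.lt (h.fits (e := nextE R) (by simp [exprs])) (R + 3)
  rw [setReg_three, show (nextE R).eval (State.mk (env R 0 n d (2 + (K + 1) * n * d)
    (2 + (K + 1) * n * d + l.length) y 0) (memOf inp (2 + (K + 1) * n * d) (l ++ [v]))) =
      2 + (K + 1) * n * d + (l ++ [v]).length by simp [nextE, add_assoc]] at h2
  have h3 := h1.seq h2
  have hτ := h.steps e he
  exact h3.mono (by simp only [Ex.steps, nextE, add]; omega)

variable (K n d inp) in
/-- The extended instance with a given encoding. -/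
abbrev listBit : ℕ → Fin (n + 1) → Fin (d + K + 1) → Prop := extBit K n d fun a => inp.getD a 0

theorem Run.code_le (h : Run K R n d θ w B m τ inp) {p : ℕ × Tup K (n + 1) (d + K + 1)}
    (hp : p.1 < 3 * K + 2) : code p ≤ B := by
  have := code_lt hp
  have := h.room
  omega

theorem present_lt {P : Bool × ℕ} (hP : P ∈ passes K) (z : Tup K (n + 1) (d + K + 1)) :
    (ends P z).1.1 < 3 * K + 2 ∧ (ends P z).2.1 < 3 * K + 2 := by
  obtain ⟨b, l⟩ := P
  cases b
  · have hl : l < 3 * K + 2 := by simpa [passes] using hP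
    exact ⟨by simp [ends], by simpa [ends] using hl⟩
  · have hl : l < 3 * K + 1 := by simpa [passes] using hP
    exact ⟨by simp [ends]; omega, by simp [ends]; omega⟩

variable (K n d inp) in
/-- The encoding of the edge of a given kind with a given label. -/
noncomputable def edgeCodes (P : Bool × ℕ) (y : ℕ) : List ℕ :=
  (edgeOpt (listBit K n d inp) P (ofRank y : Tup K (n + 1) (d + K + 1))).flatMap
    fun e => [code e.1, code e.2]

variable (K n d inp) in
/-- The encoding of the edges of a given kind. -/
noncomputable def passCodes (P : Bool × ℕ) : List ℕ :=
  (List.range (width K (n + 1) (d + K + 1))).flatMap (edgeCodes K n d inp P)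

/-- One iteration of a pass. -/
theorem Run.does_edge (h : Run K R n d θ w B m τ inp) {P : Bool × ℕ} (hP : P ∈ passes K)
    {l : List ℕ} {c : ℕ} (hl : Small K n d B l (c + 2)) {y : ℕ}
    (hy : y < width K (n + 1) (d + K + 1)) :
    Does w (scratch K R θ) (3 * τ + 14)
      (.when (scratch K R θ) (presentE K R P)
        (.seq (emit (scratch K R θ) R (fstE K R P)) (emit (scratch K R θ) R (sndE K R P))))
      (building K R n d inp l y)
      (building K R n d inp (l ++ edgeCodes K n d inp P y) y) ∧
    Small K n d B (l ++ edgeCodes K n d inp P y) c := by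
  have hy' : y ≤ order K (n + 1) (d + K + 1) := hy.le.trans width_le_order
  have hpr := (holds_building (K := K) (R := R) (inp := inp) (n := n) (d := d) l y).eval_presentE
    (inp := fun a => inp.getD a 0) (mem_building l y) hy P
  have he : presentE K R P ∈ exprs K R θ := by
    simp only [exprs, List.mem_append]
    exact .inl (.inl (.inr (List.mem_map_of_mem hP)))
  have he1 : fstE K R P ∈ exprs K R θ := by
    simp only [exprs, List.mem_append]
    exact .inl (.inr (List.mem_map_of_mem hP))
  have he2 : sndE K R P ∈ exprs K R θ := by
    simp only [exprs, List.mem_append]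
    exact .inr (List.mem_map_of_mem hP)
  have hs := h.steps _ he
  have hb := h.bounded_building hl hy' (R := R) (t := scratch K R θ)
  by_cases hc : Present (listBit K n d inp) P (ofRank y : Tup K (n + 1) (d + K + 1))
  · obtain ⟨h1, hl1⟩ := h.does_emit (c := c + 1) hl hy' he1 ((holds_building l y).eval_fstE P)
      (h.code_le (present_lt hP _).1)
    obtain ⟨h2, hl2⟩ := h.does_emit hl1 hy' he2 ((holds_building _ y).eval_sndE hy P)
      (h.code_le (present_lt hP _).2)
    have e : l ++ edgeCodes K n d inp P y =
        l ++ [code (ends P (ofRank y : Tup K (n + 1) (d + K + 1))).1] ++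
          [code (ends P (ofRank y : Tup K (n + 1) (d + K + 1))).2] := by
      simp [edgeCodes, edgeOpt, hc]
    rw [e]
    exact ⟨(does_when_true hb h.two_le h.lt (h.fits he) (hpr.2 hc) (h1.seq h2)).mono (by omega), hl2⟩
  · have e : edgeCodes K n d inp P y = [] := by
      simp [edgeCodes, edgeOpt, hc]
    rw [e, List.append_nil]
    exact ⟨(does_when_false hb h.two_le h.lt (h.fits he) (not_not.1 (mt hpr.1 hc)) (2 * τ) _).mono
      (by omega), hl.le, by have := hl.length; omega⟩

theorem Run.does_pass (h : Run K R n d θ w B m τ inp) {P : Bool × ℕ} (hP : P ∈ passes K)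
    {l : List ℕ} {c : ℕ} (hl : Small K n d B l (c + 2 * width K (n + 1) (d + K + 1))) {y : ℕ}
    (hy : y ≤ order K (n + 1) (d + K + 1)) :
    Does w (scratch K R θ) ((width K (n + 1) (d + K + 1) + 1) * (4 * τ + 22) + 1)
      (passProg (scratch K R θ) K R P) (building K R n d inp l y)
      (building K R n d inp (l ++ passCodes K n d inp P) (width K (n + 1) (d + K + 1))) ∧
    Small K n d B (l ++ passCodes K n d inp P) c := by
  set M := width K (n + 1) (d + K + 1) with hM
  -- `f i` is the list after the labels below `i`. Each label is charged two words of the budget,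
  -- whether or not its edge is present.
  let f : ℕ → List ℕ := fun i => l ++ (List.range i).flatMap (edgeCodes K n d inp P)
  have hf : ∀ i, f (i + 1) = f i ++ edgeCodes K n d inp P i := by
    intro i
    simp [f, List.range_succ]
  have step : ∀ i < M, ∀ c, Small K n d B (f i) (c + 2) →
      Does w (scratch K R θ) (3 * τ + 14)
        (.when (scratch K R θ) (presentE K R P)
          (.seq (emit (scratch K R θ) R (fstE K R P)) (emit (scratch K R θ) R (sndE K R P))))
        (building K R n d inp (f i) i) (building K R n d inp (f (i + 1)) i) ∧
      Small K n d B (f (i + 1)) c := by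
    intro i hi c hs
    rw [hf]
    exact h.does_edge hP hs hi
  have small : ∀ i ≤ M, Small K n d B (f i) (c + 2 * (M - i)) := by
    intro i hi
    induction i with
    | zero => simpa [f] using hl
    | succ i ih =>
      refine (step i hi (c + 2 * (M - (i + 1))) ?_).2
      have := ih (by omega)
      rwa [show c + 2 * (M - i) = c + 2 * (M - (i + 1)) + 2 by omega] at this
  have hMo : M ≤ order K (n + 1) (d + K + 1) := width_le_order
  have hwd : widthE K R ∈ exprs K R θ := by simp [exprs]
  refine ⟨?_, by
    have := small M le_rfl
    rwa [Nat.sub_self, mul_zero, add_zero] at this⟩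
  have := does_upTo (r := R + 4) (n := M) (T := 3 * τ + 14) (lt_scratch (by norm_num)) h.two_le h.lt
    (h.fits hwd) (h.size _ hwd) (building K R n d inp l y)
    (fun i => building K R n d inp (f i) i) (fun i => building K R n d inp (f (i + 1)) i)
    (h.bounded_building hl hy) (by simp [building, setReg_four, f])
    (fun i hi => ⟨h.bounded_building (small i hi) (hi.trans hMo), (holds_building _ i).label,
      (holds_building _ i).eval_widthE⟩)
    (fun i hi => ⟨h.bounded_building (small (i + 1) hi) (hi.le.trans hMo), (holds_building _ i).label,
      by simp [building, setReg_four]⟩)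
    (fun i hi => (step i hi (c + 2 * (M - (i + 1))) (by
      have := small i hi.le
      rwa [show c + 2 * (M - i) = c + 2 * (M - (i + 1)) + 2 by omega] at this)).1)
  refine this.mono ?_
  have hτ := h.steps _ hwd
  exact Nat.add_le_add_right (Nat.mul_le_mul_left _ (by omega)) 1

theorem Run.does_passes (h : Run K R n d θ w B m τ inp) : ∀ {Ps : List (Bool × ℕ)},
    (∀ P ∈ Ps, P ∈ passes K) → ∀ {l : List ℕ} {c y : ℕ},
    Small K n d B l (c + Ps.length * (2 * width K (n + 1) (d + K + 1))) →
    y ≤ order K (n + 1) (d + K + 1) →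
    ∃ y' ≤ order K (n + 1) (d + K + 1),
      Does w (scratch K R θ)
        (Ps.length * ((width K (n + 1) (d + K + 1) + 1) * (4 * τ + 22) + 1) + 1)
        (passesProg (scratch K R θ) K R Ps) (building K R n d inp l y)
        (building K R n d inp (l ++ Ps.flatMap (passCodes K n d inp)) y') ∧
      Small K n d B (l ++ Ps.flatMap (passCodes K n d inp)) c := by
  intro Ps
  induction Ps with
  | nil =>
    intro _ l c y hl hy
    refine ⟨y, hy, ?_, ?_⟩
    · simpa [passesProg] using Does.skip w _ _
    · simpa using hl
  | cons P Ps ih =>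
    intro hPs l c y hl hy
    obtain ⟨h1, hl1⟩ := h.does_pass (hPs P (by simp))
      (c := c + Ps.length * (2 * width K (n + 1) (d + K + 1))) (by
        rw [List.length_cons, add_mul, one_mul] at hl
        rwa [add_assoc]) hy
    obtain ⟨y', hy', h2, hl2⟩ := ih (fun P hP => hPs P (by simp [hP])) hl1 width_le_order
    refine ⟨y', hy', ?_, ?_⟩
    · rw [List.flatMap_cons, ← List.append_assoc]
      refine (h1.seq h2).mono ?_
      rw [List.length_cons, Nat.succ_mul Ps.length]
      omega
    · rwa [List.flatMap_cons, ← List.append_assoc]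

theorem flatMap_passCodes : (passes K).flatMap (passCodes K n d inp) =
    (edges (listBit K n d inp) K).flatMap fun e => [code e.1, code e.2] := by
  simp only [edges, List.flatMap_assoc]
  rfl

theorem graphInput_edgeList : graphInput (edgeList (listBit K n d inp) K) =
    order K (n + 1) (d + K + 1) :: (edges (listBit K n d inp) K).length ::
      (passes K).flatMap (passCodes K n d inp) := by
  rw [flatMap_passCodes, graphInput, edgeList, List.length_map, List.flatMap_map]
  congr 2
  refine List.flatMap_congr fun e he => ?_
  have := (mem_edges.1 he).fst_lt
  simp only [Fin.val_ofNat, Nat.mod_eq_of_lt (code_lt this.1), Nat.mod_eq_of_lt (code_lt this.2)]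

theorem Run.does_init (h : Run K R n d θ w B m τ inp) :
    Does w (scratch K R θ) (4 * τ + 4) (initProg (scratch K R θ) K R) (State.start inp)
      (building K R n d inp [] 0) := by
  have hmem : (State.start inp).mem = memOf inp (2 + (K + 1) * n * d) [] := by
    funext a
    simp only [State.start, memOf, List.getD_nil]
    split_ifs with ha
    · rfl
    · exact List.getD_eq_default _ _ (h.length.trans (not_lt.1 ha))
  have hst : State.start inp = ⟨env R 0 0 0 0 0 0 0, memOf inp (2 + (K + 1) * n * d) []⟩ := by
    rw [← hmem]
    simp only [State.start, State.mk.injEq, and_true]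
    funext r
    simp only [env, Pi.zero_apply]
    split_ifs <;> rfl
  have hroom := h.room
  have hm : ∀ a, memOf inp (2 + (K + 1) * n * d) [] a ≤ B := memOf_le h.le (by simp)
  have hm0 : memOf inp (2 + (K + 1) * n * d) [] 0 = n := by
    exact (if_pos (by omega)).trans h.count
  have hm1 : memOf inp (2 + (K + 1) * n * d) [] 1 = d := by
    exact (if_pos (by omega)).trans h.dim
  have h0 : ∀ r < R, (0 : ℕ → ℕ) r ≤ B := fun _ _ => Nat.zero_le _
  have hz : 0 ≤ B := Nat.zero_le _
  have f1 : Ex.get (Ex.num 0) ∈ exprs K R θ := by simp [exprs]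
  have f2 : Ex.get (Ex.num 1) ∈ exprs K R θ := by simp [exprs]
  have f3 : baseE K R ∈ exprs K R θ := by simp [exprs]
  have f4 : var (R + 2) ∈ exprs K R θ := by simp [exprs]
  have h1 := does_assign (bounded_env (R := R) (t := scratch K R θ) h0 hz hz hz hz hz hz hm)
    h.two_le h.lt (h.fits f1) R
  simp only [setReg_zero, eval_get, eval_num, hm0] at h1
  rw [← hst] at h1
  have h2 := does_assign (bounded_env (R := R) (t := scratch K R θ) h0 h.n_le.1 hz hz hz hz hz hm)
    h.two_le h.lt (h.fits f2) (R + 1)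
  simp only [setReg_one, eval_get, eval_num, hm1] at h2
  have h3 := does_assign (bounded_env (R := R) (t := scratch K R θ) h0 h.n_le.1 h.n_le.2 hz hz hz hz
    hm) h.two_le h.lt (h.fits f3) (R + 2)
  have hbase : 2 + (K + 1) * n * d ≤ B := by omega
  rw [setReg_two, show (baseE K R).eval _ = 2 + (K + 1) * n * d by simp [baseE]] at h3
  have h4 := does_assign (bounded_env (R := R) (t := scratch K R θ) h0 h.n_le.1 h.n_le.2 hbase hz hz
    hz hm) h.two_le h.lt (h.fits f4) (R + 3)
  simp only [setReg_three, eval_var, env_two] at h4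
  have := h.steps _ f1
  have := h.steps _ f2
  have := h.steps _ f3
  have := h.steps _ f4
  exact (h1.seq (h2.seq (h3.seq h4))).mono (by omega)

/-- The configuration in which the layered graph has been written. -/
noncomputable def built (K R n d : ℕ) (inp : List ℕ) (y : ℕ) : State :=
  ⟨env R 0 n d (2 + (K + 1) * n * d)
    (2 + (K + 1) * n * d + (graphInput (edgeList (listBit K n d inp) K)).length) y 0,
    memOf inp (2 + (K + 1) * n * d) (graphInput (edgeList (listBit K n d inp) K))⟩

theorem Run.does_build (h : Run K R n d θ w B m τ inp) :
    (∃ y ≤ order K (n + 1) (d + K + 1),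
      Does w (scratch K R θ) ((12 * K + 6) * (4 * τ + 23) * order K (n + 1) (d + K + 1) + 8 * τ + 20)
        (buildProg (scratch K R θ) K R) (State.start inp) (built K R n d inp y)) ∧
    (∀ x ∈ graphInput (edgeList (listBit K n d inp) K), x ≤ B) ∧
    (graphInput (edgeList (listBit K n d inp) K)).length ≤
      4 * order K (n + 1) (d + K + 1) + 2 := by
  have hroom := h.room
  set N := order K (n + 1) (d + K + 1) with hN
  set M := width K (n + 1) (d + K + 1) with hM
  have hNM : N = (3 * K + 2) * M := rfl
  have hM0 : 0 < M := width_pos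
  have hlen : (passes K).length = 6 * K + 3 := by simp [passes]; omega
  have hsmall : Small K n d B [] ((passes K).length * (2 * M) + 1 + 1) := by
    refine ⟨by simp, ?_⟩
    rw [hlen, List.length_nil, ← hN, hNM]
    have : (6 * K + 3) * (2 * M) = 12 * (K * M) + 6 * M := by ring
    have : 4 * ((3 * K + 2) * M) = 12 * (K * M) + 8 * M := by ring
    omega
  have f1 : orderE K R ∈ exprs K R θ := by simp [exprs]
  have f2 : Ex.num 0 ∈ exprs K R θ := by simp [exprs]
  have f3 : lenCellE R ∈ exprs K R θ := by simp [exprs]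
  have f4 : lenE R ∈ exprs K R θ := by simp [exprs]
  obtain ⟨h1, s1⟩ := h.does_emit hsmall (Nat.zero_le _) f1 (v := N) (by
    simp only [orderE, eval_mul, eval_num, (holds_building [] 0).eval_widthE]
    rfl) (by omega)
  obtain ⟨h2, s2⟩ := h.does_emit s1 (Nat.zero_le _) f2 (v := 0) rfl (Nat.zero_le _)
  obtain ⟨y, hy, h3, s3⟩ := h.does_passes (fun _ hP => hP) (c := 0) (by rwa [zero_add])
    (Nat.zero_le _)
  have h4 := does_write (h.bounded_building s3 hy) h.two_le h.lt (h.fits f3) (h.fits f4)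
  set E := (passes K).flatMap (passCodes K n d inp) with hE
  have hEl : E.length = 2 * (edges (listBit K n d inp) K).length := by
    rw [hE, flatMap_passCodes, List.length_flatMap]
    simp [mul_comm]
  have hfin : (building K R n d inp ([] ++ [N] ++ [0] ++ E) y).setMem
      ((lenCellE R).eval (building K R n d inp ([] ++ [N] ++ [0] ++ E) y))
      ((lenE R).eval (building K R n d inp ([] ++ [N] ++ [0] ++ E) y)) = built K R n d inp y := by
    have e1 : (lenCellE R).eval (building K R n d inp ([] ++ [N] ++ [0] ++ E) y) =
        2 + (K + 1) * n * d + 1 := by simp [lenCellE, building]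
    have e2 : (lenE R).eval (building K R n d inp ([] ++ [N] ++ [0] ++ E) y) =
        (edges (listBit K n d inp) K).length := by
      simp only [lenE, building, eval_div, eval_sub, eval_add, eval_var, eval_num, env_two,
        env_three, List.length_append, List.length_cons, List.length_nil, hEl]
      omega
    rw [e1, e2]
    simp only [State.setMem, building, built, graphInput_edgeList, ← hN, ← hE, State.mk.injEq]
    refine ⟨by simp, ?_⟩
    funext a
    simp only [memOf, Function.update_apply]
    by_cases ha : a < 2 + (K + 1) * n * d
    · simp [ha, show a ≠ 2 + (K + 1) * n * d + 1 by omega]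
    · obtain ⟨b, rfl⟩ := Nat.exists_eq_add_of_le (not_lt.1 ha)
      rcases b with _ | _ | b
      · simp
      · simp
      · simp
  rw [hfin] at h4
  have hEB : E.length ≤ 4 * N := by
    have := s3.length
    simp only [List.length_append, List.length_cons, List.length_nil] at this
    omega
  refine ⟨⟨y, hy, ?_⟩, ?_, ?_⟩
  · refine (h.does_init.seq (h1.seq (h2.seq (h3.seq h4)))).mono ?_
    have := h.steps _ f3
    have := h.steps _ f4
    simp only [hlen, ← hM, ← hN]
    have e : (6 * K + 3) * ((M + 1) * (4 * τ + 22) + 1) ≤ (12 * K + 6) * (4 * τ + 23) * N := by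
      have hMN : M ≤ N := width_le_order
      have : (M + 1) * (4 * τ + 22) + 1 ≤ 2 * (4 * τ + 23) * N := by nlinarith
      calc _ ≤ (6 * K + 3) * (2 * (4 * τ + 23) * N) := Nat.mul_le_mul_left _ this
        _ = _ := by ring
    omega
  · intro x hx
    rw [graphInput_edgeList, ← hN, ← hE, List.mem_cons, List.mem_cons] at hx
    rcases hx with rfl | rfl | hx
    · omega
    · omega
    · exact s3.le x (List.mem_append_right _ hx)
  · rw [graphInput_edgeList, ← hE, List.length_cons, List.length_cons]
    omega

end

end LayeredGraph

/-! ### Reading off the answer, and the complete run of the reduction. -/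

namespace LayeredGraph

open WordRAM.Ex

section

variable {K R n d θ w B m τ : ℕ} {inp : List ℕ}

open Classical in
-- The registers below `R` and the memory are whatever the algorithm left behind; only their
-- boundedness is used. The invariant is that register `R + 5` tells whether one of the sources
-- already inspected reached `θ`.
theorem Run.does_scan (h : Run K R n d θ w B m τ inp) {g M : ℕ → ℕ} (hg : ∀ r < R, g r ≤ B)
    (hM : ∀ a, M a ≤ B) {p y : ℕ} (hp : p ≤ B) (hy : y ≤ order K (n + 1) (d + K + 1)) :
    ∃ s', Does w (scratch K R θ) ((order K (n + 1) (d + K + 1) + 1) * (3 * τ + 11) + 2 * τ + 2)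
      (scanProg (scratch K R θ) K R θ)
      ⟨env R g n d (2 + (K + 1) * n * d) p y 0, M⟩ s' ∧
      (s'.mem 0 ≠ 0 ↔ ∃ i < (n + 1) ^ K, θ ≤ M (2 + (K + 1) * n * d +
        (K * width K (n + 1) (d + K + 1) + i * (d + K + 1) ^ K))) := by
  have hroom := h.room
  have hyB : ∀ y ≤ order K (n + 1) (d + K + 1), y ≤ B := fun y hy => by omega
  have hbase : 2 + (K + 1) * n * d ≤ B := by omega
  let hit : ℕ → Prop := fun i => θ ≤ M (2 + (K + 1) * n * d +
    (K * width K (n + 1) (d + K + 1) + i * (d + K + 1) ^ K))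
  let ans : ℕ → ℕ := fun i => if ∃ j < i, hit j then 1 else 0
  have hans : ∀ i, ans i ≤ B := fun i => by
    have := h.two_le
    simp only [ans]; split_ifs <;> omega
  have hS : ∀ i j, j ≤ order K (n + 1) (d + K + 1) →
      (State.mk (env R g n d (2 + (K + 1) * n * d) p j (ans i)) M).Bounded (scratch K R θ) B :=
    fun i j hj => bounded_env hg h.n_le.1 h.n_le.2 hbase hp (hyB j hj) (hans i) hM
  have hle : (n + 1) ^ K ≤ order K (n + 1) (d + K + 1) :=
    (Nat.le_mul_of_pos_right _ (by positivity)).trans width_le_order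
  have f1 : scanE K R ∈ exprs K R θ := by simp [exprs]
  have f2 : testE K R θ ∈ exprs K R θ := by simp [exprs]
  have f3 : Ex.num 1 ∈ exprs K R θ := by simp [exprs]
  have f4 : Ex.num 0 ∈ exprs K R θ := by simp [exprs]
  have f5 : var (R + 5) ∈ exprs K R θ := by simp [exprs]
  have g1 := h.steps _ f1
  have g2 := h.steps _ f2
  have g3 := h.steps _ f3
  have g4 := h.steps _ f4
  have g5 := h.steps _ f5
  have hh : ∀ i j, Holds R n d j (State.mk (env R g n d (2 + (K + 1) * n * d) p j (ans i)) M) :=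
    fun i j => ⟨env_zero .., env_one .., env_four ..⟩
  have htest : ∀ i j, (testE K R θ).eval
      (State.mk (env R g n d (2 + (K + 1) * n * d) p j (ans i)) M) ≠ 0 ↔ hit j := by
    intro i j
    simp only [testE, eval_lt, eval_num, eval_add, eval_get, eval_mul, eval_var, eval_pow,
      (hh i j).eval_widthE, (hh i j).eval_dimE, env_two, env_four, hit]
    split_ifs <;> simp <;> omega
  have hbody : ∀ i < (n + 1) ^ K, Does w (scratch K R θ) (2 * τ + 3)
      (.when (scratch K R θ) (testE K R θ) (.assign (scratch K R θ) (R + 5) (Ex.num 1)))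
      ⟨env R g n d (2 + (K + 1) * n * d) p i (ans i), M⟩
      ⟨env R g n d (2 + (K + 1) * n * d) p i (ans (i + 1)), M⟩ := by
    intro i hi
    have hb := hS i i (hi.le.trans hle)
    by_cases hc : hit i
    · have h1 := does_assign hb h.two_le h.lt (h.fits f3) (R + 5)
      rw [setReg_five, eval_num] at h1
      have : ans (i + 1) = 1 := if_pos ⟨i, Nat.lt_succ_self i, hc⟩
      rw [this]
      exact (does_when_true hb h.two_le h.lt (h.fits f2) ((htest i i).2 hc) h1).mono (by omega)
    · have : ans (i + 1) = ans i := by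
        have : (∃ j < i + 1, hit j) ↔ ∃ j < i, hit j := by
          constructor
          · rintro ⟨j, hj, hj'⟩
            refine ⟨j, lt_of_le_of_ne (Nat.le_of_lt_succ hj) ?_, hj'⟩
            rintro rfl
            exact hc hj'
          · rintro ⟨j, hj, hj'⟩
            exact ⟨j, by omega, hj'⟩
        simp only [ans, this]
      rw [this]
      exact (does_when_false hb h.two_le h.lt (h.fits f2)
        (not_not.1 (mt (htest i i).1 hc)) 0 _).mono (by omega)
  have hans0 : ans 0 = 0 := if_neg (by simp)
  have hloop := does_upTo (r := R + 4) (n := (n + 1) ^ K) (T := 2 * τ + 3)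
    (lt_scratch (by norm_num)) h.two_le h.lt (h.fits f1) (h.size _ f1)
    ⟨env R g n d (2 + (K + 1) * n * d) p y (ans 0), M⟩
    (fun i => ⟨env R g n d (2 + (K + 1) * n * d) p i (ans i), M⟩)
    (fun i => ⟨env R g n d (2 + (K + 1) * n * d) p i (ans (i + 1)), M⟩)
    (hS 0 y hy) (by rw [setReg_four])
    (fun i hi => ⟨hS i i (hi.trans hle), env_four .., by
      simp only [scanE, eval_pow, (hh i i).eval_countE]⟩)
    (fun i hi => ⟨hS (i + 1) i (hi.le.trans hle), env_four .., by rw [setReg_four]⟩) hbody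
  have hlast := does_write (hS ((n + 1) ^ K) ((n + 1) ^ K) hle) h.two_le h.lt (h.fits f4) (h.fits f5)
  rw [hans0] at hloop
  refine ⟨_, (hloop.seq hlast).mono ?_, ?_⟩
  · have : ((n + 1) ^ K + 1) * (2 * τ + 3 + (scanE K R).steps + 8) ≤
        (order K (n + 1) (d + K + 1) + 1) * (3 * τ + 11) :=
      Nat.mul_le_mul (by omega) (by omega)
    omega
  · simp only [State.setMem, eval_num, eval_var, env_five, Function.update_self]
    simp only [ans]
    split_ifs with hc <;> simpa [hit] using hc

theorem steps_le (K τ : ℕ) {N : ℕ} (hN : 1 ≤ N) :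
    ((12 * K + 6) * (4 * τ + 23) * N + 8 * τ + 20) + ((N + 1) * (3 * τ + 11) + 2 * τ + 2) ≤
      (100 * K + 100) * (τ + 10) * N := by
  obtain ⟨N, rfl⟩ := Nat.exists_eq_add_of_le' hN
  exact Nat.le.intro (k := 52 * K * τ * (N + 1) + 724 * K * (N + 1) + 73 * τ * N + 60 * τ +
    851 * N + 818) (by ring)

/-- The reduction performs the algorithm on the layered graph and inspects its output. -/
theorem Run.runsWithin {p : Prog} (h : Run K p.regBound n d θ w B m τ inp) {v : ℕ} {T : ℝ}
    {Q : (ℕ → ℕ) → Prop} (hv : 2 ^ v ≤ B) (hw : 2 ^ v + (2 + (K + 1) * n * d) ≤ 2 ^ w)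
    (hrun : RunsWithin p v (graphInput (edgeList (listBit K n d inp) K)) T Q) :
    RunsWithin (reduction K θ p) w inp
      (((100 * K + 100) * (τ + 10) * order K (n + 1) (d + K + 1) : ℕ) + 2 * T)
      fun o => ∃ o', Q o' ∧ (o 0 ≠ 0 ↔ ∃ i < (n + 1) ^ K,
        θ ≤ o' (K * width K (n + 1) (d + K + 1) + i * (d + K + 1) ^ K)) := by
  set R := p.regBound with hR
  set t := scratch K R θ with ht
  have hroom := h.room
  obtain ⟨⟨y, hy, hbuild⟩, hgB, hgl⟩ := h.does_build
  obtain ⟨k1, u1, x1, l1, a1⟩ := hbuild (State.start inp) ⟨fun _ _ => rfl, rfl⟩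
  obtain ⟨k, s', hs', hk, hQ⟩ := hrun
  have hreg : ∀ r, (State.start (graphInput (edgeList (listBit K n d inp) K))).reg r < 2 ^ v :=
    fun r => by simp [State.start]
  have hRt : R + 6 ≤ t := by rw [ht]; unfold scratch; omega
  -- Construction leaves the algorithm's registers at `0`, and from the base address on the memory
  -- is the encoded graph followed by zeros. To the relocated program this is a starting
  -- configuration.
  have hrep : Represents R t (2 + (K + 1) * n * d) u1
      (State.start (graphInput (edgeList (listBit K n d inp) K))) u1 := by
    refine ⟨fun r hr => ?_, fun _ _ _ => rfl, fun a => ?_, fun _ _ => rfl⟩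
    · rw [a1.reg r (by omega)]
      simp [built, env, hr, State.start]
    · rw [a1.mem]
      simp [built, memOf, State.start]
  have hbs : u1.reg (R + 2) = 2 + (K + 1) * n * d := by
    rw [a1.reg _ (by omega)]
    exact env_two ..
  obtain ⟨k2, u2, x2, l2, r2⟩ := hs'.relocate hw (by omega : R ≤ R + 2) (by omega : R ≤ t) (by omega)
    hbs le_rfl hreg u1 hrep
  have hs'r := hs'.reg_lt hreg
  have hs'm := hs'.mem_lt (W := B + 1) (by omega) hreg (fun a => Nat.lt_succ_of_le (by
    have := memOf_le (inp := []) (b := 0) (by simp) hgB a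
    simpa [memOf, State.start] using this))
  have hg : ∀ r < R, u2.reg r ≤ B := fun r hr => by
    rw [r2.low r hr]
    exact (hs'r r).le.trans hv
  have hM : ∀ a, u2.mem a ≤ B := by
    intro a
    by_cases ha : a < 2 + (K + 1) * n * d
    · rw [r2.below a ha, a1.mem]
      exact memOf_le h.le hgB a
    · obtain ⟨a, rfl⟩ := Nat.exists_eq_add_of_le (not_lt.1 ha)
      rw [r2.mem]
      exact Nat.le_of_lt_succ (hs'm a)
  obtain ⟨s3, hscan, hans⟩ := h.does_scan hg hM
    (p := 2 + (K + 1) * n * d + (graphInput (edgeList (listBit K n d inp) K)).length) (y := y)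
    (by omega) hy
  obtain ⟨k3, u3, x3, l3, a3⟩ := hscan u2 (by
    refine ⟨fun r hr => ?_, rfl⟩
    -- The variables of the reduction survive the run: the relocated program changes registers only
    -- below `R` and at the scratch register `t`.
    by_cases hrR : r < R
    · simp [env, hrR]
    · rw [r2.high r (not_lt.1 hrR) (by omega), a1.reg r hr]
      simp [built, env, hrR])
  refine ⟨k1 + (k2 + k3), u3, .seq x1 (.seq x2 x3), ?_, s'.mem, hQ, ?_⟩
  · have hN : 1 ≤ order K (n + 1) (d + K + 1) := NeZero.one_le
    have e : k1 + k3 ≤ (100 * K + 100) * (τ + 10) * order K (n + 1) (d + K + 1) :=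
      (Nat.add_le_add l1 l3).trans (steps_le K τ hN)
    have e' : ((k1 + (k2 + k3) : ℕ) : ℝ) = ((k1 + k3 : ℕ) : ℝ) + k2 := by push_cast; ring
    rw [e']
    have h1 : ((k1 + k3 : ℕ) : ℝ) ≤ ((100 * K + 100) * (τ + 10) * order K (n + 1) (d + K + 1) : ℕ) := by
      exact_mod_cast e
    have h2 : (k2 : ℝ) ≤ 2 * k := by exact_mod_cast l2
    linarith
  · rw [a3.mem, hans]
    simp only [r2.mem]

end

end LayeredGraph

/-! ### The encoding of orthogonal vectors instances -/

theorem List.length_flatMap_const {α : Type*} {f : α → List ℕ} {m : ℕ} (hf : ∀ x, (f x).length = m)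
    (l : List α) : (l.flatMap f).length = l.length * m := by
  simp [List.length_flatMap, hf]

theorem List.getD_flatMap_const {α : Type*} {f : α → List ℕ} {m : ℕ} (hf : ∀ x, (f x).length = m) :
    ∀ (l : List α) (i : Fin l.length) {j : ℕ}, j < m →
      (l.flatMap f).getD (i * m + j) 0 = (f l[i]).getD j 0
  | [], i, _, _ => i.elim0
  | x :: l, ⟨0, _⟩, j, hj => by
    rw [List.flatMap_cons, List.getD_append _ _ _ _ (by simp [hf, hj])]
    simp
  | x :: l, ⟨i + 1, hi⟩, j, hj => by
    have := List.getD_flatMap_const hf l ⟨i, by simpa using hi⟩ hj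
    simp only at this
    have e : (i + 1) * m + j = m + (i * m + j) := by ring
    rw [List.flatMap_cons, List.getD_append_right _ _ _ _ (by simp [hf, e])]
    simp only [hf, e, Nat.add_sub_cancel_left, this]
    rfl

section encoding

variable {k n d : ℕ} (A : Fin k → Fin n → Fin d → Bool)

theorem length_ovInput : (ovInput A).length = 2 + k * n * d := by
  simp only [ovInput, List.length_cons]
  rw [List.length_flatMap_const (m := n * d)]
  · simp; ring
  · intro i
    rw [List.length_flatMap_const (m := d)] <;> simp

theorem getD_ovInput (i : Fin k) (j : Fin n) (l : Fin d) :
    (ovInput A).getD (2 + ((i * n + j) * d + l)) 0 = (A i j l).toNat := by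
  have e : 2 + ((i * n + j) * d + (l : ℕ)) = i * (n * d) + (j * d + l) + 1 + 1 := by ring
  have hjl : (j : ℕ) * d + l < n * d := by
    have := j.2
    have := l.2
    nlinarith
  rw [e, ovInput, List.getD_cons_succ, List.getD_cons_succ]
  have h1 := List.getD_flatMap_const (f := fun i => (List.finRange n).flatMap fun j =>
    (List.finRange d).map fun l => (A i j l).toNat) (m := n * d) (fun i => by
      rw [List.length_flatMap_const (m := d)] <;> simp) (List.finRange k)
      ⟨i, by simp⟩ hjl
  have h2 := List.getD_flatMap_const (f := fun j => (List.finRange d).map fun l => (A i j l).toNat)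
    (m := d) (fun i => by simp) (List.finRange n) ⟨j, by simp⟩ l.2
  simp only [Fin.getElem_fin, List.getElem_finRange, Fin.cast_mk, Fin.eta] at h1 h2
  rw [h1, h2]
  simp

theorem le_of_mem_ovInput {x : ℕ} (hx : x ∈ ovInput A) : x ≤ n + d + 1 := by
  simp only [ovInput, List.mem_cons, List.mem_flatMap, List.mem_map] at hx
  rcases hx with rfl | rfl | ⟨_, _, _, _, _, _, rfl⟩
  · omega
  · omega
  · have := Bool.toNat_le (A ‹_› ‹_› ‹_›)
    omega

end encoding

/-! ### Padding the instance preserves the answer. -/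

namespace LayeredGraph

section

variable {K n d : ℕ} (A : Fin (K + 1) → Fin n → Fin d → Bool)

theorem listBit_zero (inp : List ℕ) (p : ℕ) (x : Fin (d + K + 1)) : listBit K n d inp p 0 x :=
  .inl (by simp)

/-- The new coordinate `d + K` vanishes only on original vectors of collection `K`. -/
theorem exists_listBit (inp : List ℕ) :
    ∃ x : Fin (d + K + 1), ∀ p < K, ∀ v, listBit K n d inp p v x :=
  ⟨⟨d + K, by omega⟩, fun p hp v => .inr (.inl ⟨by simp, by simp; omega⟩)⟩

variable {A}

/-- A tuple with the all-ones vector in collection `p₀` has a common `1` at the new coordinate `d +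
p₀`. Any other tuple comes from the original instance and has one among the original coordinates. -/
theorem exists_of_not_hasOrthogonalTuple (h : ¬ HasOrthogonalTuple A) (v : ℕ → Fin (n + 1)) :
    ∃ x, ∀ p ≤ K, listBit K n d (ovInput A) p (v p) x := by
  by_cases h0 : ∃ p ≤ K, v p = 0
  · obtain ⟨p₀, hp₀, hv⟩ := h0
    refine ⟨⟨d + p₀, by omega⟩, fun p hp => ?_⟩
    by_cases hpp : p = p₀
    · rw [hpp, hv]; exact listBit_zero _ _ _
    · exact .inr (.inl ⟨by simp, by simp; omega⟩)
  · push Not at h0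
    have hlt : ∀ p : Fin (K + 1), (v p : ℕ) - 1 < n ∧ (v p : ℕ) ≠ 0 := by
      intro p
      have h1 : (v p : ℕ) ≠ 0 := fun e => h0 p (by omega) (Fin.ext (by simpa using e))
      have := (v p).2
      omega
    unfold HasOrthogonalTuple at h
    push Not at h
    have := h fun p => ⟨(v p : ℕ) - 1, (hlt p).1⟩
    obtain ⟨l, -, hl⟩ := Finset.exists_ne_zero_of_sum_ne_zero this
    rw [Finset.prod_ne_zero_iff] at hl
    refine ⟨⟨l, by omega⟩, fun p hp => .inr (.inr ⟨l.2, ?_⟩)⟩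
    have h1 := hl ⟨p, by omega⟩ (Finset.mem_univ _)
    rwa [← getD_ovInput] at h1

theorem exists_of_hasOrthogonalTuple (h : HasOrthogonalTuple A) :
    ∃ v : ℕ → Fin (n + 1), ∀ x, ∃ p ≤ K, ¬ listBit K n d (ovInput A) p (v p) x := by
  obtain ⟨u, hu⟩ := h
  refine ⟨fun p => if h : p < K + 1 then (u ⟨p, h⟩).succ else 0, fun x => ?_⟩
  by_cases hx : (x : ℕ) < d
  · have := Finset.sum_eq_zero_iff.1 hu ⟨x, hx⟩ (Finset.mem_univ _)
    obtain ⟨p, -, hp⟩ := Finset.prod_eq_zero_iff.1 this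
    have hp' := p.2
    refine ⟨p, by omega, ?_⟩
    beta_reduce
    rw [dif_pos p.2]
    rintro (h1 | h1 | h1)
    · simp at h1
    · omega
    · rw [← getD_ovInput] at hp
      refine h1.2 ?_
      rw [Fin.val_succ, Nat.add_sub_cancel]
      exact hp
  -- At a new coordinate `x` the vector from collection `x - d` is `0`, as no vector of this tuple
  -- is a padding one.
  · refine ⟨x - d, by omega, ?_⟩
    rintro (h1 | h1 | h1)
    · have : (x : ℕ) - d < K + 1 := by omega
      simp [this] at h1
    · omega
    · omega

/-- The outputs at the sources decide the instance. -/
theorem exists_output_iff (hK : K ≠ 0) {θ : ℕ} {o : ℕ → ℕ}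
    (ho : ∀ v : Fin (order K (n + 1) (d + K + 1)),
      ((graph (listBit K n d (ovInput A)) K).eccent v ≤ (2 * K + 1 : ℕ) → o v < θ) ∧
      ((4 * K + 1 : ℕ) ≤ (graph (listBit K n d (ovInput A)) K).eccent v → θ ≤ o v)) :
    (∃ i < (n + 1) ^ K, θ ≤ o (K * width K (n + 1) (d + K + 1) + i * (d + K + 1) ^ K)) ↔
      HasOrthogonalTuple A := by
  have hsrc : ∀ a : Fin K → Fin (n + 1), (source K (n + 1) (d + K + 1) a : ℕ) =
      K * width K (n + 1) (d + K + 1) + (∑ q, (a q : ℕ) * (n + 1) ^ (q : ℕ)) * (d + K + 1) ^ K := by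
    intro a
    rw [source, Fin.val_ofNat, Nat.mod_eq_of_lt (code_lt (by simp only; omega))]
    simp [code, rank]
  constructor
  · rintro ⟨i, hi, hθ⟩
    by_contra hno
    have h := (ho (source K (n + 1) (d + K + 1) fun q => Fin.ofNat (n + 1) (i / (n + 1) ^ (q : ℕ)))).1
      (eccent_source_le (listBit_zero _) (exists_of_not_hasOrthogonalTuple hno) hK _)
    rw [hsrc, sum_digits hi] at h
    omega
  · intro hyes
    obtain ⟨v, hv⟩ := exists_of_hasOrthogonalTuple hyes
    have h := (ho _).2 (le_eccent_source (listBit_zero _) hv hK)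
    rw [hsrc] at h
    exact ⟨_, sum_digits_lt _, h⟩

end

/-! ### Word sizes -/

/-- Functions that are bounded by a power of the size of the instance. -/
def LogBounded (f : ℕ → ℕ → ℕ) : Prop :=
  ∃ a, ∀ n d, 1 ≤ n → 1 ≤ d → f n d ≤ 2 ^ (a * (Nat.log 2 (n * d) + 1))

theorem LogBounded.const (c : ℕ) : LogBounded fun _ _ => c :=
  ⟨c, fun n d _ _ => Nat.lt_two_pow_self.le.trans
    (Nat.pow_le_pow_right (by norm_num) (Nat.le_mul_of_pos_right _ (by omega)))⟩

theorem LogBounded.mul {f g : ℕ → ℕ → ℕ} (hf : LogBounded f) (hg : LogBounded g) :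
    LogBounded fun n d => f n d * g n d := by
  obtain ⟨a, ha⟩ := hf
  obtain ⟨b, hb⟩ := hg
  refine ⟨a + b, fun n d hn hd => ?_⟩
  rw [add_mul, pow_add]
  exact Nat.mul_le_mul (ha n d hn hd) (hb n d hn hd)

theorem LogBounded.add {f g : ℕ → ℕ → ℕ} (hf : LogBounded f) (hg : LogBounded g) :
    LogBounded fun n d => f n d + g n d := by
  obtain ⟨a, ha⟩ := hf
  obtain ⟨b, hb⟩ := hg
  refine ⟨a + b + 1, fun n d hn hd => ?_⟩
  set L := Nat.log 2 (n * d) + 1 with hL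
  have h1 : f n d ≤ 2 ^ ((a + b) * L) := (ha n d hn hd).trans
    (Nat.pow_le_pow_right (by norm_num) (Nat.mul_le_mul_right _ (by omega)))
  have h2 : g n d ≤ 2 ^ ((a + b) * L) := (hb n d hn hd).trans
    (Nat.pow_le_pow_right (by norm_num) (Nat.mul_le_mul_right _ (by omega)))
  have h3 : 2 ^ ((a + b) * L + 1) ≤ 2 ^ ((a + b + 1) * L) :=
    Nat.pow_le_pow_right (by norm_num) (by rw [add_mul (a + b), one_mul]; omega)
  rw [pow_succ] at h3
  show f n d + g n d ≤ _
  omega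

theorem LogBounded.pow {f : ℕ → ℕ → ℕ} (hf : LogBounded f) (m : ℕ) :
    LogBounded fun n d => f n d ^ m := by
  induction m with
  | zero => simpa using LogBounded.const 1
  | succ m ih => simpa only [pow_succ] using ih.mul hf

theorem LogBounded.fst : LogBounded fun n _ => n :=
  ⟨1, fun n d hn hd => by
    rw [one_mul]
    exact (Nat.le_mul_of_pos_right n hd).trans (Nat.lt_pow_succ_log_self (by norm_num) _).le⟩

theorem LogBounded.snd : LogBounded fun _ d => d :=
  ⟨1, fun n d hn hd => by
    rw [one_mul]
    exact (Nat.le_mul_of_pos_left d hn).trans (Nat.lt_pow_succ_log_self (by norm_num) _).le⟩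

/-- The numbers in the algorithm's words, which are logarithmic in the number of vertices, remain
polynomial in `n * d`. -/
theorem LogBounded.wordSize {f : ℕ → ℕ → ℕ} (hf : LogBounded f) (c : ℕ) :
    LogBounded fun n d => 2 ^ wordSize c (f n d) := by
  obtain ⟨a, ha⟩ := hf
  refine ⟨c * (a + 1), fun n d hn hd => Nat.pow_le_pow_right (by norm_num) ?_⟩
  have h1 := Nat.log_mono_right (b := 2) (ha n d hn hd)
  rw [Nat.log_pow (by norm_num)] at h1
  rw [WordRAM.wordSize, mul_assoc]
  refine Nat.mul_le_mul_left c ?_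
  rw [add_mul, one_mul]
  omega

theorem LogBounded.exists_lt {f : ℕ → ℕ → ℕ} (hf : LogBounded f) :
    ∃ c, ∀ n d, 1 ≤ n → 1 ≤ d → f n d < 2 ^ WordRAM.wordSize c (n * d) := by
  obtain ⟨a, ha⟩ := hf
  refine ⟨a + 1, fun n d hn hd => (ha n d hn hd).trans_lt
    (Nat.pow_lt_pow_right (by norm_num) ?_)⟩
  rw [WordRAM.wordSize]
  exact Nat.mul_lt_mul_of_pos_right (by omega) (by omega)

theorem logBounded_order (K : ℕ) : LogBounded fun n d => order K (n + 1) (d + K + 1) :=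
  (LogBounded.const _).mul (((LogBounded.fst.add (.const 1)).pow K).mul
    (((LogBounded.snd.add (.const K)).add (.const 1)).pow K))

/-! ### The reduction -/

/-- An algorithm that distinguishes small from large eccentricities in sparse graphs leads to an
algorithm for orthogonal vectors. -/
theorem exists_program {K C θ : ℕ} (hK : K ≠ 0) (hC : 2 ≤ C) {task : GraphTask}
    (htask : ∀ (n : ℕ) (G : SimpleGraph (Fin n)) (o : ℕ → ℕ), G.Connected → task n G o → ∀ v,
      (G.eccent v ≤ (2 * K + 1 : ℕ) → o v < θ) ∧ ((4 * K + 1 : ℕ) ≤ G.eccent v → θ ≤ o v))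
    {T : ℕ → ℝ} (hT : SolvableOnSparse C task T) :
    ∃ (p : Prog) (c : ℕ) (a : ℕ), ∀ n d : ℕ, 1 ≤ n → 1 ≤ d →
      ∀ A : Fin (K + 1) → Fin n → Fin d → Bool,
        RunsWithin p (wordSize c (n * d)) (ovInput A)
          (a * order K (n + 1) (d + K + 1) + 2 * T (order K (n + 1) (d + K + 1)))
          (fun out => out 0 ≠ 0 ↔ HasOrthogonalTuple A) := by
  obtain ⟨p, c, hp⟩ := hT
  set E := exprs K p.regBound θ with hE
  let nb := (E.map Ex.numBound).sum
  let m := (E.map fun e => e.size + 2).sum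
  let τ := (E.map Ex.steps).sum
  have hle : ∀ (f : Ex → ℕ), ∀ e ∈ E, f e ≤ (E.map f).sum := fun f e he =>
    List.single_le_sum (fun _ _ => Nat.zero_le _) _ (List.mem_map_of_mem he)
  -- The three summands accommodate the values in the algorithm's registers, the addresses and
  -- contents of the memory, and the numerals of the reduction.
  let B : ℕ → ℕ → ℕ := fun n d => 2 ^ wordSize c (order K (n + 1) (d + K + 1)) +
    (2 + (K + 1) * n * d + 4 * order K (n + 1) (d + K + 1) + 4) + nb
  have hB : LogBounded fun n d => B n d ^ m :=
    ((((logBounded_order K).wordSize c).add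
      ((((LogBounded.const 2).add (((LogBounded.const _).mul .fst).mul .snd)).add
        ((LogBounded.const 4).mul (logBounded_order K))).add (.const 4))).add (.const nb)).pow m
  obtain ⟨c', hc'⟩ := hB.exists_lt
  refine ⟨reduction K θ p, c', (100 * K + 100) * (τ + 10), fun n d hn hd A => ?_⟩
  have hnd : n + d ≤ (K + 1) * n * d + 1 := by
    have : n * d ≤ (K + 1) * n * d := Nat.mul_le_mul_right _ (Nat.le_mul_of_pos_left _ (by omega))
    nlinarith
  have hrun : Run K p.regBound n d θ (wordSize c' (n * d)) (B n d) m τ (ovInput A) := by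
    refine ⟨(length_ovInput A).le, rfl, rfl, fun x hx => ?_, fun e he => ?_, hle _, hle _, ?_,
      hc' n d hn hd, ?_⟩
    · have := le_of_mem_ovInput A hx
      simp only [B]
      generalize 2 ^ wordSize c _ = P
      omega
    · exact (hle _ e he).trans (Nat.le_add_left _ _)
    · simp only [B]
      generalize 2 ^ wordSize c _ = P
      omega
    · simp only [B]
      generalize 2 ^ wordSize c _ = P
      omega
  have hm : m ≠ 0 := by
    have := hle (fun e => e.size + 2) (Ex.num 0) (by simp [hE, exprs])
    simp only [m]
    omega
  have hw : 2 ^ wordSize c (order K (n + 1) (d + K + 1)) + (2 + (K + 1) * n * d) ≤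
      2 ^ wordSize c' (n * d) := by
    refine le_trans ?_ ((Nat.le_self_pow hm (B n d)).trans (hc' n d hn hd).le)
    simp only [B]
    omega
  have hcon := connected_graph (K := K) (listBit_zero (K := K) (n := n) (d := d) (ovInput A))
    (exists_listBit _) hK
  have hlen : (edgeList (listBit K n d (ovInput A)) K).length ≤ C * order K (n + 1) (d + K + 1) := by
    rw [edgeList, List.length_map]
    refine length_edges_le.trans (le_trans ?_ (Nat.mul_le_mul_right _ hC))
    rw [order, ← mul_assoc]
    exact Nat.mul_le_mul_right _ (by omega)
  have h := hrun.runsWithin (Nat.le_add_right _ _ |>.trans (Nat.le_add_right _ _)) hw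
    (hp _ _ _ hcon (isEdgeList_edgeList (listBit_zero _) hK) hlen)
  obtain ⟨t, s, hs, ht, o, ho, hso⟩ := h
  refine ⟨t, s, hs, by push_cast at ht ⊢; exact ht, ?_⟩
  show s.mem 0 ≠ 0 ↔ _
  rw [hso]
  exact exists_output_iff hK (htask _ _ o hcon ho)

/-- The padding costs only a constant depending on `K`, by `n + 1 ≤ 2n` and `d + K + 1 ≤ (K + 2) d`.
-/
theorem order_le (K : ℕ) {n d : ℕ} (hn : 1 ≤ n) (hd : 1 ≤ d) :
    order K (n + 1) (d + K + 1) ≤ (3 * K + 2) * (2 ^ K * (K + 2) ^ K) * (n ^ K * d ^ K) := by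
  have h1 : (n + 1) ^ K ≤ (2 * n) ^ K := Nat.pow_le_pow_left (by omega) K
  have h2 : (d + K + 1) ^ K ≤ ((K + 2) * d) ^ K := Nat.pow_le_pow_left (by nlinarith) K
  calc order K (n + 1) (d + K + 1) ≤ (3 * K + 2) * ((2 * n) ^ K * ((K + 2) * d) ^ K) :=
        Nat.mul_le_mul_left _ (Nat.mul_le_mul h1 h2)
    _ = _ := by rw [mul_pow, mul_pow]; ring

/-- Under the orthogonal vectors conjecture, there is no fast algorithm that distinguishes small from
large eccentricities in sparse graphs. -/
theorem not_solvableOnSparse {K C θ : ℕ} (hK : K ≠ 0) (hOV : KOVConjecture (K + 1)) (hC : 2 ≤ C)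
    {task : GraphTask}
    (htask : ∀ (n : ℕ) (G : SimpleGraph (Fin n)) (o : ℕ → ℕ), G.Connected → task n G o → ∀ v,
      (G.eccent v ≤ (2 * K + 1 : ℕ) → o v < θ) ∧ ((4 * K + 1 : ℕ) ≤ G.eccent v → θ ≤ o v))
    {T : ℕ → ℝ} {c ε : ℝ} (hε : 0 < ε)
    (hT : ∀ n : ℕ, 1 ≤ n → T n ≤ c * (n : ℝ) ^ (1 + 1 / (K : ℝ) - ε)) :
    ¬ SolvableOnSparse C task T := by
  intro hsol
  obtain ⟨p, w, a, hp⟩ := exists_program hK hC htask hsol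
  have hK0 : (0 : ℝ) < K := by exact_mod_cast Nat.pos_of_ne_zero hK
  -- Capping at `1/K` keeps the exponent `e` at least `1`, so that the linear cost of the
  -- construction is absorbed.
  set δ := min ε (1 / (K : ℝ)) with hδ
  have hδ0 : 0 < δ := lt_min hε (by positivity)
  set e : ℝ := 1 + 1 / (K : ℝ) - δ with he
  have he1 : 1 ≤ e := by have := min_le_right ε (1 / (K : ℝ)); linarith
  have hKe : (K : ℝ) * e = ((K + 1 : ℕ) : ℝ) - K * δ := by
    rw [he]; push_cast; field_simp
  set c₀ : ℕ := (3 * K + 2) * (2 ^ K * (K + 2) ^ K) with hc₀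
  have hc : 0 ≤ |c| := abs_nonneg c
  -- The constant `c` may be negative, hence `|c|`. The degree `K + 1` in `d` suffices because `K *
  -- e ≤ K + 1`.
  refine hOV (K * δ) (by positivity) ⟨p, w, (a + 2 * |c|) * (c₀ : ℝ) ^ e, K + 1,
    fun n d hn hd A => ?_⟩
  obtain ⟨t, s, hs, ht, hQ⟩ := hp n d hn hd A
  refine ⟨t, s, hs, ht.trans ?_, hQ⟩
  set N := order K (n + 1) (d + K + 1) with hN
  have hN1 : (1 : ℝ) ≤ N := by exact_mod_cast (NeZero.one_le : 1 ≤ N)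
  have hn1 : (1 : ℝ) ≤ n := by exact_mod_cast hn
  have hd1 : (1 : ℝ) ≤ d := by exact_mod_cast hd
  have h1 : (N : ℝ) ≤ (N : ℝ) ^ e := by
    simpa using Real.rpow_le_rpow_of_exponent_le hN1 he1
  have h2 : T N ≤ |c| * (N : ℝ) ^ e := by
    refine (hT N (NeZero.one_le)).trans (mul_le_mul (le_abs_self c) ?_ (by positivity) hc)
    exact Real.rpow_le_rpow_of_exponent_le hN1 (by have := min_le_left ε (1 / (K : ℝ)); linarith)
  have h3 : (N : ℝ) ≤ c₀ * ((n : ℝ) ^ K * (d : ℝ) ^ K) := by exact_mod_cast order_le K hn hd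
  have h4 : (N : ℝ) ^ e ≤ (c₀ : ℝ) ^ e * ((n : ℝ) ^ (((K + 1 : ℕ) : ℝ) - K * δ) * (d : ℝ) ^ (K + 1)) := by
    refine (Real.rpow_le_rpow (by positivity) h3 (by linarith)).trans ?_
    rw [Real.mul_rpow (by positivity) (by positivity), Real.mul_rpow (by positivity) (by positivity),
      ← Real.rpow_natCast (n : ℝ) K, ← Real.rpow_natCast (d : ℝ) K, ← Real.rpow_mul (by positivity),
      ← Real.rpow_mul (by positivity), hKe, ← Real.rpow_natCast (d : ℝ) (K + 1)]
    gcongr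
    have : 0 ≤ K * δ := by positivity
    linarith
  calc (a : ℝ) * N + 2 * T N ≤ (a + 2 * |c|) * (N : ℝ) ^ e := by
        have : (a : ℝ) * N ≤ a * (N : ℝ) ^ e := mul_le_mul_of_nonneg_left h1 (by positivity)
        linarith
    _ ≤ (a + 2 * |c|) * ((c₀ : ℝ) ^ e *
          ((n : ℝ) ^ (((K + 1 : ℕ) : ℝ) - K * δ) * (d : ℝ) ^ (K + 1))) :=
        mul_le_mul_of_nonneg_left h4 (by positivity)
    _ = _ := by ring

/-! ### Approximation algorithms -/

theorem eccent_ne_top {n : ℕ} {G : SimpleGraph (Fin n)} (hG : G.Connected) (v : Fin n) :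
    G.eccent v ≠ ⊤ := by
  obtain ⟨u, hu⟩ := G.exists_edist_eq_eccent_of_finite v
  rw [← hu]
  exact SimpleGraph.edist_ne_top_iff_reachable.2 (hG.preconnected v u)

/-- The threshold is `4K + 1`: an estimate for a small eccentricity is at most `ρ (2K + 1)` if `ρ ≥
0` and at most `0` otherwise. Finiteness of eccentricities makes `toNat` faithful. -/
theorem eccApproxAbove_gap {K : ℕ} {ρ : ℝ} (hρ : ρ * (2 * K + 1) < 4 * K + 1) (n : ℕ)
    (G : SimpleGraph (Fin n)) (o : ℕ → ℕ) (hG : G.Connected) (h : eccApproxAbove ρ n G o)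
    (v : Fin n) : (G.eccent v ≤ (2 * K + 1 : ℕ) → o v < 4 * K + 1) ∧
      ((4 * K + 1 : ℕ) ≤ G.eccent v → 4 * K + 1 ≤ o v) := by
  obtain ⟨h1, h2⟩ := h v
  obtain ⟨x, hx⟩ := ENat.ne_top_iff_exists.1 (eccent_ne_top hG v)
  rw [← hx] at h1 h2 ⊢
  simp only [ENat.toNat_natCast] at h1 h2
  refine ⟨fun h => ?_, fun h => ?_⟩
  · have h3 : (x : ℝ) ≤ 2 * K + 1 := by exact_mod_cast h
    have : (o v : ℝ) < 4 * K + 1 := by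
      rcases le_or_gt 0 ρ with h0 | h0
      · exact h2.trans_lt ((mul_le_mul_of_nonneg_left h3 h0).trans_lt hρ)
      · exact h2.trans_lt ((mul_nonpos_of_nonpos_of_nonneg h0.le (by positivity)).trans_lt
          (by positivity))
    exact_mod_cast this
  · have h3 : 4 * K + 1 ≤ x := by exact_mod_cast h
    exact h3.trans (by exact_mod_cast h1)

/-- The threshold is `2K + 2`: an estimate of at most `2K + 1` for an eccentricity of at least `4K +
1` would force `ρ (2K + 1) ≥ 4K + 1`. -/
theorem eccApproxBelow_gap {K : ℕ} {ρ : ℝ} (hρ : ρ * (2 * K + 1) < 4 * K + 1) (n : ℕ)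
    (G : SimpleGraph (Fin n)) (o : ℕ → ℕ) (hG : G.Connected) (h : eccApproxBelow ρ n G o)
    (v : Fin n) : (G.eccent v ≤ (2 * K + 1 : ℕ) → o v < 2 * K + 2) ∧
      ((4 * K + 1 : ℕ) ≤ G.eccent v → 2 * K + 2 ≤ o v) := by
  obtain ⟨h1, h2⟩ := h v
  obtain ⟨x, hx⟩ := ENat.ne_top_iff_exists.1 (eccent_ne_top hG v)
  rw [← hx] at h1 h2 ⊢
  simp only [ENat.toNat_natCast] at h1 h2
  refine ⟨fun h => ?_, fun h => ?_⟩
  · have h3 : x ≤ 2 * K + 1 := by exact_mod_cast h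
    have h4 : o v ≤ x := by exact_mod_cast h1
    omega
  · have h3 : (4 * K + 1 : ℝ) ≤ x := by exact_mod_cast h
    by_contra hlt
    have h4 : (o v : ℝ) ≤ 2 * K + 1 := by exact_mod_cast (by omega : o v ≤ 2 * K + 1)
    rcases le_or_gt 0 ρ with h0 | h0
    · have := mul_le_mul_of_nonneg_left h4 h0
      linarith
    · have : ρ * o v ≤ 0 := mul_nonpos_of_nonpos_of_nonneg h0.le (by positivity)
      have : (0 : ℝ) ≤ K := by positivity
      linarith

/-- Eventually `g n < η`; the finitely many earlier values go into the constant. -/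
theorem exists_bound_of_tendsto {g : ℕ → ℝ} (hg : Tendsto g atTop (𝓝 0)) {η : ℝ} (hη : 0 < η)
    (c : ℝ) : ∃ c', ∀ n : ℕ, 1 ≤ n → c * (n : ℝ) ^ (1 + g n) ≤ c' * (n : ℝ) ^ (1 + η) := by
  obtain ⟨n₀, hn₀⟩ := eventually_atTop.1 (hg.eventually (gt_mem_nhds hη))
  have hs : ∀ i : ℕ, (0 : ℝ) ≤ (i : ℝ) ^ (1 + g i) := fun i => by positivity
  refine ⟨|c| * (1 + ∑ i ∈ Finset.range n₀, (i : ℝ) ^ (1 + g i)), fun n hn => ?_⟩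
  have hn1 : (1 : ℝ) ≤ n := by exact_mod_cast hn
  have hsum : 0 ≤ ∑ i ∈ Finset.range n₀, (i : ℝ) ^ (1 + g i) := Finset.sum_nonneg fun i _ => hs i
  have h1 : (1 : ℝ) ≤ (n : ℝ) ^ (1 + η) := Real.one_le_rpow hn1 (by linarith)
  have key : (n : ℝ) ^ (1 + g n) ≤
      (1 + ∑ i ∈ Finset.range n₀, (i : ℝ) ^ (1 + g i)) * (n : ℝ) ^ (1 + η) := by
    by_cases h : n₀ ≤ n
    · have h2 := Real.rpow_le_rpow_of_exponent_le hn1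
        (show 1 + g n ≤ 1 + η by linarith [hn₀ n h])
      nlinarith
    · have h2 := Finset.single_le_sum (fun i _ => hs i) (Finset.mem_range.2 (not_le.1 h))
      nlinarith
  calc c * (n : ℝ) ^ (1 + g n) ≤ |c| * (n : ℝ) ^ (1 + g n) :=
        mul_le_mul_of_nonneg_right (le_abs_self c) (hs n)
    _ ≤ |c| * ((1 + ∑ i ∈ Finset.range n₀, (i : ℝ) ^ (1 + g i)) * (n : ℝ) ^ (1 + η)) :=
        mul_le_mul_of_nonneg_left key (abs_nonneg c)
    _ = _ := by ring

end LayeredGraph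

/-! ### The three lower bounds. -/

theorem mainTheorem5 :
    -- the gap problem needs time `n ^ (1 + 1/(k-1) - o(1))` under the `k`-OV conjecture
    (∀ k : ℕ, 2 ≤ k → KOVConjecture k →
      ∀ C : ℕ, 2 ≤ C → ∀ ε : ℝ, 0 < ε →
        ¬ ∃ K : ℝ, SolvableOnSparse C (eccGap (2 * k - 1) (4 * k - 3))
          (fun n => K * (n : ℝ) ^ (1 + 1 / ((k : ℝ) - 1) - ε))) ∧
    -- no `(9/5 - ε)`-approximation in time `O(n ^ (3/2 - δ))`
    (KOVConjecture 3 →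
      ∀ C : ℕ, 2 ≤ C → ∀ ε δ : ℝ, 0 < ε → 0 < δ →
        (¬ ∃ K : ℝ, SolvableOnSparse C (eccApproxAbove (9 / 5 - ε))
          (fun n => K * (n : ℝ) ^ (3 / 2 - δ))) ∧
        (¬ ∃ K : ℝ, SolvableOnSparse C (eccApproxBelow (9 / 5 - ε))
          (fun n => K * (n : ℝ) ^ (3 / 2 - δ)))) ∧
    -- no `(2 - ε)`-approximation in time `n ^ (1 + o(1))`
    ((∀ k : ℕ, 2 ≤ k → KOVConjecture k) →
      ∀ C : ℕ, 2 ≤ C → ∀ ε : ℝ, 0 < ε →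
        ∀ g : ℕ → ℝ, Tendsto g atTop (𝓝 0) →
          (¬ ∃ K : ℝ, SolvableOnSparse C (eccApproxAbove (2 - ε))
            (fun n => K * (n : ℝ) ^ (1 + g n))) ∧
          (¬ ∃ K : ℝ, SolvableOnSparse C (eccApproxBelow (2 - ε))
            (fun n => K * (n : ℝ) ^ (1 + g n)))) := by

  refine ⟨fun k hk hOV C hC ε hε => ?_, fun hOV C hC ε δ hε hδ => ?_,
    fun hOV C hC ε hε g hg => ?_⟩
  · obtain ⟨K, rfl⟩ := Nat.exists_eq_add_of_le' (show 1 ≤ k by omega)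
    rintro ⟨c, h⟩
    refine LayeredGraph.not_solvableOnSparse (K := K) (θ := 1) (c := c) (by omega) hOV hC
      (fun n G o _ ho v => ?_) hε (fun n _ => ?_) h
    · have := ho v
      rw [show 2 * (K + 1) - 1 = 2 * K + 1 by omega, show 4 * (K + 1) - 3 = 4 * K + 1 by omega] at this
      exact ⟨fun h => by rw [this.1 h]; exact Nat.one_pos,
        fun h => Nat.one_le_iff_ne_zero.2 (this.2 h)⟩
    · simp
  -- `K = 2`: the gap is between eccentricities `5` and `9`.
  · have hρ : (9 / 5 - ε) * (2 * (2 : ℕ) + 1) < 4 * (2 : ℕ) + 1 := by push_cast; linarith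
    have hT : ∀ c : ℝ, ∀ n : ℕ, 1 ≤ n → c * (n : ℝ) ^ (3 / 2 - δ) ≤
        c * (n : ℝ) ^ (1 + 1 / ((2 : ℕ) : ℝ) - δ) := fun c n _ => by norm_num
    constructor
    · rintro ⟨c, h⟩
      exact LayeredGraph.not_solvableOnSparse (by norm_num) hOV hC
        (LayeredGraph.eccApproxAbove_gap hρ) hδ (hT c) h
    · rintro ⟨c, h⟩
      exact LayeredGraph.not_solvableOnSparse (by norm_num) hOV hC
        (LayeredGraph.eccApproxBelow_gap hρ) hδ (hT c) h
  -- The ratio `(4K + 1)/(2K + 1)` equals `2 - 1/(2K + 1)`, which exceeds `2 - ε` once `K ε > 1`.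
  · obtain ⟨K, hK⟩ := exists_nat_gt (1 / ε)
    have hK0 : (0 : ℝ) < K := lt_trans (by positivity) hK
    have hKne : K ≠ 0 := by rintro rfl; simp at hK0
    have hεK : 1 < K * ε := (div_lt_iff₀ hε).1 hK
    have hρ : (2 - ε) * (2 * K + 1) < 4 * K + 1 := by nlinarith
    -- Half of the available `1/K` bounds the `o(1)` in the exponent, and the other half is the
    -- saving that contradicts the lower bound.
    have hη : (0 : ℝ) < 1 / (2 * K) := by positivity
    have hT : ∀ c : ℝ, ∃ c', ∀ n : ℕ, 1 ≤ n → c * (n : ℝ) ^ (1 + g n) ≤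
        c' * (n : ℝ) ^ (1 + 1 / (K : ℝ) - 1 / (2 * K)) := by
      intro c
      rw [show 1 + 1 / (K : ℝ) - 1 / (2 * K) = 1 + 1 / (2 * K) by field_simp; ring]
      exact LayeredGraph.exists_bound_of_tendsto hg hη c
    constructor
    · rintro ⟨c, h⟩
      obtain ⟨c', hc'⟩ := hT c
      exact LayeredGraph.not_solvableOnSparse hKne (hOV (K + 1) (by omega)) hC
        (LayeredGraph.eccApproxAbove_gap hρ) hη hc' h
    · rintro ⟨c, h⟩
      obtain ⟨c', hc'⟩ := hT c
      exact LayeredGraph.not_solvableOnSparse hKne (hOV (K + 1) (by omega)) hC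
        (LayeredGraph.eccApproxBelow_gap hρ) hη hc' h
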